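/- Let $R$ be a commutative ring and let $\psi:\mathbb Z[x_1,\dots,x_n]\to R$ be étale; write $x_i$ also for $\psi(x_i)$. For each prime $p$ let $R_p$ be the $p$-adic completion of $R$, let $R_q=R[\![q-1]\!]$, and let $R_{q,p}=R_p[\![q-1]\!]$ be the $p$-adic completion of $R_q$. Let $B$ be $R_q$ or $R_{q,p}$. Let $\delta_0: B\to B[\![\epsilon_1,\dots,\epsilon_n]\!]$ be the unique $\mathbb Z[\![q-1]\!]$-algebra homomorphism that lifts the identity modulo $(\epsilon_1,\dots,\epsilon_n)$ and satisfies $\delta_0(x_i)=x_i+\epsilon_i$; let $J=(q-1,\epsilon_1,\dots,\epsilon_n)$, and set $$\mathrm{Diff}^\wedge_{(q-1)}(B,B)=\{s\in \mathrm{Hom}_B(B[\![\epsilon_1,\dots,\epsilon_n]\!],B)\mid \lim_k s(J^k)=0\ (q-1)\text{-adically}\}.$$ It is an algebra, with the product $t\circ s$ determined by $(t\circ s)\circ\delta_0=(t\circ\delta_0)\circ(s\circ\delta_0)$; its unit $1$ is given by $\epsilon_i\mapsto 0$. Let $\nabla_{x_i,q}\in \mathrm{Diff}^\wedge_{(q-1)}(B,B)$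 be the $q$-derivative: $\nabla_{x_i,q}\circ\delta_0=(\gamma_i-\mathrm{id})/((q-1)x_i)$, where $\gamma_i$ is the $\mathbb Z[\![q-1]\!]$-algebra automorphism of $B$ that is the identity modulo $q-1$, sends $x_i$ to $qx_i$ and fixes $x_j$ for $j\ne i$; equivalently $\nabla_{x_i,q}(\epsilon_i^k)=((q-1)x_i)^{k-1}$ for $k\ge 1$, and all other monomials in the $\epsilon_j$ are sent to $0$. For $I\in\mathbb Z_{\ge0}^n$ put $\nabla^I_{\psi,q}=\prod_k\nabla_{x_k,q}^{I_k}$. Let $\mathcal A_\psi\subset \mathrm{Diff}^\wedge_{(q-1)}(R_q,R_q)$ and $\mathcal A_{\psi,p}\subset \mathrm{Diff}^\wedge_{(q-1)}(R_{q,p},R_{q,p})$ be the sets of all sums $\sum_I a_I\nabla^I_{\psi,q}$ with $a_I\in B$ and $\lim_I a_I=0$ $(q-1)$-adically. Let $s\mapsto s_p$, $\mathrm{Diff}^\wedge_{(q-1)}(R_q,R_q)\to \mathrm{Diff}^\wedge_{(q-1)}(R_{q,p},R_{q,p})$, be the $p$-adic completion map; $s_p(\epsilon^I)$ is the image of $s(\epsilon^I)$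 for every monomial $\epsilon^I$. (1) The natural $R_q$-linear map $$\mathrm{Diff}^\wedge_{(q-1)}(R_q,R_q)/\mathcal A_\psi\to \Big(\bigoplus_{p\text{ prime}}\mathrm{Diff}^\wedge_{(q-1)}(R_{q,p},R_{q,p})/\mathcal A_{\psi,p}\Big)^\wedge$$ to the $(q-1)$-adic completion of the direct sum, determined by the condition that the class of $s$ is sent to the element whose component at each $p$ (in the $(q-1)$-adic completion of the summand) is the image of the class of $s_p$, is well defined and bijective. (2) For $X$ one of the algebras above put $\mathrm SX=\{s\in X\mid s\circ\delta_0\equiv \mathrm{id} \bmod q-1\}$, a group under $\circ$, and consider the sets of left cosets $s\cdot\mathrm S\mathcal A_\psi$ and $s\cdot\mathrm S\mathcal A_{\psi,p}$. Let $\bigoplus^\wedge_p \mathrm{SDiff}^\wedge_{(q-1)}(R_{q,p},R_{q,p})/\mathrm S\mathcal A_{\psi,p}$ be the set of all families $(c_p)_p$ of cosets such that for every $m$ all but finitely many $c_p$ equal $1$ modulo $(q-1)^m$, i.e. have a representative $s\equiv 1$ modulo $(q-1)^m$. Then $s\mapsto (s_p)_p$ induces a well-defined bijection $$\mathrm{SDiff}^\wedge_{(q-1)}(R_q,R_q)/\mathrm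 S\mathcal A_\psi\to \bigoplus^\wedge_{p\text{ prime}}\mathrm{SDiff}^\wedge_{(q-1)}(R_{q,p},R_{q,p})/\mathrm S\mathcal A_{\psi,p}.$$ The same holds if all the groups $\mathrm SX$ are replaced by their subgroups $\{s\in \mathrm SX\mid s(1)=1\}$. -/

import Mathlib

open scoped PowerSeries DirectSum

noncomputable section

namespace QDiff

/-! ### `(q-1)`-adically convergent families

For a commutative ring `S` we write `S_q = S[[q-1]]`, realised as `S⟦X⟧`; the variable `X` is
`q - 1`. -/

section Null

variable {S : Type*} [CommRing S] {ι : Type*}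

/-- `lim_i u_i = 0` in the `(q-1)`-adic topology. -/
def IsNull (u : ι → S⟦X⟧) : Prop :=
  ∀ m : ℕ, {i | ¬ (PowerSeries.X : S⟦X⟧) ^ m ∣ u i}.Finite

/-- The sum `∑_i u_i` of a null family: each coefficient is a finite sum. -/
def nullSum (u : ι → S⟦X⟧) : S⟦X⟧ :=
  PowerSeries.mk fun m => ∑ᶠ i, PowerSeries.coeff m (u i)

theorem IsNull.finite_support {u : ι → S⟦X⟧} (hu : IsNull u) (m : ℕ) :
    (Function.support fun i => PowerSeries.coeff m (u i)).Finite := by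
  refine (hu (m + 1)).subset fun i hi h => hi ?_
  exact PowerSeries.X_pow_dvd_iff.mp h m (Nat.lt_succ_self m)

theorem IsNull.add {u v : ι → S⟦X⟧} (hu : IsNull u) (hv : IsNull v) :
    IsNull fun i => u i + v i := by
  intro m
  refine ((hu m).union (hv m)).subset fun i hi => ?_
  by_contra h
  simp only [Set.mem_union, Set.mem_ofPred_eq, not_or, not_not] at h
  exact hi (dvd_add h.1 h.2)

theorem IsNull.mul_left {u : ι → S⟦X⟧} (hu : IsNull u) (b : ι → S⟦X⟧) :
    IsNull fun i => b i * u i :=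
  fun m => (hu m).subset fun _ hi h => hi (Dvd.dvd.mul_left h _)

theorem IsNull.zero : IsNull fun _ : ι => (0 : S⟦X⟧) := by
  intro m
  simp

theorem nullSum_add {u v : ι → S⟦X⟧} (hu : IsNull u) (hv : IsNull v) :
    nullSum (fun i => u i + v i) = nullSum u + nullSum v := by
  ext m
  simp only [nullSum, PowerSeries.coeff_mk, map_add]
  exact finsum_add_distrib (hu.finite_support m) (hv.finite_support m)

theorem dvd_nullSum {u : ι → S⟦X⟧} {m : ℕ} (h : ∀ i, (PowerSeries.X : S⟦X⟧) ^ m ∣ u i) :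
    (PowerSeries.X : S⟦X⟧) ^ m ∣ nullSum u := by
  rw [PowerSeries.X_pow_dvd_iff]
  intro k hk
  rw [nullSum, PowerSeries.coeff_mk]
  refine finsum_eq_zero_of_forall_eq_zero fun i => ?_
  exact PowerSeries.X_pow_dvd_iff.mp (h i) k hk

theorem dvd_nullSum_sub {u : ι → S⟦X⟧} {m : ℕ} (T : Finset ι)
    (h : ∀ i, i ∉ T → (PowerSeries.X : S⟦X⟧) ^ m ∣ u i) :
    (PowerSeries.X : S⟦X⟧) ^ m ∣ nullSum u - ∑ i ∈ T, u i := by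
  rw [PowerSeries.X_pow_dvd_iff]
  intro k hk
  rw [map_sub, nullSum, PowerSeries.coeff_mk, map_sum, sub_eq_zero]
  refine finsum_eq_sum_of_support_subset _ fun i hi => ?_
  by_contra hiT
  exact hi (PowerSeries.X_pow_dvd_iff.mp (h i hiT) k hk)

theorem eq_of_forall_dvd_sub {a b : S⟦X⟧}
    (h : ∀ m : ℕ, (PowerSeries.X : S⟦X⟧) ^ m ∣ a - b) : a = b := by
  ext m
  have := PowerSeries.X_pow_dvd_iff.mp (h (m + 1)) m (Nat.lt_succ_self m)
  rwa [map_sub, sub_eq_zero] at this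

theorem nullSum_mul_left {u : ι → S⟦X⟧} (hu : IsNull u) (b : S⟦X⟧) :
    nullSum (fun i => b * u i) = b * nullSum u := by
  refine eq_of_forall_dvd_sub fun m => ?_
  set T := (hu m).toFinset with hT
  have h1 : ∀ i, i ∉ T → (PowerSeries.X : S⟦X⟧) ^ m ∣ u i := fun i hi => by
    by_contra h
    exact hi (by simpa [hT] using h)
  have e : nullSum (fun i => b * u i) - b * nullSum u
      = (nullSum (fun i => b * u i) - ∑ i ∈ T, b * u i) - b * (nullSum u - ∑ i ∈ T, u i) := by
    rw [mul_sub, Finset.mul_sum]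
    ring
  rw [e]
  exact dvd_sub (dvd_nullSum_sub T fun i hi => Dvd.dvd.mul_left (h1 i hi) _)
    (Dvd.dvd.mul_left (dvd_nullSum_sub T h1) _)

end Null

/-! ### The infinitesimal thickening and differential operators -/

section Thick

variable (S : Type*) [CommRing S] (n : ℕ)

/-- `S_q ⊗_inf S_q = S_q[[ε_1, …, ε_n]]`, an `S_q`-algebra by the inclusion `δ₁` of constants. -/
abbrev Thick := MvPowerSeries (Fin n) S⟦X⟧

/-- The ideal `J = (q-1, ε_1, …, ε_n)`. -/
def thickIdeal : Ideal (Thick S n) :=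
  Ideal.span (insert (MvPowerSeries.C (PowerSeries.X : S⟦X⟧)) (Set.range MvPowerSeries.X))

/-- The `S_q`-linear maps `s : S_q[[ε_1, …, ε_n]] → S_q` such that `s(J^k) → 0` in the
`(q-1)`-adic topology, as a submodule of the module of all `S_q`-linear maps. -/
def diffSubmodule : Submodule S⟦X⟧ (Thick S n →ₗ[S⟦X⟧] S⟦X⟧) where
  carrier := {s | ∀ m : ℕ, ∃ k : ℕ, ∀ F ∈ thickIdeal S n ^ k, (PowerSeries.X : S⟦X⟧) ^ m ∣ s F}
  add_mem' := by
    intro s t hs ht m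
    obtain ⟨k, hk⟩ := hs m
    obtain ⟨l, hl⟩ := ht m
    refine ⟨max k l, fun F hF => dvd_add (hk F ?_) (hl F ?_)⟩
    · exact Ideal.pow_le_pow_right (le_max_left k l) hF
    · exact Ideal.pow_le_pow_right (le_max_right k l) hF
  zero_mem' := fun m => ⟨0, fun _ _ => dvd_zero _⟩
  smul_mem' := by
    intro b s hs m
    obtain ⟨k, hk⟩ := hs m
    exact ⟨k, fun F hF => Dvd.dvd.mul_left (hk F hF) b⟩

/-- `Diff^∧_{(q-1)}(S_q, S_q) = {s ∈ Hom_{S_q}(S_q ⊗_inf S_q, S_q) | lim_k s(J^k) = 0}`. -/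
def Diff : Type _ := diffSubmodule S n

instance : AddCommGroup (Diff S n) := inferInstanceAs (AddCommGroup (diffSubmodule S n))

instance : Module S⟦X⟧ (Diff S n) := inferInstanceAs (Module S⟦X⟧ (diffSubmodule S n))

variable {S n}

/-- The monomial `ε^I`. -/
abbrev eps (I : Fin n →₀ ℕ) : Thick S n := MvPowerSeries.monomial I 1

theorem C_X_mem : MvPowerSeries.C (PowerSeries.X : S⟦X⟧) ∈ thickIdeal S n :=
  Ideal.subset_span (Set.mem_insert _ _)

theorem X_mem (i : Fin n) : (MvPowerSeries.X i : Thick S n) ∈ thickIdeal S n :=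
  Ideal.subset_span (Set.mem_insert_of_mem _ ⟨i, rfl⟩)

theorem eps_mem (I : Fin n →₀ ℕ) : (eps I : Thick S n) ∈ thickIdeal S n ^ I.degree := by
  induction I using Finsupp.induction_linear with
  | zero => simp
  | add f g hf hg =>
    have : (eps (f + g) : Thick S n) = eps f * eps g := by
      simp [eps, MvPowerSeries.monomial_mul_monomial]
    rw [this, map_add, pow_add]
    exact Ideal.mul_mem_mul hf hg
  | single i k =>
    have : (eps (Finsupp.single i k) : Thick S n) = MvPowerSeries.X i ^ k := by
      rw [MvPowerSeries.X_pow_eq]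
    rw [this, Finsupp.degree_single]
    exact Ideal.pow_mem_pow (X_mem i) k

theorem dvd_coeff_of_mem {k : ℕ} {F : Thick S n} (hF : F ∈ thickIdeal S n ^ k)
    (I : Fin n →₀ ℕ) : (PowerSeries.X : S⟦X⟧) ^ (k - I.degree) ∣ MvPowerSeries.coeff I F := by
  classical
  induction k generalizing F I with
  | zero => simp
  | succ k ih =>
    rw [pow_succ'] at hF
    refine Submodule.mul_induction_on hF ?_ ?_
    · intro a ha b hb
      revert b
      refine Submodule.span_induction ?_ ?_ ?_ ?_ ha
      · rintro a (rfl | ⟨i, rfl⟩) b hb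
        · rw [MvPowerSeries.coeff_C_mul]
          refine (pow_dvd_pow _ (by omega : k + 1 - I.degree ≤ 1 + (k - I.degree))).trans ?_
          rw [pow_add, pow_one]
          exact mul_dvd_mul_left _ (ih hb I)
        · rw [mul_comm, MvPowerSeries.X, MvPowerSeries.coeff_mul_monomial, mul_one]
          split_ifs with h
          · refine (pow_dvd_pow _ ?_).trans (ih hb _)
            have : (I - Finsupp.single i 1).degree + 1 = I.degree := by
              conv_rhs => rw [← tsub_add_cancel_of_le h]
              rw [map_add, Finsupp.degree_single]
            omega
          · exact dvd_zero _
      · intro b _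
        simp
      · intro a a' _ _ ha ha' b hb
        rw [add_mul, map_add]
        exact dvd_add (ha b hb) (ha' b hb)
      · intro c a _ h b hb
        rw [smul_eq_mul, mul_comm c, mul_assoc]
        exact h _ (Ideal.mul_mem_left _ _ hb)
    · intro F G hF hG
      rw [map_add]
      exact dvd_add hF hG

theorem exists_degree_bound {T : Set (Fin n →₀ ℕ)} (hT : T.Finite) :
    ∃ N : ℕ, ∀ I ∈ T, I.degree < N := by
  obtain ⟨N, hN⟩ := (hT.image Finsupp.degree).bddAbove
  exact ⟨N + 1, fun I hI => Nat.lt_succ_of_le (hN ⟨I, hI, rfl⟩)⟩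

/-- The values `s(ε^I)` of `s ∈ Diff` tend to `0`. -/
theorem isNull_symbol (s : Diff S n) : IsNull fun I => s.1 (eps I) := by
  intro m
  obtain ⟨k, hk⟩ := s.2 m
  refine (Finsupp.finite_of_degree_le (σ := Fin n) k).subset fun I hI => ?_
  by_contra h
  refine hI (hk _ (Ideal.pow_le_pow_right ?_ (eps_mem I)))
  simp only [Set.mem_ofPred_eq, not_le] at h
  exact h.le

/-- The differential operator `s ∈ Diff` with prescribed values `s(ε^I) = c_I`, where
`c_I → 0`: it sends `∑_I F_I ε^I` to `∑_I F_I c_I`. -/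
def ofSymbol (c : (Fin n →₀ ℕ) → S⟦X⟧) (hc : IsNull c) : Diff S n := Subtype.mk (p := (· ∈ diffSubmodule S n))
  (
    { toFun := fun F => nullSum fun I => MvPowerSeries.coeff I F * c I
      map_add' := fun F G => by
        rw [← nullSum_add (hc.mul_left _) (hc.mul_left _)]
        simp only [map_add, add_mul]
      map_smul' := fun b F => by
        rw [RingHom.id_apply, smul_eq_mul, ← nullSum_mul_left (hc.mul_left _)]
        simp only [map_smul, smul_eq_mul, mul_assoc] })
  (by
    intro m
    obtain ⟨N, hN⟩ := exists_degree_bound (hc m)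
    refine ⟨m + N, fun F hF => dvd_nullSum fun I => ?_⟩
    by_cases hI : (PowerSeries.X : S⟦X⟧) ^ m ∣ c I
    · exact Dvd.dvd.mul_left hI _
    · refine Dvd.dvd.mul_right ((pow_dvd_pow _ ?_).trans (dvd_coeff_of_mem hF I)) _
      have := hN I hI
      omega)

/-- The identity operator: `F ↦ F_0`, that is, `ε_i ↦ 0`. -/
def one : Diff S n := Subtype.mk (p := (· ∈ diffSubmodule S n)) (MvPowerSeries.coeff 0)
  fun m => ⟨m, fun F hF => by simpa using dvd_coeff_of_mem hF 0⟩

end Thick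

/-! ### The Taylor homomorphism `δ₀` -/

section Taylor

variable {S : Type*} [CommRing S] {n : ℕ}

/-- `d : S → S[[ε_1, …, ε_n]]` is a Taylor expansion homomorphism for the coordinates
`x_1, …, x_n`: it reduces to the identity modulo `(ε_1, …, ε_n)` and `d(x_i) = x_i + ε_i`. -/
structure IsTaylor (x : Fin n → S) (d : S →+* MvPowerSeries (Fin n) S) : Prop where
  constantCoeff : ∀ f, MvPowerSeries.constantCoeff (d f) = f
  coord : ∀ i, d (x i) = MvPowerSeries.C (x i) + MvPowerSeries.X i

open Classical in
/-- The Taylor expansion homomorphism for the coordinates `x`. For the rings and the coordinates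
of interest it exists and is unique, see `existsUnique_taylor` and
`existsUnique_taylor_completion`; otherwise the value is a dummy. -/
def taylor (x : Fin n → S) : S →+* MvPowerSeries (Fin n) S :=
  if h : ∃ d, IsTaylor x d then h.choose else MvPowerSeries.C

/-- A family of power series in `q-1` as the coefficients of a series in the `ε_i`. -/
def thickMk (c : (Fin n →₀ ℕ) → ℕ → S) : Thick S n := fun I => PowerSeries.mk (c I)

theorem coeff_coeff_thickMk (c : (Fin n →₀ ℕ) → ℕ → S) (I : Fin n →₀ ℕ) (k : ℕ) :
    PowerSeries.coeff k (MvPowerSeries.coeff I (thickMk c)) = c I k :=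
  PowerSeries.coeff_mk k (c I)

/-- `δ₀ : S_q → S_q ⊗_inf S_q = S_q[[ε_1, …, ε_n]]`, the extension of the Taylor homomorphism
with `δ₀(q-1) = q-1`. -/
def delta0 (x : Fin n → S) : S⟦X⟧ →+* Thick S n where
  toFun f := thickMk fun I k => MvPowerSeries.coeff I (taylor x (PowerSeries.coeff k f))
  map_zero' := by
    ext I k
    rw [coeff_coeff_thickMk]
    simp
  map_one' := by
    classical
    ext I k
    rw [coeff_coeff_thickMk, PowerSeries.coeff_one, MvPowerSeries.coeff_one]
    by_cases hk : k = 0 <;> by_cases hI : I = 0 <;>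
      simp [hk, hI, MvPowerSeries.coeff_one, PowerSeries.coeff_one]
  map_add' f g := by
    ext I k
    simp only [map_add, coeff_coeff_thickMk]
  map_mul' f g := by
    classical
    ext I k
    simp only [coeff_coeff_thickMk, PowerSeries.coeff_mul, map_sum, map_mul,
      MvPowerSeries.coeff_mul]
    rw [Finset.sum_comm]

theorem coeff_coeff_delta0 (x : Fin n → S) (f : S⟦X⟧) (I : Fin n →₀ ℕ) (k : ℕ) :
    PowerSeries.coeff k (MvPowerSeries.coeff I (delta0 x f)) =
      MvPowerSeries.coeff I (taylor x (PowerSeries.coeff k f)) :=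
  coeff_coeff_thickMk
    (fun I k => MvPowerSeries.coeff I (taylor x (PowerSeries.coeff k f))) I k

theorem delta0_X (x : Fin n → S) :
    delta0 x PowerSeries.X = MvPowerSeries.C PowerSeries.X := by
  classical
  ext I k
  rw [coeff_coeff_delta0, PowerSeries.coeff_X, MvPowerSeries.coeff_C]
  by_cases hk : k = 1 <;> by_cases hI : I = 0 <;>
    simp [hk, hI, MvPowerSeries.coeff_one, PowerSeries.coeff_X]

theorem delta0_mem (x : Fin n → S) {k : ℕ} {b : S⟦X⟧} (hb : (PowerSeries.X : S⟦X⟧) ^ k ∣ b) :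
    delta0 x b ∈ thickIdeal S n ^ k := by
  obtain ⟨c, rfl⟩ := hb
  rw [map_mul, map_pow, delta0_X]
  exact Ideal.mul_mem_right _ _ (Ideal.pow_mem_pow C_X_mem k)

/-- The additive endomorphism `s ∘ δ₀` of `S_q` defined by `s ∈ Diff`. -/
def op (x : Fin n → S) (s : Diff S n) : S⟦X⟧ →+ S⟦X⟧ :=
  s.1.toAddMonoidHom.comp (delta0 x).toAddMonoidHom

/-- The product `t ∘ s` in `Diff`, with `(t ∘ s) ∘ δ₀ = (t ∘ δ₀) ∘ (s ∘ δ₀)`. It is the composite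
of the comultiplication `ε ↦ ε + τ`, of `s ⊗ id`, which is linear over the last factor and sends
`ε^A τ^B` to `δ₀(s(ε^A)) τ^B`, and of `t`. So
`(t ∘ s)(ε^I) = ∑_{A + B = I} (I choose A) t(δ₀(s(ε^A)) ε^B)`. -/
def comp (x : Fin n → S) (t s : Diff S n) : Diff S n :=
  ofSymbol
    (fun I => ∑ p ∈ Finset.HasAntidiagonal.antidiagonal I,
      ((∏ i, (I i).choose (p.1 i) : ℕ) : S⟦X⟧) * t.1 (delta0 x (s.1 (eps p.1)) * eps p.2))
    (by
      intro m
      obtain ⟨k, hk⟩ := t.2 m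
      obtain ⟨N, hN⟩ := exists_degree_bound (isNull_symbol s k)
      refine (Finsupp.finite_of_degree_le (σ := Fin n) (N + k)).subset fun I hI => ?_
      by_contra h
      simp only [Set.mem_ofPred_eq, not_le] at h
      refine hI (Finset.dvd_sum fun p hp => Dvd.dvd.mul_left (hk _ ?_) _)
      have hd : p.1.degree + p.2.degree = I.degree := by
        rw [← map_add, Finset.HasAntidiagonal.mem_antidiagonal.mp hp]
      by_cases hA : (PowerSeries.X : S⟦X⟧) ^ k ∣ s.1 (eps p.1)
      · exact Ideal.mul_mem_right _ _ (delta0_mem x hA)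
      · have := hN p.1 hA
        exact Ideal.mul_mem_left _ _ (Ideal.pow_le_pow_right (by omega) (eps_mem p.2)))

/-! ### `q`-derivatives -/

open Classical in
/-- The `q`-derivative `∇_{x_i,q}`, with
`∇_{x_i,q} ∘ δ₀ = (γ_i - id) / (q x_i - x_i)` for the automorphism
`γ_i : x_i ↦ q x_i, x_j ↦ x_j (j ≠ i)` of `S_q`. As `γ_i` is `δ₀` followed by
`ε_i ↦ (q-1) x_i, ε_j ↦ 0`, it sends `ε_i^k` to `((q-1) x_i)^(k-1)` for `k ≥ 1`,
and all other monomials to `0`. -/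
def nabla (x : Fin n → S) (i : Fin n) : Diff S n :=
  ofSymbol
    (fun I => if I ≠ 0 ∧ I = Finsupp.single i (I i) then
      (PowerSeries.X * PowerSeries.C (x i)) ^ (I i - 1) else 0)
    (by
      intro m
      refine (Finsupp.finite_of_degree_le (σ := Fin n) m).subset fun I hI => ?_
      by_contra h
      simp only [Set.mem_ofPred_eq, not_le] at h
      refine hI ?_
      beta_reduce
      split_ifs with hc
      · have : I.degree = I i := by
          conv_lhs => rw [hc.2]
          rw [Finsupp.degree_single]
        rw [mul_pow]
        exact Dvd.dvd.mul_right (pow_dvd_pow _ (by omega)) _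
      · exact dvd_zero _)

/-- `∇^I_{ψ,q} = ∏_{k=1}^n ∇_{x_k,q}^{I_k}`. -/
def nablaPow (x : Fin n → S) (I : Fin n →₀ ℕ) : Diff S n :=
  (List.finRange n).foldr (fun k s => (comp x (nabla x k))^[I k] s) one

/-- `𝒜_ψ`: the operators `∑_I a_I ∇^I_{ψ,q}` with `a_I ∈ S_q`, `lim_I a_I = 0`. -/
def A (x : Fin n → S) : Submodule S⟦X⟧ (Diff S n) where
  carrier := {s | ∃ a : (Fin n →₀ ℕ) → S⟦X⟧, IsNull a ∧
    ∀ F, s.1 F = nullSum fun I => a I * (nablaPow x I).1 F}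
  zero_mem' := ⟨fun _ => 0, IsNull.zero, fun F => by
    change (0 : S⟦X⟧) = _
    ext m
    simp [nullSum]⟩
  add_mem' := by
    rintro s t ⟨a, ha, hs⟩ ⟨b, hb, ht⟩
    refine ⟨fun I => a I + b I, ha.add hb, fun F => ?_⟩
    have h : ∀ c : (Fin n →₀ ℕ) → S⟦X⟧, IsNull c →
        IsNull fun I => c I * (nablaPow x I).1 F := fun c hc => by
      simpa only [mul_comm] using hc.mul_left fun I => (nablaPow x I).1 F
    change s.1 F + t.1 F = _
    rw [hs F, ht F, ← nullSum_add (h a ha) (h b hb)]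
    simp only [add_mul]
  smul_mem' := by
    rintro b s ⟨a, ha, hs⟩
    refine ⟨fun I => b * a I, ha.mul_left fun _ => b, fun F => ?_⟩
    have h : IsNull fun I => a I * (nablaPow x I).1 F := by
      simpa only [mul_comm] using ha.mul_left fun I => (nablaPow x I).1 F
    change b * s.1 F = _
    rw [hs F, ← nullSum_mul_left h]
    simp only [mul_assoc]

/-! ### Groups of sections and their cosets -/

/-- `SX = {s ∈ X | s ∘ δ₀ ≡ id mod (q-1)}` for `X ⊆ Diff`. -/
def SSet (x : Fin n → S) (Y : Set (Diff S n)) : Set (Diff S n) :=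
  {s | s ∈ Y ∧ ∀ f, (PowerSeries.X : S⟦X⟧) ∣ op x s f - f}

/-- The unital variant `{s ∈ SX | s(1) = 1}`. -/
def SSet1 (x : Fin n → S) (Y : Set (Diff S n)) : Set (Diff S n) :=
  {s | s ∈ SSet x Y ∧ s.1 1 = 1}

/-- The coset `s · H = {s ∘ a | a ∈ H}`. -/
def coset (x : Fin n → S) (H : Set (Diff S n)) (s : Diff S n) : Set (Diff S n) :=
  {u | ∃ a ∈ H, u = comp x s a}

/-- The set `G/H` of cosets `s · H`, `s ∈ G`. -/
def CosetSpace (x : Fin n → S) (G H : Set (Diff S n)) : Type _ :=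
  {C : Set (Diff S n) // ∃ s ∈ G, C = coset x H s}

/-- The class in `G/H` of `s ∈ G`. -/
def CosetSpace.mk (x : Fin n → S) {G : Set (Diff S n)} (H : Set (Diff S n)) {s : Diff S n}
    (hs : s ∈ G) : CosetSpace x G H :=
  ⟨coset x H s, s, hs, rfl⟩

/-- The coset `C` equals `1` after reduction modulo `(q-1)^m`: it has a representative `s` with
`s ≡ 1 mod (q-1)^m`. -/
def CosetSpace.IsOneMod {x : Fin n → S} {G H : Set (Diff S n)} (C : CosetSpace x G H) (m : ℕ) :
    Prop :=
  ∃ s ∈ C.1, ∀ F, (PowerSeries.X : S⟦X⟧) ^ m ∣ s.1 F - (one : Diff S n).1 F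

end Taylor

/-! ### `p`-adic completion -/

section Completion

variable (R : Type*) [CommRing R]

/-- The `p`-adic completion `R_p`. Correspondingly `R_{q,p} = R_p[[q-1]]` is the `p`-adic
completion of `R_q = R[[q-1]]`, see `powerSeries_Cp_isCompletion`. -/
abbrev Cp (p : ℕ) : Type _ := AdicCompletion (Ideal.span {(p : R)}) R

variable {R}

/-- The coordinates `x_i = ψ(x_i) ∈ R`. -/
def coord {n : ℕ} (ψ : MvPolynomial (Fin n) ℤ →+* R) : Fin n → R :=
  fun i => ψ (MvPolynomial.X i)

/-- The coordinates in `R_p`. -/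
def coordp {n : ℕ} (ψ : MvPolynomial (Fin n) ℤ →+* R) (p : ℕ) : Fin n → Cp R p :=
  fun i => algebraMap R (Cp R p) (coord ψ i)

/-- The `p`-adic completion map `Diff^∧_{(q-1)}(R_q, R_q) → Diff^∧_{(q-1)}(R_{q,p}, R_{q,p})`:
`s_p` is the operator with `s_p(ε^I)` the image of `s(ε^I)`. -/
def pComp {n : ℕ} (p : ℕ) (s : Diff R n) : Diff (Cp R p) n :=
  ofSymbol (fun I => algebraMap R⟦X⟧ (Cp R p)⟦X⟧ (s.1 (eps I)))
    (by
      intro m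
      refine (isNull_symbol s m).subset fun I hI h => hI ?_
      have := map_dvd (algebraMap R⟦X⟧ (Cp R p)⟦X⟧) h
      rw [map_pow] at this
      convert this
      change _ = PowerSeries.map _ _
      simp)

/-- `⊕^∧_p G_p/H_p`: the families of cosets only finitely many of whose components are `≠ 1`
modulo `(q-1)^m`, for every `m`. -/
def RestrictedProduct {n : ℕ} (x : ∀ p : Nat.Primes, Fin n → Cp R p)
    (G H : ∀ p : Nat.Primes, Set (Diff (Cp R p) n)) : Type _ :=
  {y : ∀ p : Nat.Primes, CosetSpace (x p) (G p) (H p) //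
    ∀ m : ℕ, {p | ¬ (y p).IsOneMod m}.Finite}

/-- `Diff^∧_{(q-1)}(R_{q,p}, R_{q,p}) / 𝒜_{ψ,p}`, an `R_q`-module through `R_q → R_{q,p}`. -/
def DiffQuot {n : ℕ} (ψ : MvPolynomial (Fin n) ℤ →+* R) (p : ℕ) : Type _ :=
  Diff (Cp R p) n ⧸ A (coordp ψ p)

instance {n : ℕ} (ψ : MvPolynomial (Fin n) ℤ →+* R) (p : ℕ) : AddCommGroup (DiffQuot ψ p) :=
  inferInstanceAs (AddCommGroup (Diff (Cp R p) n ⧸ A (coordp ψ p)))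

instance {n : ℕ} (ψ : MvPolynomial (Fin n) ℤ →+* R) (p : ℕ) :
    Module (Cp R p)⟦X⟧ (DiffQuot ψ p) :=
  inferInstanceAs (Module (Cp R p)⟦X⟧ (Diff (Cp R p) n ⧸ A (coordp ψ p)))

instance {n : ℕ} (ψ : MvPolynomial (Fin n) ℤ →+* R) (p : ℕ) : Module R⟦X⟧ (DiffQuot ψ p) :=
  Module.compHom _ (algebraMap R⟦X⟧ (Cp R p)⟦X⟧)

/-- The class of `s ∈ Diff^∧_{(q-1)}(R_{q,p}, R_{q,p})` modulo `𝒜_{ψ,p}`. -/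
def DiffQuot.mk {n : ℕ} (ψ : MvPolynomial (Fin n) ℤ →+* R) (p : ℕ) (s : Diff (Cp R p) n) :
    DiffQuot ψ p :=
  Submodule.Quotient.mk (p := A (coordp ψ p)) s

end Completion

/-! ### Existence and uniqueness of the Taylor homomorphism -/

section Existence

variable {R : Type*} [CommRing R] {n : ℕ}

theorem exists_lift {ψ : MvPolynomial (Fin n) ℤ →+* R} (hψ : ψ.Etale) {T : Type*} [CommRing T]
    (j : R →+* T) : ∃ g : R →+* MvPowerSeries (Fin n) T,
      (∀ r, MvPowerSeries.constantCoeff (g r) = j r) ∧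
      ∀ i, g (coord ψ i) = MvPowerSeries.C (j (coord ψ i)) + MvPowerSeries.X i := by
  let _ : Algebra (MvPolynomial (Fin n) ℤ) R := ψ.toAlgebra
  have : Algebra.Etale (MvPolynomial (Fin n) ℤ) R := hψ
  let φ : MvPolynomial (Fin n) ℤ →+* MvPowerSeries (Fin n) T :=
    MvPolynomial.eval₂Hom (Int.castRingHom _)
      fun i => MvPowerSeries.C (j (coord ψ i)) + MvPowerSeries.X i
  let _ : Algebra (MvPolynomial (Fin n) ℤ) (MvPowerSeries (Fin n) T) := φ.toAlgebra
  set K : Ideal (MvPowerSeries (Fin n) T) := Ideal.span (Set.range MvPowerSeries.X) with hK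
  let f0 : R →+* MvPowerSeries (Fin n) T ⧸ K :=
    (Ideal.Quotient.mk K).comp (MvPowerSeries.C.comp j)
  have hf0 : f0.comp ψ = (Ideal.Quotient.mk K).comp φ := by
    apply MvPolynomial.ringHom_ext
    · intro r
      simp
    · intro i
      change Ideal.Quotient.mk K (MvPowerSeries.C (j (coord ψ i))) = Ideal.Quotient.mk K (φ _)
      rw [Ideal.Quotient.eq]
      simp only [φ, MvPolynomial.coe_eval₂Hom, MvPolynomial.eval₂_X, sub_add_cancel_left]
      exact neg_mem (Ideal.subset_span ⟨i, rfl⟩)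
  let f : R →ₐ[MvPolynomial (Fin n) ℤ] MvPowerSeries (Fin n) T ⧸ K :=
    { f0 with commutes' := fun a => congrArg (fun h => h a) hf0 }
  obtain ⟨g, hg⟩ := Algebra.FormallySmooth.exists_mkₐ_comp_eq_of_isAdicComplete f
  refine ⟨g.toRingHom, fun r => ?_, fun i => ?_⟩
  · have h1 : Ideal.Quotient.mk K (g r) = Ideal.Quotient.mk K (MvPowerSeries.C (j r)) :=
      congrArg (fun h => h r) hg
    rw [Ideal.Quotient.eq] at h1
    have h2 : K ≤ RingHom.ker (MvPowerSeries.constantCoeff (σ := Fin n) (R := T)) := by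
      rw [hK, Ideal.span_le]
      rintro _ ⟨i, rfl⟩
      simp
    have h3 := h2 h1
    rw [RingHom.mem_ker, map_sub, sub_eq_zero] at h3
    simpa using h3
  · have h1 := g.commutes (MvPolynomial.X i)
    have h2 : algebraMap (MvPolynomial (Fin n) ℤ) (MvPowerSeries (Fin n) T) (MvPolynomial.X i)
        = MvPowerSeries.C (j (coord ψ i)) + MvPowerSeries.X i := by
      change φ _ = _
      simp [φ]
    rw [h2] at h1
    exact h1

theorem lift_unique {ψ : MvPolynomial (Fin n) ℤ →+* R} (hψ : ψ.Etale) {T : Type*} [CommRing T]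
    {g g' : R →+* MvPowerSeries (Fin n) T}
    (h : ∀ r, MvPowerSeries.constantCoeff (g r) = MvPowerSeries.constantCoeff (g' r))
    (hx : ∀ i, g (coord ψ i) = g' (coord ψ i)) : g = g' := by
  let _ : Algebra (MvPolynomial (Fin n) ℤ) R := ψ.toAlgebra
  have : Algebra.Etale (MvPolynomial (Fin n) ℤ) R := hψ
  let _ : Algebra (MvPolynomial (Fin n) ℤ) (MvPowerSeries (Fin n) T) := (g.comp ψ).toAlgebra
  have hgg : g.comp ψ = g'.comp ψ := by
    apply MvPolynomial.ringHom_ext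
    · intro r
      simp
    · exact hx
  let g1 : R →ₐ[MvPolynomial (Fin n) ℤ] MvPowerSeries (Fin n) T :=
    { g with commutes' := fun _ => rfl }
  let g2 : R →ₐ[MvPolynomial (Fin n) ℤ] MvPowerSeries (Fin n) T :=
    { g' with commutes' := fun a => congrArg (fun h => h a) hgg.symm }
  set K : Ideal (MvPowerSeries (Fin n) T) := RingHom.ker MvPowerSeries.constantCoeff with hK
  have key : ∀ m : ℕ, ∀ F ∈ K ^ m, (m : ℕ∞) ≤ MvPowerSeries.order F := by
    intro m
    induction m with
    | zero => intro F _; simp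
    | succ m ih =>
      intro F hF
      rw [pow_succ'] at hF
      refine Submodule.mul_induction_on hF (fun a ha b hb => ?_) fun a b ha hb => ?_
      · refine le_trans ?_ MvPowerSeries.le_order_mul
        have h1 : (1 : ℕ∞) ≤ MvPowerSeries.order a :=
          MvPowerSeries.one_le_order_iff_constCoeff_eq_zero.mpr ha
        rw [Nat.cast_add, Nat.cast_one, add_comm]
        exact add_le_add h1 (ih b hb)
      · exact le_trans (le_min ha hb) MvPowerSeries.min_order_le_add
  ext1 r
  rw [← sub_eq_zero, ← MvPowerSeries.order_eq_top_iff, ENat.eq_top_iff_forall_ge]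
  intro m
  refine key m _ ?_
  have : (Ideal.Quotient.mkₐ _ (K ^ m)).comp g1 = (Ideal.Quotient.mkₐ _ (K ^ m)).comp g2 := by
    refine Algebra.FormallyUnramified.ext (I := K.map (Ideal.Quotient.mk (K ^ m)))
      ⟨m, ?_⟩ fun r => ?_
    · rw [← Ideal.map_pow, Ideal.map_quotient_self]
      rfl
    · rw [Ideal.Quotient.eq]
      change Ideal.Quotient.mk (K ^ m) (g r) - Ideal.Quotient.mk (K ^ m) (g' r) ∈ _
      rw [← map_sub]
      exact Ideal.mem_map_of_mem _ (by rw [hK, RingHom.mem_ker, map_sub, h, sub_self])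
  have h2 := congrArg (fun h => h r) this
  exact Ideal.Quotient.eq.mp h2

/-- The Taylor homomorphism of an étale coordinate system exists and is unique. -/
theorem existsUnique_taylor {ψ : MvPolynomial (Fin n) ℤ →+* R} (hψ : ψ.Etale) :
    ∃! d, IsTaylor (coord ψ) d := by
  obtain ⟨d, h1, h2⟩ := exists_lift hψ (RingHom.id R)
  refine ⟨d, ⟨h1, h2⟩, fun d' h' => lift_unique hψ (fun r => ?_) fun i => ?_⟩
  · rw [h'.constantCoeff, h1, RingHom.id_apply]
  · rw [h'.coord, h2, RingHom.id_apply]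

theorem isAdicComplete_mvPowerSeries (p : ℕ) {σ T : Type*} [CommRing T]
    [IsAdicComplete (Ideal.span {(p : T)}) T] :
    IsAdicComplete (Ideal.span {(p : MvPowerSeries σ T)}) (MvPowerSeries σ T) where
  haus' := by
    intro F hF
    ext I
    refine IsHausdorff.haus' (I := Ideal.span {(p : T)}) _ fun k => ?_
    have := hF k
    rw [SModEq.zero, smul_eq_mul, Ideal.mul_top, Ideal.span_singleton_pow,
      Ideal.mem_span_singleton] at this ⊢
    obtain ⟨G, rfl⟩ := this
    refine ⟨MvPowerSeries.coeff I G, ?_⟩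
    rw [← map_natCast (MvPowerSeries.C (σ := σ) (R := T)), ← map_pow, MvPowerSeries.coeff_C_mul]
  prec' := by
    intro f hf
    have h1 : ∀ I, ∃ L : T, ∀ k, MvPowerSeries.coeff I (f k) ≡ L
        [SMOD (Ideal.span {(p : T)} ^ k • ⊤ : Submodule T T)] := by
      intro I
      refine IsPrecomplete.prec' _ fun {k l} hkl => ?_
      have := hf hkl
      rw [SModEq.sub_mem, smul_eq_mul, Ideal.mul_top, Ideal.span_singleton_pow,
        Ideal.mem_span_singleton] at this ⊢
      obtain ⟨G, hG⟩ := this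
      refine ⟨MvPowerSeries.coeff I G, ?_⟩
      rw [← map_sub, hG, ← map_natCast (MvPowerSeries.C (σ := σ) (R := T)), ← map_pow,
        MvPowerSeries.coeff_C_mul]
    choose L hL using h1
    let L' : MvPowerSeries σ T := L
    have hL' : ∀ I, MvPowerSeries.coeff I L' = L I := fun I => rfl
    refine ⟨L', fun k => ?_⟩
    have h2 : ∀ I, ∃ c, MvPowerSeries.coeff I (f k) - L I = (p : T) ^ k * c := by
      intro I
      have := hL I k
      rwa [SModEq.sub_mem, smul_eq_mul, Ideal.mul_top, Ideal.span_singleton_pow,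
        Ideal.mem_span_singleton] at this
    choose c hc using h2
    let c' : MvPowerSeries σ T := c
    have hc' : ∀ I, MvPowerSeries.coeff I c' = c I := fun I => rfl
    rw [SModEq.sub_mem, smul_eq_mul, Ideal.mul_top, Ideal.span_singleton_pow,
        Ideal.mem_span_singleton]
    refine ⟨c', ?_⟩
    ext I
    rw [map_sub, hL', hc, ← map_natCast (MvPowerSeries.C (σ := σ) (R := T)), ← map_pow,
      MvPowerSeries.coeff_C_mul, hc']

theorem isAdicComplete_Cp (p : ℕ) : IsAdicComplete (Ideal.span {(p : Cp R p)}) (Cp R p) := by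
  have h := AdicCompletion.isAdicComplete (I := Ideal.span {(p : R)}) (M := R)
    ⟨{(p : R)}, by simp⟩
  have h2 := (IsAdicComplete.map_algebraMap_iff (I := Ideal.span {(p : R)})
    (S := Cp R p) (M := Cp R p)).mpr h
  rwa [Ideal.map_span, Set.image_singleton, map_natCast] at h2

theorem Cp_exists_eq (p : ℕ) (y : Cp R p) (m : ℕ) :
    ∃ (r : R) (z : Cp R p), y = algebraMap R (Cp R p) r + (p : Cp R p) ^ m * z := by
  obtain ⟨r, hr⟩ := Submodule.Quotient.mk_surjective _ (AdicCompletion.eval _ R m y)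
  have h1 : y - algebraMap R (Cp R p) r ∈
      (AdicCompletion.eval (Ideal.span {(p : R)}) R m).ker := by
    rw [LinearMap.mem_ker, map_sub, ← hr, sub_eq_zero]
    rfl
  rw [← AdicCompletion.pow_smul_top_eq_ker_eval ⟨{(p : R)}, by simp⟩,
    Ideal.span_singleton_pow, Submodule.ideal_span_singleton_smul] at h1
  obtain ⟨z, -, hz⟩ := h1
  refine ⟨r, z, ?_⟩
  have hz' : ((p : R) ^ m) • z = y - algebraMap R (Cp R p) r := hz
  rw [Algebra.smul_def, map_pow, map_natCast] at hz'
  rw [hz']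
  ring

/-- `R_p[[q-1]]` is the `p`-adic completion of `R[[q-1]]`: it is `p`-adically complete, and
`R[[q-1]]/p^m → R_p[[q-1]]/p^m` is bijective for every `m`. -/
theorem powerSeries_Cp_isCompletion (p : ℕ) :
    IsAdicComplete (Ideal.span {(p : (Cp R p)⟦X⟧)}) (Cp R p)⟦X⟧ ∧
    (∀ (m : ℕ) (F : (Cp R p)⟦X⟧), ∃ (f : R⟦X⟧) (G : (Cp R p)⟦X⟧),
      F = algebraMap R⟦X⟧ (Cp R p)⟦X⟧ f + (p : (Cp R p)⟦X⟧) ^ m * G) ∧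
    (∀ (m : ℕ) (f : R⟦X⟧), (p : (Cp R p)⟦X⟧) ^ m ∣ algebraMap R⟦X⟧ (Cp R p)⟦X⟧ f →
      (p : R⟦X⟧) ^ m ∣ f) := by
  have hC : ∀ (T : Type _) [CommRing T] (m : ℕ), (p : T⟦X⟧) ^ m = PowerSeries.C ((p : T) ^ m) := by
    intro T _ m
    simp
  refine ⟨?_, fun m F => ?_, fun m f hf => ?_⟩
  · have := isAdicComplete_Cp (R := R) p
    exact isAdicComplete_mvPowerSeries p (σ := Unit) (T := Cp R p)
  · choose r z h using fun k => Cp_exists_eq p (PowerSeries.coeff k F) m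
    refine ⟨PowerSeries.mk r, PowerSeries.mk z, ?_⟩
    refine PowerSeries.ext fun k => ?_
    have h1 : PowerSeries.coeff k (PowerSeries.map (algebraMap R (Cp R p)) (PowerSeries.mk r))
        = algebraMap R (Cp R p) (r k) := by
      rw [PowerSeries.coeff_map, PowerSeries.coeff_mk]
    rw [map_add, hC, PowerSeries.coeff_C_mul, PowerSeries.coeff_mk, h k, ← h1]
    rfl
  · obtain ⟨G, hG⟩ := hf
    have h1 : ∀ k, ∃ c, PowerSeries.coeff k f = (p : R) ^ m * c := by
      intro k
      have h2 : algebraMap R (Cp R p) (PowerSeries.coeff k f)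
          = (p : Cp R p) ^ m * PowerSeries.coeff k G := by
        rw [← PowerSeries.coeff_C_mul, ← hC, ← hG]
        exact (PowerSeries.coeff_map (algebraMap R (Cp R p)) k f).symm
      have h3 := congrArg (AdicCompletion.evalₐ (Ideal.span {(p : R)}) m) h2
      have h4 : (p : R ⧸ Ideal.span {(p : R)} ^ m) ^ m = 0 := by
        have : (p : R) ^ m ∈ Ideal.span {(p : R)} ^ m :=
          Ideal.pow_mem_pow (Ideal.mem_span_singleton_self _) m
        rw [← Ideal.Quotient.eq_zero_iff_mem, map_pow, map_natCast] at this
        exact this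
      rw [map_mul, map_pow, map_natCast, h4, zero_mul] at h3
      have h5 : Ideal.Quotient.mk (Ideal.span {(p : R)} ^ m) (PowerSeries.coeff k f) = 0 :=
        (AlgHom.commutes _ _).symm.trans h3
      rw [Ideal.Quotient.eq_zero_iff_mem, Ideal.span_singleton_pow,
        Ideal.mem_span_singleton] at h5
      exact h5
    choose c hc using h1
    refine ⟨PowerSeries.mk c, ?_⟩
    ext k
    rw [hC, PowerSeries.coeff_C_mul, PowerSeries.coeff_mk, hc]

theorem Cp_ringHom_ext (p : ℕ) {T : Type*} [CommRing T] [IsHausdorff (Ideal.span {(p : T)}) T]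
    {h h' : Cp R p →+* T}
    (H : ∀ r, h (algebraMap R (Cp R p) r) = h' (algebraMap R (Cp R p) r)) : h = h' := by
  ext1 y
  refine (IsHausdorff.eq_iff_smodEq (I := Ideal.span {(p : T)})).mpr fun m => ?_
  obtain ⟨r, z, rfl⟩ := Cp_exists_eq p y m
  rw [SModEq.sub_mem, smul_eq_mul, Ideal.mul_top, Ideal.span_singleton_pow,
    Ideal.mem_span_singleton]
  refine ⟨h z - h' z, ?_⟩
  simp only [map_add, map_mul, map_pow, map_natCast, H]
  ring

theorem Cp_exists_extend (p : ℕ) {T : Type*} [CommRing T] [IsAdicComplete (Ideal.span {(p : T)}) T]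
    (g : R →+* T) : ∃ d : Cp R p →+* T, ∀ r, d (algebraMap R (Cp R p) r) = g r := by
  have hle : ∀ m, ∀ a ∈ Ideal.span {(p : R)} ^ m,
      (Ideal.Quotient.mk (Ideal.span {(p : T)} ^ m)).comp g a = 0 := by
    intro m a ha
    rw [RingHom.comp_apply, Ideal.Quotient.eq_zero_iff_mem]
    rw [Ideal.span_singleton_pow, Ideal.mem_span_singleton] at ha ⊢
    have := map_dvd g ha
    rwa [map_pow, map_natCast] at this
  let f : (m : ℕ) → Cp R p →+* T ⧸ Ideal.span {(p : T)} ^ m := fun m =>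
    (Ideal.Quotient.lift _ _ (hle m)).comp
      (AdicCompletion.evalₐ (Ideal.span {(p : R)}) m).toRingHom
  have hfa : ∀ m r, f m (algebraMap R (Cp R p) r) = Ideal.Quotient.mk _ (g r) := by
    intro m r
    have : (AdicCompletion.evalₐ (Ideal.span {(p : R)}) m) (algebraMap R (Cp R p) r)
        = Ideal.Quotient.mk _ r := AlgHom.commutes _ r
    exact (congrArg (Ideal.Quotient.lift _ _ (hle m)) this).trans (Ideal.Quotient.lift_mk _ _ _)
  have hf : ∀ {k l : ℕ} (hkl : k ≤ l),
      (Ideal.Quotient.factorPow (Ideal.span {(p : T)}) hkl).comp (f l) = f k := by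
    intro k l hkl
    ext1 y
    obtain ⟨r, z, rfl⟩ := Cp_exists_eq p y l
    have h0 : ∀ j, j ≤ l → (p : T ⧸ Ideal.span {(p : T)} ^ j) ^ l = 0 := by
      intro j hj
      have : (p : T) ^ l ∈ Ideal.span {(p : T)} ^ j := by
        rw [Ideal.span_singleton_pow, Ideal.mem_span_singleton]
        exact pow_dvd_pow _ hj
      rw [← Ideal.Quotient.eq_zero_iff_mem, map_pow, map_natCast] at this
      exact this
    rw [RingHom.comp_apply]
    simp only [map_add, map_mul, map_pow, map_natCast, hfa, h0 l le_rfl, h0 k hkl, zero_mul,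
      add_zero]
    rfl
  refine ⟨IsAdicComplete.liftRingHom _ f hf, fun r => ?_⟩
  refine (IsHausdorff.eq_iff_smodEq (I := Ideal.span {(p : T)})).mpr fun m => ?_
  rw [SModEq.sub_mem, smul_eq_mul, Ideal.mul_top, ← Ideal.Quotient.eq,
    IsAdicComplete.mk_liftRingHom, hfa]

/-- The Taylor homomorphism of the `p`-adic completion exists and is unique. -/
theorem existsUnique_taylor_completion {ψ : MvPolynomial (Fin n) ℤ →+* R} (hψ : ψ.Etale)
    (p : ℕ) : ∃! d, IsTaylor (coordp ψ p) d := by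
  have := isAdicComplete_Cp (R := R) p
  have := isAdicComplete_mvPowerSeries p (σ := Fin n) (T := Cp R p)
  obtain ⟨g, h1, h2⟩ := exists_lift hψ (algebraMap R (Cp R p))
  obtain ⟨d, hd⟩ := Cp_exists_extend p g
  refine ⟨d, ⟨fun y => ?_, fun i => ?_⟩, fun d' h' => Cp_ringHom_ext p fun r => ?_⟩
  · have : (MvPowerSeries.constantCoeff).comp d = RingHom.id (Cp R p) :=
      Cp_ringHom_ext p fun r => by rw [RingHom.comp_apply, hd, h1, RingHom.id_apply]
    exact congrArg (fun h => h y) this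
  · exact (hd _).trans (h2 i)
  · have : d'.comp (algebraMap R (Cp R p)) = g := by
      refine lift_unique hψ (fun r => ?_) fun i => ?_
      · rw [RingHom.comp_apply, h'.constantCoeff, h1]
      · exact (h'.coord i).trans (h2 i).symm
    rw [hd, ← this]
    rfl

end Existence

end QDiff
end

/-!
The theorem is a local-global principle for the prime numbers, and it holds because `𝒜_ψ` becomes
everything once the integers are inverted, modulo each power of `q-1`.

An operator `s` is the same as the null family of its values `s(ε^I)` (`apply_eq_nullSum`,
`ofSymbol`). Modulo `q-1`, the operator `∇^J` sends `ε^J` to `J!` and all other monomials to `0`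
(`nablaPow_congr`). So `Diff / (𝒜_ψ + (q-1) Diff)` is `⨁_I R / I!` (`mem_modA_one_iff`), and
in the same way over `R_p`. Since `R / I!` is the product of the `R_p / I!` over the prime divisors
`p` of `I!`, the graded pieces in degree `0` are matched by the Chinese remainder theorem
(`mem_modA_one_of_forall`, `exists_modA_one_approx`).

`R` is flat over `ℤ`, hence torsion free, and so is `R_p`. Therefore `(q-1) d ∈ 𝒜_ψ` implies
`d ∈ 𝒜_ψ` (`IsCoordSystem.mem_A_of_X_smul_mem`): all graded pieces of the `(q-1)`-adic filtration
of `Diff / 𝒜_ψ` are equal to that in degree `0`. As `Diff` is complete and `𝒜_ψ` is closed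
(`Diff.exists_series`, `IsCoordSystem.mem_A_of_forall`), the injectivity of the map of the theorem
is `mem_A_of_forall_pComp`, and the surjectivity follows by successive approximation
(`exists_forall_neg_add_mem`). An operator is in `𝒜_{ψ,p} + (q-1)^m Diff` for almost all `p`, since
some nonzero integer multiple of it is in `𝒜_ψ + (q-1)^m Diff` (`finite_not_mem_modA`).

The groups of sections are filtered by the congruence subgroups modulo `(q-1)^m`, which are normal
in the group of units of the ring `DiffRing`. For `u = 1 + (q-1) d`, the class of `u` modulo
`S𝒜_ψ` is trivial modulo `(q-1)^{m+1}` if and only if the class of `d` modulo `𝒜_ψ` is trivial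
modulo `(q-1)^m` (`mem_congruenceSubgroup_sup_iff`). So the graded pieces are the same as before,
and the same successive approximation applies in its multiplicative form
(`exists_forall_inv_mul_mem`). That composition is associative, and that `𝒜_ψ` is closed under it,
rests on the Taylor homomorphism being iterative (`IsCoordSystem`), which is a consequence of the
uniqueness of liftings along the étale map `ψ`. Finally, a section `u` can be made unital by a
multiplication on the right with the scalar `u⁻¹(1)`, which is in `S𝒜_ψ`
(`exists_mul_mem_unitalSubgroup`); this reduces the unital case to the general one.
-/

noncomputable section

namespace QDiff

/-! ### Symbols of differential operators -/

section Symbols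

variable {S : Type*} [CommRing S] {n : ℕ}

theorem Diff.add_apply (s t : Diff S n) (F : Thick S n) : (s + t).1 F = s.1 F + t.1 F := rfl

theorem Diff.sub_apply (s t : Diff S n) (F : Thick S n) : (s - t).1 F = s.1 F - t.1 F := rfl

theorem Diff.zero_apply (F : Thick S n) : (0 : Diff S n).1 F = 0 := rfl

theorem Diff.smul_apply (b : S⟦X⟧) (s : Diff S n) (F : Thick S n) :
    (b • s).1 F = b * s.1 F := rfl

theorem Diff.sum_apply {ι : Type*} (T : Finset ι) (s : ι → Diff S n) (F : Thick S n) :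
    (∑ i ∈ T, s i).1 F = ∑ i ∈ T, (s i).1 F := by
  classical
  induction T using Finset.induction_on with
  | empty => rfl
  | insert a T ha ih => rw [Finset.sum_insert ha, Finset.sum_insert ha, Diff.add_apply, ih]

theorem one_apply (F : Thick S n) : (one : Diff S n).1 F = MvPowerSeries.coeff 0 F := rfl

theorem one_eps (I : Fin n →₀ ℕ) : (one : Diff S n).1 (eps I) = if I = 0 then 1 else 0 := by
  classical
  rw [one_apply, MvPowerSeries.coeff_monomial]
  simp only [eq_comm]

/-- A power series all of whose monomials have degree at least `k` lies in `J ^ k`. The induction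
splits off from each monomial one variable that occurs in it. -/
theorem mem_thickIdeal_pow {k : ℕ} {F : Thick S n}
    (hF : ∀ I : Fin n →₀ ℕ, I.degree < k → MvPowerSeries.coeff I F = 0) :
    F ∈ thickIdeal S n ^ k := by
  classical
  induction k generalizing F with
  | zero => simp
  | succ k ih =>
    have h1 : ∀ I : Fin n →₀ ℕ, I ≠ 0 → ∃ i, I i ≠ 0 := fun I hI => by
      by_contra! h
      exact hI (Finsupp.ext h)
    choose v hv using h1
    -- `G i` collects the monomials from which the variable `i` is split off
    let G : Fin n → Thick S n := fun i I =>
      if h : I + Finsupp.single i 1 ≠ 0 then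
        if v _ h = i then MvPowerSeries.coeff (I + Finsupp.single i 1) F else 0 else 0
    have hG : ∀ i I, MvPowerSeries.coeff I (G i) = if h : I + Finsupp.single i 1 ≠ 0 then
        if v _ h = i then MvPowerSeries.coeff (I + Finsupp.single i 1) F else 0 else 0 :=
      fun i I => rfl
    have hFG : F = ∑ i, G i * MvPowerSeries.X i := by
      ext1 I
      rw [map_sum]
      simp only [MvPowerSeries.X, MvPowerSeries.coeff_mul_monomial, mul_one]
      by_cases hI : I = 0
      · subst hI
        rw [hF 0 (by simp)]
        refine (Finset.sum_eq_zero fun i _ => if_neg fun h => ?_).symm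
        have := h i
        simp at this
      · rw [Finset.sum_eq_single (v I hI)]
        · have hle : Finsupp.single (v I hI) 1 ≤ I := by
            rw [Finsupp.single_le_iff]
            exact Nat.one_le_iff_ne_zero.mpr (hv I hI)
          rw [if_pos hle, hG]
          simp only [tsub_add_cancel_of_le hle]
          simp [hI]
        · intro i _ hi
          split_ifs with hle
          · rw [hG]
            simp only [tsub_add_cancel_of_le hle]
            simp [hI, Ne.symm hi]
          · rfl
        · simp
    rw [hFG]
    refine Ideal.sum_mem _ fun i _ => ?_
    rw [pow_succ]
    refine Ideal.mul_mem_mul (ih fun I hI => ?_) (X_mem i)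
    rw [hG]
    split_ifs with h h'
    · exact hF _ (by rw [map_add, Finsupp.degree_single]; omega)
    · rfl
    · rfl

theorem isNull_coeff_mul (s : Diff S n) (F : Thick S n) :
    IsNull fun I => MvPowerSeries.coeff I F * s.1 (eps I) :=
  (isNull_symbol s).mul_left _

/-- A differential operator is determined by its values on the monomials `ε^I`. -/
theorem apply_eq_nullSum (s : Diff S n) (F : Thick S n) :
    s.1 F = nullSum fun I => MvPowerSeries.coeff I F * s.1 (eps I) := by
  classical
  refine eq_of_forall_dvd_sub fun m => ?_
  obtain ⟨k, hk⟩ := s.2 m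
  set T := (Finsupp.finite_of_degree_le (σ := Fin n) k).toFinset with hT
  have h1 : ∀ I, I ∉ T → (PowerSeries.X : S⟦X⟧) ^ m ∣ MvPowerSeries.coeff I F * s.1 (eps I) := by
    intro I hI
    refine Dvd.dvd.mul_left (hk _ (Ideal.pow_le_pow_right ?_ (eps_mem I))) _
    simp only [hT, Set.Finite.mem_toFinset, Set.mem_ofPred_eq, not_le] at hI
    exact hI.le
  have h2 : (PowerSeries.X : S⟦X⟧) ^ m ∣ s.1 F - ∑ I ∈ T, MvPowerSeries.coeff I F * s.1 (eps I) := by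
    have : s.1 F - ∑ I ∈ T, MvPowerSeries.coeff I F * s.1 (eps I)
        = s.1 (F - ∑ I ∈ T, MvPowerSeries.coeff I F • eps I) := by
      rw [map_sub, map_sum]
      simp only [map_smul, smul_eq_mul]
    rw [this]
    refine hk _ (mem_thickIdeal_pow fun I hI => ?_)
    rw [map_sub, map_sum, Finset.sum_eq_single I]
    · simp
    · intro A _ hA
      simp [MvPowerSeries.coeff_monomial, hA.symm]
    · intro h
      exact absurd (by simpa [hT] using hI.le) h
  have := dvd_sub h2 (dvd_nullSum_sub T h1)
  simpa using this

theorem Diff.ext_eps {s t : Diff S n} (h : ∀ I, s.1 (eps I) = t.1 (eps I)) : s = t := by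
  refine Subtype.ext (LinearMap.ext fun F => ?_)
  rw [apply_eq_nullSum s, apply_eq_nullSum t]
  simp only [h]

theorem Diff.ext_apply {s t : Diff S n} (h : ∀ F, s.1 F = t.1 F) : s = t :=
  Diff.ext_eps fun _ => h _

theorem nullSum_eq_single {ι : Type*} (u : ι → S⟦X⟧) (i : ι) (h : ∀ j, j ≠ i → u j = 0) :
    nullSum u = u i := by
  ext m
  rw [nullSum, PowerSeries.coeff_mk]
  exact finsum_eq_single _ i fun j hj => by rw [h j hj, map_zero]

theorem ofSymbol_apply (c : (Fin n →₀ ℕ) → S⟦X⟧) (hc : IsNull c) (F : Thick S n) :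
    (ofSymbol c hc).1 F = nullSum fun I => MvPowerSeries.coeff I F * c I := rfl

theorem ofSymbol_eps (c : (Fin n →₀ ℕ) → S⟦X⟧) (hc : IsNull c) (I : Fin n →₀ ℕ) :
    (ofSymbol c hc).1 (eps I) = c I := by
  classical
  rw [ofSymbol_apply, nullSum_eq_single _ I]
  · simp
  · intro J hJ
    simp [MvPowerSeries.coeff_monomial, hJ]

theorem dvd_apply_of_dvd_eps {s : Diff S n} {m : ℕ}
    (h : ∀ I, (PowerSeries.X : S⟦X⟧) ^ m ∣ s.1 (eps I)) (F : Thick S n) :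
    (PowerSeries.X : S⟦X⟧) ^ m ∣ s.1 F := by
  rw [apply_eq_nullSum]
  exact dvd_nullSum fun I => Dvd.dvd.mul_left (h I) _

theorem X_pow_mul_cancel {m : ℕ} {a b : S⟦X⟧}
    (h : (PowerSeries.X : S⟦X⟧) ^ m * a = PowerSeries.X ^ m * b) : a = b := by
  ext k
  have := congrArg (PowerSeries.coeff (k + m)) h
  rwa [PowerSeries.coeff_X_pow_mul, PowerSeries.coeff_X_pow_mul] at this

theorem Diff.X_pow_smul_cancel {m : ℕ} {s t : Diff S n}
    (h : (PowerSeries.X : S⟦X⟧) ^ m • s = (PowerSeries.X : S⟦X⟧) ^ m • t) : s = t :=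
  Diff.ext_eps fun I => X_pow_mul_cancel (congrArg (fun u : Diff S n => u.1 (eps I)) h)

theorem isNull_of_X_pow_mul {ι : Type*} {c : ι → S⟦X⟧} {m : ℕ}
    (h : IsNull fun i => (PowerSeries.X : S⟦X⟧) ^ m * c i) : IsNull c := by
  intro k
  refine (h (m + k)).subset fun i hi hd => hi ?_
  obtain ⟨b, hb⟩ := hd
  rw [pow_add, mul_assoc] at hb
  exact ⟨b, X_pow_mul_cancel hb⟩

theorem exists_X_pow_smul_of_dvd {s : Diff S n} {m : ℕ}
    (h : ∀ I, (PowerSeries.X : S⟦X⟧) ^ m ∣ s.1 (eps I)) :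
    ∃ d : Diff S n, s = (PowerSeries.X : S⟦X⟧) ^ m • d := by
  choose c hc using h
  have hn : IsNull c := isNull_of_X_pow_mul (m := m) (by simpa only [← hc] using isNull_symbol s)
  refine ⟨ofSymbol c hn, Diff.ext_eps fun I => ?_⟩
  rw [Diff.smul_apply, ofSymbol_eps, hc]

theorem Diff.eq_zero_of_forall_X_pow_smul {s : Diff S n}
    (h : ∀ m : ℕ, ∃ d : Diff S n, s = (PowerSeries.X : S⟦X⟧) ^ m • d) : s = 0 := by
  refine Diff.ext_eps fun I => eq_of_forall_dvd_sub fun m => ?_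
  obtain ⟨d, rfl⟩ := h m
  rw [Diff.zero_apply, sub_zero]
  exact ⟨_, rfl⟩

/-- `(q-1)`-adic completeness of `Diff`: the series `∑_k (q-1)^k d_k` converges. -/
theorem Diff.exists_series (d : ℕ → Diff S n) :
    ∃ s : Diff S n, ∀ m, ∃ e : Diff S n,
      s = ∑ k ∈ Finset.range m, (PowerSeries.X : S⟦X⟧) ^ k • d k
        + (PowerSeries.X : S⟦X⟧) ^ m • e := by
  let c : (Fin n →₀ ℕ) → S⟦X⟧ := fun I =>
    nullSum fun k : ℕ => (PowerSeries.X : S⟦X⟧) ^ k * (d k).1 (eps I)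
  have hd : ∀ I m, (PowerSeries.X : S⟦X⟧) ^ m ∣
      c I - ∑ k ∈ Finset.range m, (PowerSeries.X : S⟦X⟧) ^ k * (d k).1 (eps I) := by
    intro I m
    refine dvd_nullSum_sub _ fun k hk => Dvd.dvd.mul_right (pow_dvd_pow _ ?_) _
    simpa using hk
  have hc : IsNull c := by
    intro m
    refine ((Finset.range m).finite_toSet.biUnion fun k _ => isNull_symbol (d k) m).subset
      fun I hI => ?_
    by_contra h
    simp only [Set.mem_iUnion, not_exists, Set.mem_ofPred_eq, not_not] at h
    refine hI ((dvd_sub_left (Finset.dvd_sum fun k hk => ?_)).mp (hd I m))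
    exact Dvd.dvd.mul_left (h k hk) _
  refine ⟨ofSymbol c hc, fun m => ?_⟩
  obtain ⟨e, he⟩ := exists_X_pow_smul_of_dvd (m := m)
    (s := ofSymbol c hc - ∑ k ∈ Finset.range m, (PowerSeries.X : S⟦X⟧) ^ k • d k) (fun I => by
      rw [Diff.sub_apply, ofSymbol_eps, Diff.sum_apply]
      exact hd I m)
  exact ⟨e, by rw [← he]; abel⟩

end Symbols

/-! ### The Taylor homomorphism and the translations of the `ε_i` -/

section Translate

variable {S : Type*} [CommRing S] {n : ℕ}

/-- The Vandermonde identity for multi-indices. -/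
theorem sum_antidiagonal_prod_choose (I J A : Fin n →₀ ℕ) :
    ∑ p ∈ Finset.HasAntidiagonal.antidiagonal A,
      (∏ i, (I i).choose (p.1 i)) * ∏ i, (J i).choose (p.2 i)
      = ∏ i, (I i + J i).choose (A i) := by
  classical
  simp only [Nat.add_choose_eq, Finset.prod_univ_sum, ← Finset.prod_mul_distrib]
  refine Finset.sum_bij' (fun p _ i => (p.1 i, p.2 i))
    (fun g _ => (Finsupp.equivFunOnFinite.symm fun i => (g i).1,
      Finsupp.equivFunOnFinite.symm fun i => (g i).2)) ?_ ?_ ?_ ?_ ?_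
  · intro p hp
    rw [Finset.HasAntidiagonal.mem_antidiagonal] at hp
    simp [← hp]
  · intro g hg
    rw [Fintype.mem_piFinset] at hg
    rw [Finset.HasAntidiagonal.mem_antidiagonal]
    ext i
    simpa using hg i
  · intro p _
    ext <;> simp
  · intro g _
    ext <;> simp
  · intro p _
    rfl

/-- The map underlying the substitution `ε ↦ ε + τ`, see `translate`. -/
def translateFun (F : MvPowerSeries (Fin n) S) :
    MvPowerSeries (Fin n) (MvPowerSeries (Fin n) S) :=
  fun B A => ((∏ i, (A i + B i).choose (A i) : ℕ) : S) * MvPowerSeries.coeff (A + B) F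

theorem coeff_coeff_translateFun (F : MvPowerSeries (Fin n) S) (B A : Fin n →₀ ℕ) :
    MvPowerSeries.coeff A (MvPowerSeries.coeff B (translateFun F)) =
      ((∏ i, (A i + B i).choose (A i) : ℕ) : S) * MvPowerSeries.coeff (A + B) F := rfl

/-- The substitution `ε ↦ ε + τ`, from series in `ε` to series in `τ` whose coefficients are
series in `ε`: the coefficient of `ε^A τ^B` is `(A + B choose A) F_{A + B}`. -/
def translate : MvPowerSeries (Fin n) S →+* MvPowerSeries (Fin n) (MvPowerSeries (Fin n) S) where
  toFun := translateFun
  map_zero' := by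
    ext B A
    simp [coeff_coeff_translateFun]
  map_one' := by
    classical
    ext B A
    rw [coeff_coeff_translateFun, MvPowerSeries.coeff_one, MvPowerSeries.coeff_one]
    by_cases hB : B = 0
    · subst hB
      rw [if_pos rfl, MvPowerSeries.coeff_one]
      by_cases hA : A = 0 <;> simp [hA]
    · rw [if_neg hB, if_neg (by simp [hB]), mul_zero, map_zero]
  map_add' F G := by
    ext B A
    simp only [coeff_coeff_translateFun, map_add, mul_add]
  map_mul' F G := by
    classical
    ext B A
    rw [MvPowerSeries.coeff_mul, map_sum, coeff_coeff_translateFun, MvPowerSeries.coeff_mul]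
    simp only [MvPowerSeries.coeff_mul, coeff_coeff_translateFun]
    have hV : ∀ q ∈ Finset.HasAntidiagonal.antidiagonal (A + B),
        ((∏ i, (A i + B i).choose (A i) : ℕ) : S) *
          (MvPowerSeries.coeff q.1 F * MvPowerSeries.coeff q.2 G) =
        ∑ p ∈ Finset.HasAntidiagonal.antidiagonal A,
          (((∏ i, (q.1 i).choose (p.1 i) : ℕ) : S) * MvPowerSeries.coeff q.1 F) *
          (((∏ i, (q.2 i).choose (p.2 i) : ℕ) : S) * MvPowerSeries.coeff q.2 G) := by
      intro q hq
      rw [Finset.HasAntidiagonal.mem_antidiagonal] at hq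
      have h1 : ∀ i, A i + B i = q.1 i + q.2 i := fun i => by
        rw [← Finsupp.add_apply, ← hq, Finsupp.add_apply]
      simp only [h1]
      rw [← sum_antidiagonal_prod_choose q.1 q.2 A, Nat.cast_sum, Finset.sum_mul]
      refine Finset.sum_congr rfl fun p _ => ?_
      rw [Nat.cast_mul]
      ring
    rw [Finset.mul_sum, Finset.sum_congr rfl hV, Finset.sum_comm,
      Finset.sum_comm (s := Finset.HasAntidiagonal.antidiagonal B)]
    refine Finset.sum_congr rfl fun p hp => ?_
    rw [Finset.HasAntidiagonal.mem_antidiagonal] at hp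
    -- the terms with `p.1 ≰ q.1` or `p.2 ≰ q.2` vanish, the others have `q = p + r`
    symm
    refine Finset.sum_of_injOn (fun r => (p.1 + r.1, p.2 + r.2)) ?_ ?_ ?_ ?_
    · rintro ⟨r1, r2⟩ _ ⟨s1, s2⟩ _ h
      simpa using h
    · rintro ⟨r1, r2⟩ hr
      simp only [Finset.mem_coe, Finset.HasAntidiagonal.mem_antidiagonal] at hr ⊢
      rw [← hp, ← hr]
      abel
    · rintro ⟨q1, q2⟩ hq hq'
      simp only [Finset.HasAntidiagonal.mem_antidiagonal] at hq
      by_cases h1 : p.1 ≤ q1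
      · by_cases h2 : p.2 ≤ q2
        · refine absurd ⟨(q1 - p.1, q2 - p.2), ?_, ?_⟩ hq'
          · simp only [Finset.mem_coe, Finset.HasAntidiagonal.mem_antidiagonal]
            have : p.1 + p.2 + (q1 - p.1 + (q2 - p.2)) = p.1 + p.2 + B := by
              rw [add_add_add_comm, add_tsub_cancel_of_le h1, add_tsub_cancel_of_le h2, hp, hq]
            exact add_left_cancel this
          · simp [add_tsub_cancel_of_le h1, add_tsub_cancel_of_le h2]
        · obtain ⟨i, hi⟩ := not_forall.mp (show ¬ ∀ i, p.2 i ≤ q2 i from h2)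
          rw [Finset.prod_eq_zero (i := i) (f := fun i => (q2 i).choose (p.2 i))
            (Finset.mem_univ i) (Nat.choose_eq_zero_of_lt (not_le.mp hi))]
          simp
      · obtain ⟨i, hi⟩ := not_forall.mp (show ¬ ∀ i, p.1 i ≤ q1 i from h1)
        rw [Finset.prod_eq_zero (i := i) (f := fun i => (q1 i).choose (p.1 i))
          (Finset.mem_univ i) (Nat.choose_eq_zero_of_lt (not_le.mp hi))]
        simp
    · intro r _
      rfl

theorem coeff_coeff_translate (F : MvPowerSeries (Fin n) S) (B A : Fin n →₀ ℕ) :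
    MvPowerSeries.coeff A (MvPowerSeries.coeff B (translate F)) =
      ((∏ i, (A i + B i).choose (A i) : ℕ) : S) * MvPowerSeries.coeff (A + B) F := rfl

theorem constantCoeff_translate (F : MvPowerSeries (Fin n) S) :
    MvPowerSeries.constantCoeff (translate F) = F := by
  ext A
  rw [← MvPowerSeries.coeff_zero_eq_constantCoeff_apply, coeff_coeff_translate]
  simp

theorem translate_C (a : S) : translate (MvPowerSeries.C a : MvPowerSeries (Fin n) S) =
    MvPowerSeries.C (MvPowerSeries.C a) := by
  classical
  ext B A
  rw [coeff_coeff_translate, MvPowerSeries.coeff_C, MvPowerSeries.coeff_C]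
  by_cases hB : B = 0
  · subst hB
    by_cases hA : A = 0
    · simp [hA]
    · simp [hA, MvPowerSeries.coeff_C]
  · rw [if_neg (by simp [hB]), if_neg hB]
    simp

theorem translate_X (i : Fin n) : translate (MvPowerSeries.X i : MvPowerSeries (Fin n) S) =
    MvPowerSeries.C (MvPowerSeries.X i) + MvPowerSeries.X i := by
  classical
  ext B A
  rw [coeff_coeff_translate, map_add, map_add, MvPowerSeries.coeff_C, MvPowerSeries.coeff_X,
    MvPowerSeries.coeff_X]
  by_cases h : A + B = Finsupp.single i 1
  · rw [if_pos h]
    by_cases hB : B = 0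
    · subst hB
      rw [add_zero] at h
      subst h
      have h0 : (0 : Fin n →₀ ℕ) ≠ Finsupp.single i 1 := by simp [eq_comm]
      simp [MvPowerSeries.coeff_X, h0]
    · have hA : A = 0 := by
        have h1 : ∃ j, B j ≠ 0 := by
          by_contra! h'
          exact hB (Finsupp.ext h')
        obtain ⟨j, hj⟩ := h1
        have h3 : j = i := by
          by_contra hji
          have := DFunLike.congr_fun h j
          rw [Finsupp.add_apply, Finsupp.single_eq_of_ne hji] at this
          omega
        subst h3
        ext l
        have := DFunLike.congr_fun h l
        rw [Finsupp.add_apply, Finsupp.single_apply] at this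
        rw [Finsupp.zero_apply]
        split_ifs at this with hl
        · subst hl
          omega
        · omega
      subst hA
      rw [zero_add] at h
      subst h
      simp
  · rw [if_neg h]
    by_cases hB : B = 0
    · subst hB
      rw [add_zero] at h
      simp [MvPowerSeries.coeff_X, h, eq_comm]
    · rw [if_neg hB]
      by_cases hB' : B = Finsupp.single i 1
      · subst hB'
        have hA : A ≠ 0 := fun h' => h (by simp [h'])
        simp [MvPowerSeries.coeff_one, hA]
      · simp [hB']

end Translate

section Coordinates

variable {S : Type*} [CommRing S] {n : ℕ}

/-- The properties of the coordinates `x` of a `ℤ`-torsion free ring `S` on which the calculus of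
differential operators depends: the Taylor homomorphism exists, and it is iterative,
that is, its coefficients `D_A` satisfy `D_B D_A = (A + B choose A) D_{A + B}`. -/
structure IsCoordSystem (x : Fin n → S) : Prop where
  isTaylor : IsTaylor x (taylor x)
  iterative : ∀ f A B, MvPowerSeries.coeff B (taylor x (MvPowerSeries.coeff A (taylor x f))) =
    ((∏ i, (A i + B i).choose (A i) : ℕ) : S) * MvPowerSeries.coeff (A + B) (taylor x f)
  torsionFree : ∀ k : ℕ, k ≠ 0 → ∀ a : S, (k : S) * a = 0 → a = 0

theorem isTaylor_taylor {x : Fin n → S} (h : ∃ d, IsTaylor x d) : IsTaylor x (taylor x) := by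
  rw [taylor, dif_pos h]
  exact h.choose_spec

/-- If homomorphisms from `S` to the series over `S[[ε]]` are determined by their constant terms
and by their values at the coordinates, then the Taylor homomorphism is iterative:
both `f ↦ ∑_B δ₀(D_B f) τ^B` and `f ↦ (δ₀ f)(ε + τ)` extend `δ₀` and send `x_i` to
`x_i + ε_i + τ_i`. -/
theorem IsCoordSystem.of_unique {x : Fin n → S} (h : ∃ d, IsTaylor x d)
    (hu : ∀ g g' : S →+* MvPowerSeries (Fin n) (MvPowerSeries (Fin n) S),
      (∀ r, MvPowerSeries.constantCoeff (g r) = MvPowerSeries.constantCoeff (g' r)) →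
      (∀ i, g (x i) = g' (x i)) → g = g')
    (htf : ∀ k : ℕ, k ≠ 0 → ∀ a : S, (k : S) * a = 0 → a = 0) : IsCoordSystem x := by
  have hT := isTaylor_taylor h
  refine ⟨hT, fun f A B => ?_, htf⟩
  have key : (MvPowerSeries.map (taylor x)).comp (taylor x) = translate.comp (taylor x) := by
    refine hu _ _ (fun r => ?_) fun i => ?_
    · rw [RingHom.comp_apply, RingHom.comp_apply, constantCoeff_translate,
        MvPowerSeries.constantCoeff_map, hT.constantCoeff]
    · rw [RingHom.comp_apply, RingHom.comp_apply, hT.coord, map_add, map_add, translate_C,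
        translate_X, MvPowerSeries.map_C, MvPowerSeries.map_X, hT.coord, map_add, add_assoc]
  have h2 := congrArg (fun g => MvPowerSeries.coeff B (MvPowerSeries.coeff A (g f))) key
  simp only [RingHom.comp_apply, MvPowerSeries.coeff_map, coeff_coeff_translate] at h2
  rw [h2, add_comm B A]
  congr 2
  refine Finset.prod_congr rfl fun i _ => ?_
  rw [add_comm (B i) (A i), Nat.choose_symm_add]

end Coordinates

section Etale

variable {R : Type*} [CommRing R] {n : ℕ}

/-- `R` is torsion free because it is flat over `ℤ[x_1, …, x_n]`. -/
theorem torsionFree_of_etale {ψ : MvPolynomial (Fin n) ℤ →+* R} (hψ : ψ.Etale) (k : ℕ)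
    (hk : k ≠ 0) (a : R) (h : (k : R) * a = 0) : a = 0 := by
  let _ : Algebra (MvPolynomial (Fin n) ℤ) R := ψ.toAlgebra
  have : Algebra.Etale (MvPolynomial (Fin n) ℤ) R := hψ
  have h1 : Module.Flat (MvPolynomial (Fin n) ℤ) R := inferInstance
  have h2 : Module.Flat ℤ R := Module.Flat.trans ℤ (MvPolynomial (Fin n) ℤ) R
  have h3 : Module.IsTorsionFree ℤ R := inferInstance
  have h4 : (k : ℤ) • a = 0 := by simpa using h
  exact (smul_eq_zero.mp h4).resolve_left (by exact_mod_cast hk)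

theorem isCoordSystem_coord {ψ : MvPolynomial (Fin n) ℤ →+* R} (hψ : ψ.Etale) :
    IsCoordSystem (coord ψ) :=
  .of_unique (existsUnique_taylor hψ).exists (fun _ _ h1 h2 => lift_unique hψ h1 h2)
    (torsionFree_of_etale hψ)

theorem Cp_dvd_iff (p m : ℕ) (r : R) :
    (p : Cp R p) ^ m ∣ algebraMap R (Cp R p) r ↔ (p : R) ^ m ∣ r := by
  refine ⟨fun h => ?_, fun h => by simpa using map_dvd (algebraMap R (Cp R p)) h⟩
  have h1 := (powerSeries_Cp_isCompletion (R := R) p).2.2 m (PowerSeries.C r)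
  have h2 : algebraMap R⟦X⟧ (Cp R p)⟦X⟧ (PowerSeries.C r)
      = PowerSeries.C (algebraMap R (Cp R p) r) := PowerSeries.map_C _ _
  rw [h2] at h1
  have h3 : ∀ (T : Type _) [CommRing T], (p : T⟦X⟧) ^ m = PowerSeries.C ((p : T) ^ m) := by
    intro T _
    simp
  rw [h3, h3] at h1
  obtain ⟨c, hc⟩ := h1 (map_dvd _ h)
  have := congrArg (PowerSeries.coeff 0) hc
  rw [PowerSeries.coeff_C_mul, PowerSeries.coeff_zero_C] at this
  exact ⟨_, this⟩

/-- An integer prime to `p` is a unit in the `p`-adic completion. -/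
theorem isUnit_natCast_Cp {p N : ℕ} (hp : p.Prime) (hN : ¬ p ∣ N) : IsUnit (N : Cp R p) := by
  have := isAdicComplete_Cp (R := R) p
  have h1 : (p : Cp R p) ∈ (⊥ : Ideal (Cp R p)).jacobson :=
    IsAdicComplete.le_jacobson_bot (Ideal.span {(p : Cp R p)}) (Ideal.mem_span_singleton_self _)
  have h2 : IsCoprime (N : ℤ) (p : ℤ) :=
    Nat.isCoprime_iff_coprime.mpr ((Nat.Prime.coprime_iff_not_dvd hp).mpr hN).symm
  obtain ⟨a, b, hab⟩ := h2
  have h3 : (a : Cp R p) * N = (p : Cp R p) * (-b) + 1 := by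
    have := congrArg (Int.cast : ℤ → Cp R p) hab
    push_cast at this
    rw [← this]
    ring
  have h4 := Ideal.mem_jacobson_bot.mp h1 (-(b : Cp R p))
  rw [← h3] at h4
  exact isUnit_of_mul_isUnit_right h4

theorem Cp_prime_torsionFree {p : ℕ} (htf : ∀ a : R, (p : R) * a = 0 → a = 0) (y : Cp R p)
    (h : (p : Cp R p) * y = 0) : y = 0 := by
  have := isAdicComplete_Cp (R := R) p
  refine IsHausdorff.haus' (I := Ideal.span {(p : Cp R p)}) _ fun m => ?_
  rw [SModEq.zero, smul_eq_mul, Ideal.mul_top, Ideal.span_singleton_pow,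
    Ideal.mem_span_singleton]
  obtain ⟨r, z, rfl⟩ := Cp_exists_eq p y m
  have h1 : (p : Cp R p) ^ (m + 1) ∣ algebraMap R (Cp R p) (p * r) := by
    refine ⟨-z, ?_⟩
    rw [map_mul, map_natCast]
    linear_combination h
  rw [Cp_dvd_iff] at h1
  obtain ⟨c, hc⟩ := h1
  have h2 : r = p ^ m * c := by
    rw [← sub_eq_zero]
    refine htf _ ?_
    linear_combination hc
  refine dvd_add ?_ (Dvd.intro _ rfl)
  rw [Cp_dvd_iff]
  exact ⟨c, h2⟩

theorem Cp_torsionFree {p : ℕ} (hp : p.Prime)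
    (htf : ∀ k : ℕ, k ≠ 0 → ∀ a : R, (k : R) * a = 0 → a = 0) (k : ℕ) (hk : k ≠ 0) (y : Cp R p)
    (h : (k : Cp R p) * y = 0) : y = 0 := by
  obtain ⟨v, N, hN, rfl⟩ := Nat.exists_eq_pow_mul_and_not_dvd hk p hp.ne_one
  rw [Nat.cast_mul, mul_comm ((p ^ v : ℕ) : Cp R p), mul_assoc] at h
  replace h := (isUnit_natCast_Cp hp hN).mul_right_eq_zero.mp h
  clear hk
  induction v with
  | zero => simpa using h
  | succ v ih =>
    rw [pow_succ', Nat.cast_mul, mul_assoc] at h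
    exact ih (Cp_prime_torsionFree (htf p hp.ne_zero) _ h)

theorem Cp_lift_unique {ψ : MvPolynomial (Fin n) ℤ →+* R} (hψ : ψ.Etale) (p : ℕ)
    {T : Type*} [CommRing T] [IsAdicComplete (Ideal.span {(p : T)}) T]
    {g g' : Cp R p →+* MvPowerSeries (Fin n) T}
    (h : ∀ r, MvPowerSeries.constantCoeff (g r) = MvPowerSeries.constantCoeff (g' r))
    (hx : ∀ i, g (coordp ψ p i) = g' (coordp ψ p i)) : g = g' := by
  have := isAdicComplete_mvPowerSeries p (σ := Fin n) (T := T)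
  refine Cp_ringHom_ext p fun r => ?_
  have : g.comp (algebraMap R (Cp R p)) = g'.comp (algebraMap R (Cp R p)) :=
    lift_unique hψ (fun r => h _) hx
  exact congrArg (fun k => k r) this

theorem isCoordSystem_coordp {ψ : MvPolynomial (Fin n) ℤ →+* R} (hψ : ψ.Etale) {p : ℕ}
    (hp : p.Prime) : IsCoordSystem (coordp ψ p) := by
  have := isAdicComplete_Cp (R := R) p
  have := isAdicComplete_mvPowerSeries p (σ := Fin n) (T := Cp R p)
  exact .of_unique (existsUnique_taylor_completion hψ p).exists
    (fun _ _ h1 h2 => Cp_lift_unique hψ p h1 h2) (Cp_torsionFree hp (torsionFree_of_etale hψ))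

/-- The Taylor homomorphisms of `R` and `R_p` are compatible. -/
theorem taylor_algebraMap {ψ : MvPolynomial (Fin n) ℤ →+* R} (hψ : ψ.Etale) {p : ℕ}
    (r : R) : taylor (coordp ψ p) (algebraMap R (Cp R p) r) =
      MvPowerSeries.map (algebraMap R (Cp R p)) (taylor (coord ψ) r) := by
  have h1 := isTaylor_taylor (existsUnique_taylor hψ).exists
  have h2 := isTaylor_taylor (existsUnique_taylor_completion hψ p).exists
  have : (taylor (coordp ψ p)).comp (algebraMap R (Cp R p)) =
      (MvPowerSeries.map (algebraMap R (Cp R p))).comp (taylor (coord ψ)) := by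
    refine lift_unique hψ (fun r => ?_) fun i => ?_
    · rw [RingHom.comp_apply, RingHom.comp_apply, h2.constantCoeff,
        MvPowerSeries.constantCoeff_map, h1.constantCoeff]
    · rw [RingHom.comp_apply, RingHom.comp_apply, h1.coord, map_add, MvPowerSeries.map_C,
        MvPowerSeries.map_X]
      exact h2.coord i
  exact congrArg (fun k => k r) this

end Etale

/-! ### Composition of differential operators -/

section Composition

variable {S : Type*} [CommRing S] {n : ℕ} {x : Fin n → S}

theorem op_apply (x : Fin n → S) (s : Diff S n) (f : S⟦X⟧) : op x s f = s.1 (delta0 x f) := rfl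

/-- The operator `F ↦ t(F G)`. -/
def Diff.mulRight (t : Diff S n) (G : Thick S n) : Diff S n :=
  Subtype.mk (p := (· ∈ diffSubmodule S n)) (t.1 ∘ₗ LinearMap.mulRight S⟦X⟧ G) (by
    intro m
    obtain ⟨k, hk⟩ := t.2 m
    exact ⟨k, fun F hF => hk _ (Ideal.mul_mem_right _ _ hF)⟩)

theorem Diff.mulRight_apply (t : Diff S n) (G F : Thick S n) :
    (t.mulRight G).1 F = t.1 (F * G) := rfl

/-- The operator whose composite with `δ₀` is `f ↦ t(δ₀(D_A f))`, where `D_A f` is the coefficient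
of `ε^A` in `δ₀ f`, see `IsCoordSystem.hasse_delta0`. -/
def Diff.hasse (t : Diff S n) (A : Fin n →₀ ℕ) : Diff S n :=
  ofSymbol (fun I => ((∏ i, (I i).choose (A i) : ℕ) : S⟦X⟧) * t.1 (eps (I - A))) (by
    refine IsNull.mul_left (fun m => ?_) _
    obtain ⟨k, hk⟩ := t.2 m
    refine (Finsupp.finite_of_degree_le (σ := Fin n) (k + A.degree)).subset fun I hI => ?_
    by_contra h
    refine hI (hk _ (Ideal.pow_le_pow_right ?_ (eps_mem _)))
    simp only [Set.mem_ofPred_eq, not_le] at h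
    have : I.degree ≤ (I - A).degree + A.degree := by
      rw [← map_add]
      exact Finsupp.degree_mono le_tsub_add
    omega)

theorem prod_choose_eq_zero {I A : Fin n →₀ ℕ} (h : ¬ A ≤ I) : ∏ i, (I i).choose (A i) = 0 := by
  obtain ⟨i, hi⟩ := not_forall.mp (show ¬ ∀ i, A i ≤ I i from h)
  exact Finset.prod_eq_zero (Finset.mem_univ i) (Nat.choose_eq_zero_of_lt (not_le.mp hi))

theorem nullSum_comp_add (A : Fin n →₀ ℕ) (u : (Fin n →₀ ℕ) → S⟦X⟧)
    (h : ∀ I, ¬ A ≤ I → u I = 0) : nullSum (fun B => u (A + B)) = nullSum u := by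
  ext m
  rw [nullSum, nullSum, PowerSeries.coeff_mk, PowerSeries.coeff_mk]
  refine (finsum_mem_range (f := fun I => PowerSeries.coeff m (u I))
    (add_right_injective A)).symm.trans ?_
  rw [← finsum_mem_univ (fun I => PowerSeries.coeff m (u I))]
  refine finsum_mem_inter_support_eq _ _ _ (Set.ext fun I => ?_)
  simp only [Set.mem_inter_iff, Set.mem_range, Function.mem_support, Set.mem_univ, true_and,
    and_iff_right_iff_imp]
  intro hI
  refine ⟨I - A, add_tsub_cancel_of_le ?_⟩
  by_contra hA
  exact hI (by rw [h I hA, map_zero])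

theorem IsCoordSystem.iterative_delta0 (h : IsCoordSystem x) (f : S⟦X⟧) (A B : Fin n →₀ ℕ) :
    MvPowerSeries.coeff B (delta0 x (MvPowerSeries.coeff A (delta0 x f))) =
      ((∏ i, (A i + B i).choose (A i) : ℕ) : S⟦X⟧) * MvPowerSeries.coeff (A + B) (delta0 x f) := by
  ext k
  rw [coeff_coeff_delta0, coeff_coeff_delta0, h.iterative, ← map_natCast (PowerSeries.C (R := S)),
    PowerSeries.coeff_C_mul, coeff_coeff_delta0]

theorem IsCoordSystem.hasse_delta0 (h : IsCoordSystem x) (t : Diff S n) (A : Fin n →₀ ℕ)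
    (f : S⟦X⟧) : (t.hasse A).1 (delta0 x f) =
      t.1 (delta0 x (MvPowerSeries.coeff A (delta0 x f))) := by
  rw [apply_eq_nullSum t, Diff.hasse, ofSymbol_apply, ← nullSum_comp_add A]
  · congr 1
    funext B
    rw [h.iterative_delta0, add_tsub_cancel_left]
    simp only [Finsupp.add_apply]
    ring
  · intro I hI
    rw [prod_choose_eq_zero hI]
    simp

theorem IsCoordSystem.coeff_zero_delta0 (h : IsCoordSystem x) (f : S⟦X⟧) :
    MvPowerSeries.coeff 0 (delta0 x f) = f := by
  ext k
  rw [coeff_coeff_delta0, MvPowerSeries.coeff_zero_eq_constantCoeff_apply,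
    h.isTaylor.constantCoeff]

theorem IsCoordSystem.delta0_C (h : IsCoordSystem x) (i : Fin n) :
    delta0 x (PowerSeries.C (x i)) =
      MvPowerSeries.C (PowerSeries.C (x i)) + MvPowerSeries.X i := by
  classical
  ext I k
  rw [coeff_coeff_delta0, map_add, map_add, MvPowerSeries.coeff_C, MvPowerSeries.coeff_X,
    PowerSeries.coeff_C]
  by_cases hk : k = 0
  · subst hk
    rw [if_pos rfl, h.isTaylor.coord, map_add, MvPowerSeries.coeff_C, MvPowerSeries.coeff_X]
    congr 1 <;> split_ifs <;> simp
  · rw [if_neg hk, map_zero, map_zero]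
    split_ifs <;> simp [hk, PowerSeries.coeff_C, PowerSeries.coeff_one]

theorem comp_eps (x : Fin n → S) (t s : Diff S n) (I : Fin n →₀ ℕ) :
    (comp x t s).1 (eps I) = ∑ p ∈ Finset.HasAntidiagonal.antidiagonal I,
      ((∏ i, (I i).choose (p.1 i) : ℕ) : S⟦X⟧) * t.1 (delta0 x (s.1 (eps p.1)) * eps p.2) :=
  ofSymbol_eps _ _ I

theorem Diff.hasse_eps (t : Diff S n) (A I : Fin n →₀ ℕ) :
    (t.hasse A).1 (eps I) = ((∏ i, (I i).choose (A i) : ℕ) : S⟦X⟧) * t.1 (eps (I - A)) :=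
  ofSymbol_eps _ _ I

/-- The defining property of the product. Modulo `(q-1)^m`, the operator `t ∘ s` is a finite sum of
operators `f ↦ t(δ₀(s(ε^A) D_A f))`, and `s(δ₀ f)` is the sum of the `s(ε^A) D_A f`. -/
theorem IsCoordSystem.op_comp (h : IsCoordSystem x) (t s : Diff S n) (f : S⟦X⟧) :
    op x (comp x t s) f = op x t (op x s f) := by
  classical
  refine eq_of_forall_dvd_sub fun m => ?_
  obtain ⟨k, hk⟩ := t.2 m
  -- modulo `(q-1)^m`, only the finitely many `A` in `T` contribute
  set T := (isNull_symbol s k).toFinset with hT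
  have hT' : ∀ A, A ∉ T → (PowerSeries.X : S⟦X⟧) ^ k ∣ s.1 (eps A) := fun A hA => by
    by_contra h
    exact hA (by simpa [hT] using h)
  set G : (Fin n →₀ ℕ) → Thick S n := fun A => delta0 x (s.1 (eps A)) with hG
  set u : Diff S n := ∑ A ∈ T, (t.mulRight (G A)).hasse A with hu
  have h1 : ∀ F, (PowerSeries.X : S⟦X⟧) ^ m ∣ (comp x t s - u).1 F := by
    refine dvd_apply_of_dvd_eps fun I => ?_
    rw [Diff.sub_apply, hu, Diff.sum_apply, comp_eps]
    simp only [Diff.hasse_eps, Diff.mulRight_apply]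
    have e : ∑ A ∈ T, ((∏ i, (I i).choose (A i) : ℕ) : S⟦X⟧) * t.1 (eps (I - A) * G A) =
        ∑ p ∈ (Finset.HasAntidiagonal.antidiagonal I).filter fun p => p.1 ∈ T,
          ((∏ i, (I i).choose (p.1 i) : ℕ) : S⟦X⟧) * t.1 (G p.1 * eps p.2) := by
      symm
      refine Finset.sum_of_injOn (fun p => p.1) ?_ ?_ ?_ ?_
      · rintro ⟨p1, p2⟩ hp ⟨r1, r2⟩ hr (rfl : p1 = r1)
        simp only [Finset.coe_filter, Finset.HasAntidiagonal.mem_antidiagonal,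
          Set.mem_ofPred_eq] at hp hr
        rw [← hr.1] at hp
        rw [add_left_cancel hp.1]
      · rintro p hp
        simp only [Finset.coe_filter, Set.mem_ofPred_eq] at hp
        exact hp.2
      · intro A hA hA'
        rw [prod_choose_eq_zero, Nat.cast_zero, zero_mul]
        intro hle
        refine hA' ⟨(A, I - A), ?_, rfl⟩
        simp [add_tsub_cancel_of_le hle, hA]
      · rintro ⟨p1, p2⟩ hp
        simp only [Finset.mem_filter, Finset.HasAntidiagonal.mem_antidiagonal] at hp
        rw [mul_comm (G p1), ← hp.1, add_tsub_cancel_left]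
    rw [e, ← Finset.sum_filter_add_sum_filter_not (Finset.HasAntidiagonal.antidiagonal I)
      (fun p => p.1 ∈ T), add_sub_cancel_left]
    refine Finset.dvd_sum fun p hp => Dvd.dvd.mul_left (hk _ (Ideal.mul_mem_right _ _ ?_)) _
    exact delta0_mem x (hT' _ (Finset.mem_filter.mp hp).2)
  have h2 : u.1 (delta0 x f) =
      t.1 (delta0 x (∑ A ∈ T, MvPowerSeries.coeff A (delta0 x f) * s.1 (eps A))) := by
    rw [hu, Diff.sum_apply, map_sum, map_sum]
    refine Finset.sum_congr rfl fun A _ => ?_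
    rw [h.hasse_delta0, Diff.mulRight_apply, map_mul (delta0 x)]
  have h3 : (PowerSeries.X : S⟦X⟧) ^ k ∣
      op x s f - ∑ A ∈ T, MvPowerSeries.coeff A (delta0 x f) * s.1 (eps A) := by
    rw [op_apply, apply_eq_nullSum s]
    exact dvd_nullSum_sub T fun A hA => Dvd.dvd.mul_left (hT' A hA) _
  have h4 := hk _ (delta0_mem x h3)
  have h5 := h1 (delta0 x f)
  rw [Diff.sub_apply, h2] at h5
  rw [map_sub, map_sub] at h4
  have h6 := dvd_sub h5 h4
  rw [sub_sub_sub_cancel_right] at h6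
  exact h6

theorem IsCoordSystem.op_one (h : IsCoordSystem x) (f : S⟦X⟧) : op x one f = f :=
  h.coeff_zero_delta0 f

theorem op_add (s t : Diff S n) (f : S⟦X⟧) : op x (s + t) f = op x s f + op x t f := rfl

theorem op_smul (b : S⟦X⟧) (s : Diff S n) (f : S⟦X⟧) : op x (b • s) f = b * op x s f := rfl

theorem op_X_pow_mul (s : Diff S n) (m : ℕ) (f : S⟦X⟧) :
    op x s (PowerSeries.X ^ m * f) = PowerSeries.X ^ m * op x s f := by
  rw [op_apply, map_mul, map_pow, delta0_X, ← map_pow, ← MvPowerSeries.smul_eq_C_mul, map_smul]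
  rfl

/-- The monomials `x^I` in the coordinates. -/
def monomials (x : Fin n → S) : Submonoid S⟦X⟧ :=
  Submonoid.closure (Set.range fun i => PowerSeries.C (x i))

/-- The series `δ₀(x^J)` span a submodule that contains all `ε^I`, since `ε_i = δ₀(x_i) - x_i`. -/
theorem IsCoordSystem.eps_mem_span (h : IsCoordSystem x) (I : Fin n →₀ ℕ) :
    (eps I : Thick S n) ∈ Submodule.span S⟦X⟧ (delta0 x '' monomials x) := by
  have h1 : Submodule.span S⟦X⟧ (delta0 x '' monomials x) = Subalgebra.toSubmodule
      (Algebra.adjoin S⟦X⟧ (delta0 x '' Set.range fun i => PowerSeries.C (x i))) := by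
    rw [Algebra.adjoin_eq_span]
    congr 1
    exact congrArg SetLike.coe (MonoidHom.map_mclosure (delta0 x : S⟦X⟧ →* Thick S n)
      (Set.range fun i => PowerSeries.C (x i)))
  rw [h1, Subalgebra.mem_toSubmodule]
  induction I using Finsupp.induction_linear with
  | zero => exact one_mem _
  | add f g hf hg =>
    have : (eps (f + g) : Thick S n) = eps f * eps g := by
      simp [eps, MvPowerSeries.monomial_mul_monomial]
    rw [this]
    exact mul_mem hf hg
  | single i k =>
    have : (eps (Finsupp.single i k) : Thick S n) = MvPowerSeries.X i ^ k := by
      rw [MvPowerSeries.X_pow_eq]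
    rw [this]
    refine pow_mem ?_ k
    have h2 : (MvPowerSeries.X i : Thick S n) = delta0 x (PowerSeries.C (x i)) -
        algebraMap S⟦X⟧ (Thick S n) (PowerSeries.C (x i)) := by
      rw [h.delta0_C]
      exact (add_sub_cancel_left _ _).symm
    rw [h2]
    exact sub_mem (Algebra.subset_adjoin ⟨_, ⟨i, rfl⟩, rfl⟩) (Subalgebra.algebraMap_mem _ _)

theorem IsCoordSystem.dvd_eps_of_dvd_op (h : IsCoordSystem x) {s : Diff S n} {m : ℕ}
    (hs : ∀ f ∈ monomials x, (PowerSeries.X : S⟦X⟧) ^ m ∣ op x s f) (I : Fin n →₀ ℕ) :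
    (PowerSeries.X : S⟦X⟧) ^ m ∣ s.1 (eps I) := by
  refine Submodule.span_induction (p := fun F _ => (PowerSeries.X : S⟦X⟧) ^ m ∣ s.1 F)
    ?_ ?_ ?_ ?_ (h.eps_mem_span I)
  · rintro _ ⟨f, hf, rfl⟩
    exact hs f hf
  · rw [map_zero]
    exact dvd_zero _
  · intro F G _ _ hF hG
    rw [map_add]
    exact dvd_add hF hG
  · intro b F _ hF
    rw [map_smul]
    exact Dvd.dvd.mul_left hF b

/-- A differential operator is determined by the values of `s ∘ δ₀` on the monomials in the
coordinates. -/
theorem IsCoordSystem.ext_op (h : IsCoordSystem x) {s t : Diff S n}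
    (hst : ∀ f ∈ monomials x, op x s f = op x t f) : s = t := by
  rw [← sub_eq_zero]
  refine Diff.eq_zero_of_forall_X_pow_smul fun m => exists_X_pow_smul_of_dvd ?_
  refine h.dvd_eps_of_dvd_op fun f hf => ?_
  have : op x (s - t) f = op x s f - op x t f := rfl
  rw [this, hst f hf, sub_self]
  exact dvd_zero _

theorem IsCoordSystem.comp_assoc (h : IsCoordSystem x) (a b c : Diff S n) :
    comp x (comp x a b) c = comp x a (comp x b c) :=
  h.ext_op fun f _ => by simp only [h.op_comp]

theorem IsCoordSystem.one_comp (h : IsCoordSystem x) (a : Diff S n) : comp x one a = a :=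
  h.ext_op fun f _ => by rw [h.op_comp, h.op_one]

theorem IsCoordSystem.comp_one (h : IsCoordSystem x) (a : Diff S n) : comp x a one = a :=
  h.ext_op fun f _ => by rw [h.op_comp, h.op_one]

theorem IsCoordSystem.comp_add (h : IsCoordSystem x) (a b c : Diff S n) :
    comp x a (b + c) = comp x a b + comp x a c :=
  h.ext_op fun f _ => by simp only [op_add, h.op_comp, map_add]

theorem IsCoordSystem.add_comp (h : IsCoordSystem x) (a b c : Diff S n) :
    comp x (a + b) c = comp x a c + comp x b c :=
  h.ext_op fun f _ => by simp only [op_add, h.op_comp]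

theorem IsCoordSystem.smul_comp (h : IsCoordSystem x) (b : S⟦X⟧) (s t : Diff S n) :
    comp x (b • s) t = b • comp x s t :=
  h.ext_op fun f _ => by simp only [op_smul, h.op_comp]

/-- The product is not linear over `S_q` in the second factor, but over powers of `q-1`. -/
theorem IsCoordSystem.comp_X_pow_smul (h : IsCoordSystem x) (m : ℕ) (s t : Diff S n) :
    comp x s ((PowerSeries.X : S⟦X⟧) ^ m • t) = (PowerSeries.X : S⟦X⟧) ^ m • comp x s t :=
  h.ext_op fun f _ => by simp only [op_smul, h.op_comp, op_X_pow_mul]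

/-- `Diff` with the product `comp x`. The proof `h` is an index of the type because the product
depends on the coordinates and is associative only because of `h`. -/
def DiffRing (_h : IsCoordSystem x) : Type _ := Diff S n

variable (h : IsCoordSystem x)

instance : AddCommGroup (DiffRing h) := inferInstanceAs (AddCommGroup (Diff S n))

instance : Module S⟦X⟧ (DiffRing h) := inferInstanceAs (Module S⟦X⟧ (Diff S n))

instance : Ring (DiffRing h) :=
  { (inferInstance : AddCommGroup (DiffRing h)) with
    mul := fun t s => comp x t s
    one := (one : Diff S n)
    mul_assoc := h.comp_assoc
    one_mul := h.one_comp
    mul_one := h.comp_one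
    left_distrib := h.comp_add
    right_distrib := h.add_comp
    zero_mul := fun a => by
      have := h.smul_comp 0 0 a
      rwa [zero_smul, zero_smul] at this
    mul_zero := fun a => by
      have := h.comp_add a 0 0
      rwa [add_zero, left_eq_add] at this }

variable {h}

/-- The operator `s ∘ δ₀` of an element of the ring `DiffRing h`. -/
def DiffRing.op (a : DiffRing h) : S⟦X⟧ →+ S⟦X⟧ := QDiff.op x a

theorem DiffRing.op_mul (a b : DiffRing h) (f : S⟦X⟧) : (a * b).op f = a.op (b.op f) :=
  h.op_comp a b f

theorem DiffRing.op_one (f : S⟦X⟧) : (1 : DiffRing h).op f = f := h.op_one f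

theorem DiffRing.op_add (a b : DiffRing h) (f : S⟦X⟧) : (a + b).op f = a.op f + b.op f := rfl

theorem DiffRing.op_smul (b : S⟦X⟧) (a : DiffRing h) (f : S⟦X⟧) : (b • a).op f = b * a.op f := rfl

theorem DiffRing.smul_mul (b : S⟦X⟧) (s t : DiffRing h) : b • s * t = b • (s * t) :=
  h.smul_comp b s t

theorem DiffRing.mul_X_pow_smul (m : ℕ) (s t : DiffRing h) :
    s * ((PowerSeries.X : S⟦X⟧) ^ m • t) = (PowerSeries.X : S⟦X⟧) ^ m • (s * t) :=
  h.comp_X_pow_smul m s t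

end Composition

/-! ### Powers of the `q`-derivatives -/

section Nabla

variable {S : Type*} [CommRing S] {n : ℕ} {x : Fin n → S}

theorem nabla_eps (x : Fin n → S) (i : Fin n) (I : Fin n →₀ ℕ) :
    (nabla x i).1 (eps I) = if I ≠ 0 ∧ I = Finsupp.single i (I i) then
      (PowerSeries.X * PowerSeries.C (x i)) ^ (I i - 1) else 0 := by
  refine (ofSymbol_eps _ _ I).trans ?_
  congr

theorem nabla_eps_single (x : Fin n → S) (i : Fin n) (a : ℕ) :
    (nabla x i).1 (eps (Finsupp.single i (a + 1))) =
      (PowerSeries.X * PowerSeries.C (x i)) ^ a := by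
  rw [nabla_eps, if_pos ⟨by simp, by simp⟩]
  simp

theorem nabla_eps_zero (x : Fin n → S) (i : Fin n) : (nabla x i).1 (eps 0) = 0 := by
  rw [nabla_eps, if_neg (by simp)]

theorem nabla_eps_of_ne (x : Fin n → S) {i : Fin n} {I : Fin n →₀ ℕ}
    (hI : ∀ a, I ≠ Finsupp.single i a) : (nabla x i).1 (eps I) = 0 := by
  rw [nabla_eps, if_neg fun h => hI _ h.2]

/-- The operator `1 + (q-1) x_i ∇_{x_i,q}`, whose composite with `δ₀` is the automorphism `γ_i`.
It is multiplicative, with `ε_i ↦ (q-1) x_i` and `ε_j ↦ 0` for `j ≠ i`, see `qShift_eps_single` and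
`qShift_eps_of_ne`. -/
def qShift (x : Fin n → S) (i : Fin n) : Diff S n :=
  one + (PowerSeries.X * PowerSeries.C (x i)) • nabla x i

theorem qShift_eps_single (x : Fin n → S) (i : Fin n) (a : ℕ) :
    (qShift x i).1 (eps (Finsupp.single i a)) = (PowerSeries.X * PowerSeries.C (x i)) ^ a := by
  rw [qShift, Diff.add_apply, Diff.smul_apply, one_eps]
  cases a with
  | zero => simp [nabla_eps_zero]
  | succ a => rw [nabla_eps_single, if_neg (by simp), pow_succ', zero_add]

theorem qShift_eps_of_ne (x : Fin n → S) {i : Fin n} {I : Fin n →₀ ℕ}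
    (hI : ∀ a, I ≠ Finsupp.single i a) : (qShift x i).1 (eps I) = 0 := by
  have h0 : I ≠ 0 := fun h => hI 0 (by simpa using h)
  rw [qShift, Diff.add_apply, Diff.smul_apply, one_eps, nabla_eps_of_ne x hI, if_neg h0]
  simp

/-- The twisted Leibniz rule for the `q`-derivative, on `S_q[[ε]]`. -/
theorem nabla_mul (x : Fin n → S) (i : Fin n) (F G : Thick S n) :
    (nabla x i).1 (F * G) =
      (qShift x i).1 F * (nabla x i).1 G + (nabla x i).1 F * MvPowerSeries.coeff 0 G := by
  -- both sides are differential operators in `F` and in `G`, so monomials suffice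
  have h1 : ∀ I J : Fin n →₀ ℕ, (nabla x i).1 (eps I * eps J) =
      (qShift x i).1 (eps I) * (nabla x i).1 (eps J) + (nabla x i).1 (eps I) *
        MvPowerSeries.coeff 0 (eps J) := by
    intro I J
    have hIJ : (eps I * eps J : Thick S n) = eps (I + J) := by
      simp [eps, MvPowerSeries.monomial_mul_monomial]
    rw [hIJ, ← one_apply, one_eps]
    by_cases hI : ∃ a, I = Finsupp.single i a
    · obtain ⟨a, rfl⟩ := hI
      by_cases hJ : ∃ b, J = Finsupp.single i b
      · obtain ⟨b, rfl⟩ := hJ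
        rw [← Finsupp.single_add]
        cases b with
        | zero => simp [nabla_eps_zero]
        | succ b =>
          rw [← add_assoc, nabla_eps_single, nabla_eps_single, qShift_eps_single, if_neg (by simp)]
          ring
      · push Not at hJ
        rw [nabla_eps_of_ne x hJ, nabla_eps_of_ne x, if_neg]
        · ring
        · intro h
          exact hJ 0 (by simpa using h)
        · intro b h
          refine hJ (J i) (Finsupp.ext fun j => ?_)
          have := DFunLike.congr_fun h j
          rw [Finsupp.add_apply, Finsupp.single_apply, Finsupp.single_apply] at this
          rw [Finsupp.single_apply]
          split_ifs at this ⊢ with hj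
          · rw [hj]
          · omega
    · push Not at hI
      rw [nabla_eps_of_ne x hI, qShift_eps_of_ne x hI, nabla_eps_of_ne x]
      · ring
      · intro b h
        refine hI (I i) (Finsupp.ext fun j => ?_)
        have := DFunLike.congr_fun h j
        rw [Finsupp.add_apply, Finsupp.single_apply] at this
        rw [Finsupp.single_apply]
        split_ifs at this ⊢ with hj
        · rw [hj]
        · omega
  have h2 : ∀ I G, (nabla x i).1 (eps I * G) =
      (qShift x i).1 (eps I) * (nabla x i).1 G + (nabla x i).1 (eps I) *
        MvPowerSeries.coeff 0 G := by
    intro I G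
    have : (nabla x i).mulRight (eps I) =
        (qShift x i).1 (eps I) • nabla x i + (nabla x i).1 (eps I) • one :=
      Diff.ext_eps fun J => by
        rw [Diff.mulRight_apply, mul_comm, h1]
        rfl
    have h3 := congrArg (fun t : Diff S n => t.1 G) this
    rw [mul_comm]
    exact h3
  have : (nabla x i).mulRight G =
      (nabla x i).1 G • qShift x i + MvPowerSeries.coeff 0 G • nabla x i :=
    Diff.ext_eps fun I => by
      rw [Diff.mulRight_apply, h2, Diff.add_apply, Diff.smul_apply, Diff.smul_apply]
      ring
  have h3 := congrArg (fun t : Diff S n => t.1 F) this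
  refine h3.trans ?_
  rw [Diff.add_apply, Diff.smul_apply, Diff.smul_apply]
  ring

theorem IsCoordSystem.op_nabla_mul (h : IsCoordSystem x) (i : Fin n) (f g : S⟦X⟧) :
    op x (nabla x i) (f * g) =
      op x (qShift x i) f * op x (nabla x i) g + op x (nabla x i) f * g := by
  rw [op_apply, map_mul (delta0 x), nabla_mul, h.coeff_zero_delta0]
  rfl

theorem IsCoordSystem.nabla_comp_smul (h : IsCoordSystem x) (i : Fin n) (b : S⟦X⟧)
    (s : Diff S n) : comp x (nabla x i) (b • s) =
      op x (qShift x i) b • comp x (nabla x i) s + op x (nabla x i) b • s :=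
  h.ext_op fun f _ => by simp only [h.op_comp, op_smul, op_add, h.op_nabla_mul]

theorem op_nabla_one (x : Fin n → S) (i : Fin n) :
    op x (nabla x i) 1 = 0 := by
  rw [op_apply, map_one]
  exact nabla_eps_zero x i

theorem IsCoordSystem.op_nabla_coord (h : IsCoordSystem x) (i k : Fin n) :
    op x (nabla x i) (PowerSeries.C (x k)) = if i = k then 1 else 0 := by
  have h1 : (MvPowerSeries.C (PowerSeries.C (x k)) : Thick S n) =
      PowerSeries.C (x k) • eps 0 := by
    rw [MvPowerSeries.smul_eq_C_mul]
    exact (mul_one _).symm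
  rw [op_apply, h.delta0_C, map_add, h1, map_smul, nabla_eps_zero, smul_zero, zero_add]
  change (nabla x i).1 (eps (Finsupp.single k 1)) = _
  split_ifs with hik
  · subst hik
    exact (nabla_eps_single x i 0).trans (pow_zero _)
  · refine nabla_eps_of_ne x fun a ha => ?_
    have := DFunLike.congr_fun ha k
    rw [Finsupp.single_eq_same, Finsupp.single_eq_of_ne (Ne.symm hik)] at this
    omega

theorem IsCoordSystem.op_nabla_coord_mul_self (h : IsCoordSystem x) (i : Fin n) (g : S⟦X⟧) :
    op x (nabla x i) (PowerSeries.C (x i) * g) =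
      PowerSeries.C (x i) * op x (nabla x i) g +
        PowerSeries.X ^ 1 * (PowerSeries.C (x i) * op x (nabla x i) g) + g := by
  rw [h.op_nabla_mul, qShift, op_add, op_smul, h.op_one, h.op_nabla_coord, if_pos rfl]
  ring

theorem IsCoordSystem.op_nabla_coord_mul_of_ne (h : IsCoordSystem x) {i k : Fin n} (hik : i ≠ k)
    (g : S⟦X⟧) : op x (nabla x i) (PowerSeries.C (x k) * g) =
      PowerSeries.C (x k) * op x (nabla x i) g := by
  rw [h.op_nabla_mul, qShift, op_add, op_smul, h.op_one, h.op_nabla_coord, if_neg hik]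
  ring

/-- The `q`-derivatives commute. It suffices to compare the operators on monomials in the
coordinates, by induction on the degree. -/
theorem IsCoordSystem.nabla_comm (h : IsCoordSystem x) (i j : Fin n) :
    comp x (nabla x i) (nabla x j) = comp x (nabla x j) (nabla x i) := by
  by_cases hij : i = j
  · rw [hij]
  have key : ∀ i j : Fin n, i ≠ j → ∀ g : S⟦X⟧,
      op x (nabla x i) (op x (nabla x j) g) = op x (nabla x j) (op x (nabla x i) g) →
      op x (nabla x i) (op x (nabla x j) (PowerSeries.C (x i) * g)) =
        op x (nabla x j) (op x (nabla x i) (PowerSeries.C (x i) * g)) := by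
    intro i j hij g hg
    simp only [h.op_nabla_coord_mul_self, h.op_nabla_coord_mul_of_ne hij.symm, map_add,
      op_X_pow_mul, hg]
  refine h.ext_op fun f hf => ?_
  rw [h.op_comp, h.op_comp]
  induction hf using Submonoid.closure_induction_left with
  | one => simp [op_nabla_one]
  | mul_left y hy g hg ih =>
    obtain ⟨k, rfl⟩ := hy
    by_cases hi : i = k
    · subst hi
      exact key i j hij g ih
    · by_cases hj : j = k
      · subst hj
        exact (key j i (Ne.symm hij) g ih.symm).symm
      · simp only [h.op_nabla_coord_mul_of_ne hi, h.op_nabla_coord_mul_of_ne hj, ih]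

theorem nablaPow_zero (x : Fin n → S) : nablaPow x 0 = one := by
  rw [nablaPow]
  induction List.finRange n with
  | nil => rfl
  | cons k l ih => simp

theorem IsCoordSystem.nabla_comp_nablaPow (h : IsCoordSystem x) (i : Fin n) (I : Fin n →₀ ℕ) :
    comp x (nabla x i) (nablaPow x I) = nablaPow x (I + Finsupp.single i 1) := by
  have hc : ∀ k, Function.Commute (comp x (nabla x i)) (comp x (nabla x k)) := fun k s => by
    rw [← h.comp_assoc, ← h.comp_assoc, h.nabla_comm]
  have key : ∀ l : List (Fin n), l.Nodup → i ∈ l → comp x (nabla x i)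
      (l.foldr (fun k s => (comp x (nabla x k))^[I k] s) one) =
      l.foldr (fun k s => (comp x (nabla x k))^[(I + Finsupp.single i 1 : Fin n →₀ ℕ) k] s) one := by
    intro l
    induction l with
    | nil => simp
    | cons k l ih =>
      intro hl hi
      rw [List.nodup_cons] at hl
      rw [List.foldr_cons, List.foldr_cons]
      by_cases hk : k = i
      · subst hk
        have hcongr : l.foldr (fun j s => (comp x (nabla x j))^[I j] s) one =
            l.foldr (fun j s =>
              (comp x (nabla x j))^[(I + Finsupp.single k 1 : Fin n →₀ ℕ) j] s) one := by
          refine List.foldr_ext _ _ _ fun j hj s => ?_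
          have : j ≠ k := fun h' => hl.1 (h' ▸ hj)
          simp [this]
        rw [← hcongr, Finsupp.add_apply, Finsupp.single_eq_same, Function.iterate_succ_apply']
      · rw [Finsupp.add_apply, Finsupp.single_eq_of_ne hk, add_zero,
          ← ih hl.2 ((List.mem_cons.mp hi).resolve_left (Ne.symm hk))]
        exact (hc k).iterate_right _ _
  exact key _ (List.nodup_finRange n) (List.mem_finRange i)

/-! ### Reduction modulo `q-1` -/

/-- Reduction modulo `q-1` of `∇_i ∘ s` for `s` congruent to `c` times the dual basis vector of
`ε^J`. -/
theorem nabla_comp_congr (x : Fin n → S) (i : Fin n) {s : Diff S n} {c : ℕ} {J : Fin n →₀ ℕ}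
    (hs : ∀ I, (PowerSeries.X : S⟦X⟧) ∣ s.1 (eps I) - if I = J then (c : S⟦X⟧) else 0)
    (I : Fin n →₀ ℕ) : (PowerSeries.X : S⟦X⟧) ∣ (comp x (nabla x i) s).1 (eps I) -
      if I = J + Finsupp.single i 1 then ((c * (J i + 1) : ℕ) : S⟦X⟧) else 0 := by
  classical
  have h1 : ∀ B, (PowerSeries.X : S⟦X⟧) ∣
      (nabla x i).1 (eps B) - if B = Finsupp.single i 1 then 1 else 0 := by
    intro B
    by_cases hB : ∃ a, B = Finsupp.single i a
    · obtain ⟨a, rfl⟩ := hB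
      match a with
      | 0 => simp [nabla_eps_zero, eq_comm]
      | 1 => simp [nabla_eps_single x i 0]
      | a + 2 =>
        have h21 : Finsupp.single i (a + 2) ≠ Finsupp.single i 1 := fun h => by
          have := DFunLike.congr_fun h i
          simp only [Finsupp.single_eq_same] at this
          omega
        rw [nabla_eps_single, if_neg h21, sub_zero, pow_succ']
        exact Dvd.dvd.mul_right (Dvd.intro _ rfl) _
    · push Not at hB
      rw [nabla_eps_of_ne x hB, if_neg (hB 1), sub_zero]
      exact dvd_zero _
  have h2 : ∀ A B, (PowerSeries.X : S⟦X⟧) ∣ (nabla x i).1 (delta0 x (s.1 (eps A)) * eps B) -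
      (if A = J then (c : S⟦X⟧) else 0) * if B = Finsupp.single i 1 then 1 else 0 := by
    intro A B
    obtain ⟨g, hg⟩ := hs A
    have e1 : s.1 (eps A) = PowerSeries.X * g + ((if A = J then c else 0 : ℕ) : S⟦X⟧) := by
      rw [← hg]
      split_ifs <;> simp
    have e2 : delta0 x (s.1 (eps A)) * eps B = (PowerSeries.X : S⟦X⟧) • (delta0 x g * eps B) +
        ((if A = J then c else 0 : ℕ) : S⟦X⟧) • eps B := by
      rw [e1, map_add, map_mul, delta0_X, map_natCast, MvPowerSeries.smul_eq_C_mul,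
        MvPowerSeries.smul_eq_C_mul, map_natCast]
      ring
    rw [e2, map_add, map_smul, map_smul, smul_eq_mul, smul_eq_mul, add_sub_assoc]
    refine dvd_add (Dvd.intro _ rfl) ?_
    have e3 : (if A = J then (c : S⟦X⟧) else 0) = ((if A = J then c else 0 : ℕ) : S⟦X⟧) := by
      split_ifs <;> simp
    rw [e3, ← mul_sub]
    exact Dvd.dvd.mul_left (h1 B) _
  have h3 : (if I = J + Finsupp.single i 1 then ((c * (J i + 1) : ℕ) : S⟦X⟧) else 0) =
      ∑ p ∈ Finset.HasAntidiagonal.antidiagonal I, ((∏ j, (I j).choose (p.1 j) : ℕ) : S⟦X⟧) *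
        ((if p.1 = J then (c : S⟦X⟧) else 0) * if p.2 = Finsupp.single i 1 then 1 else 0) := by
    split_ifs with hI
    · rw [Finset.sum_eq_single (J, Finsupp.single i 1)]
      · rw [if_pos rfl, if_pos rfl, hI, Finset.prod_eq_single i]
        · simp
          ring
        · intro j _ hj
          simp [hj]
        · simp
      · rintro ⟨p1, p2⟩ _ hp
        by_cases h1 : p1 = J
        · by_cases h2 : p2 = Finsupp.single i 1
          · exact absurd (by rw [h1, h2]) hp
          · simp [h2]
        · simp [h1]
      · intro h
        exact absurd (Finset.HasAntidiagonal.mem_antidiagonal.mpr hI.symm) h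
    · symm
      refine Finset.sum_eq_zero ?_
      rintro ⟨p1, p2⟩ hp
      rw [Finset.HasAntidiagonal.mem_antidiagonal] at hp
      by_cases h1 : p1 = J
      · by_cases h2 : p2 = Finsupp.single i 1
        · exact absurd (by rw [← hp, h1, h2]) hI
        · simp [h2]
      · simp [h1]
  rw [h3, comp_eps, ← Finset.sum_sub_distrib]
  refine Finset.dvd_sum fun p _ => ?_
  rw [← mul_sub]
  exact Dvd.dvd.mul_left (h2 _ _) _

/-- The multi-index factorial `I!`. -/
def mfact (I : Fin n →₀ ℕ) : ℕ := ∏ i, (I i).factorial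

theorem mfact_ne_zero (I : Fin n →₀ ℕ) : mfact I ≠ 0 :=
  Finset.prod_ne_zero_iff.mpr fun _ _ => Nat.factorial_ne_zero _

/-- Modulo `q-1`, the operator `∇^J` is `J!` times the dual basis vector of `ε^J`. -/
theorem nablaPow_congr (x : Fin n → S) (J I : Fin n →₀ ℕ) :
    (PowerSeries.X : S⟦X⟧) ∣ (nablaPow x J).1 (eps I) -
      if I = J then (mfact J : S⟦X⟧) else 0 := by
  classical
  have h1 : ∀ (i : Fin n) (k : ℕ) (s : Diff S n) (c : ℕ) (K : Fin n →₀ ℕ), K i = 0 →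
      (∀ I, (PowerSeries.X : S⟦X⟧) ∣ s.1 (eps I) - if I = K then (c : S⟦X⟧) else 0) →
      ∀ I, (PowerSeries.X : S⟦X⟧) ∣ ((comp x (nabla x i))^[k] s).1 (eps I) -
        if I = K + Finsupp.single i k then ((c * k.factorial : ℕ) : S⟦X⟧) else 0 := by
    intro i k s c K hK hs
    induction k with
    | zero => simpa using hs
    | succ k ih =>
      intro I
      have := nabla_comp_congr x i ih I
      rw [Finsupp.add_apply, hK, Finsupp.single_eq_same, zero_add, add_assoc,
        ← Finsupp.single_add, mul_assoc, mul_comm k.factorial, ← Nat.factorial_succ] at this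
      rwa [Function.iterate_succ_apply']
  have h2 : ∀ l : List (Fin n), l.Nodup → ∃ K : Fin n →₀ ℕ,
      (∀ i, K i = if i ∈ l then J i else 0) ∧ ∀ I, (PowerSeries.X : S⟦X⟧) ∣
        (l.foldr (fun k s => (comp x (nabla x k))^[J k] s) one).1 (eps I) -
          if I = K then (((l.map fun i => (J i).factorial).prod : ℕ) : S⟦X⟧) else 0 := by
    intro l
    induction l with
    | nil =>
      intro _
      refine ⟨0, by simp, fun I => ?_⟩
      rw [List.foldr_nil, one_eps]
      simp
    | cons i l ih =>
      intro hl
      rw [List.nodup_cons] at hl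
      obtain ⟨K, hK, hK'⟩ := ih hl.2
      refine ⟨K + Finsupp.single i (J i), fun j => ?_, fun I => ?_⟩
      · rw [Finsupp.add_apply, hK, Finsupp.single_apply]
        by_cases hj : j = i
        · subst hj
          simp [hl.1]
        · simp [hj, Ne.symm hj]
      · have := h1 i (J i) _ _ K (by rw [hK, if_neg hl.1]) hK' I
        rwa [mul_comm] at this
  obtain ⟨K, hK, hK'⟩ := h2 _ (List.nodup_finRange n)
  have hKJ : K = J := Finsupp.ext fun i => by rw [hK, if_pos (List.mem_finRange i)]
  have hm : ((List.finRange n).map fun i => (J i).factorial).prod = mfact J := by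
    rw [mfact, ← List.ofFn_eq_map, List.prod_ofFn]
  rw [hKJ, hm] at hK'
  exact hK' I

end Nabla

/-! ### The algebra `𝒜_ψ` -/

section Algebra

variable {S : Type*} [CommRing S] {n : ℕ} {x : Fin n → S}

theorem isNull_mul_right {ι : Type*} {c : ι → S⟦X⟧} (hc : IsNull c) (u : ι → S⟦X⟧) :
    IsNull fun i => c i * u i := by
  simpa only [mul_comm] using hc.mul_left u

theorem isNull_nullSum_nablaPow (x : Fin n → S) (c : Diff S n) :
    IsNull fun I => nullSum fun J => c.1 (eps J) * (nablaPow x J).1 (eps I) := by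
  intro m
  refine ((isNull_symbol c m).biUnion fun J _ => isNull_symbol (nablaPow x J) m).subset
    fun I hI => ?_
  by_contra h
  simp only [Set.mem_iUnion, not_exists, Set.mem_ofPred_eq, not_not] at h
  refine hI (dvd_nullSum fun J => ?_)
  by_cases hJ : (PowerSeries.X : S⟦X⟧) ^ m ∣ c.1 (eps J)
  · exact Dvd.dvd.mul_right hJ _
  · exact Dvd.dvd.mul_left (h J hJ) _

/-- The operator `∑_J c(ε^J) ∇^J`, where the null family of coefficients is recorded as the
differential operator `c` with these values. -/
def nablaSum (x : Fin n → S) (c : Diff S n) : Diff S n :=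
  ofSymbol _ (isNull_nullSum_nablaPow x c)

theorem nablaSum_eps (x : Fin n → S) (c : Diff S n) (I : Fin n →₀ ℕ) :
    (nablaSum x c).1 (eps I) = nullSum fun J => c.1 (eps J) * (nablaPow x J).1 (eps I) :=
  ofSymbol_eps _ _ I

theorem nablaSum_eq_sum_add (x : Fin n → S) (c : Diff S n) {m : ℕ} (T : Finset (Fin n →₀ ℕ))
    (hT : ∀ J, J ∉ T → (PowerSeries.X : S⟦X⟧) ^ m ∣ c.1 (eps J)) :
    ∃ d : Diff S n, nablaSum x c =
      ∑ J ∈ T, c.1 (eps J) • nablaPow x J + (PowerSeries.X : S⟦X⟧) ^ m • d := by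
  obtain ⟨d, hd⟩ := exists_X_pow_smul_of_dvd (m := m)
    (s := nablaSum x c - ∑ J ∈ T, c.1 (eps J) • nablaPow x J) (fun I => by
      rw [Diff.sub_apply, Diff.sum_apply, nablaSum_eps]
      exact dvd_nullSum_sub T fun J hJ => Dvd.dvd.mul_right (hT J hJ) _)
  exact ⟨d, by rw [← hd]; abel⟩

theorem exists_finset_forall_dvd (c : Diff S n) (m : ℕ) : ∃ T : Finset (Fin n →₀ ℕ),
    ∀ J, J ∉ T → (PowerSeries.X : S⟦X⟧) ^ m ∣ c.1 (eps J) := by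
  refine ⟨(isNull_symbol c m).toFinset, fun J hJ => ?_⟩
  by_contra h
  exact hJ (by simpa using h)

theorem nablaSum_apply (x : Fin n → S) (c : Diff S n) (F : Thick S n) :
    (nablaSum x c).1 F = nullSum fun J => c.1 (eps J) * (nablaPow x J).1 F := by
  refine eq_of_forall_dvd_sub fun m => ?_
  obtain ⟨T, hT⟩ := exists_finset_forall_dvd c m
  obtain ⟨d, hd⟩ := nablaSum_eq_sum_add x c T hT
  have h1 := dvd_nullSum_sub (u := fun J => c.1 (eps J) * (nablaPow x J).1 F) T
    fun J hJ => Dvd.dvd.mul_right (hT J hJ) _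
  rw [hd, Diff.add_apply, Diff.sum_apply, Diff.smul_apply]
  have h2 := dvd_sub (Dvd.intro (d.1 F) rfl) h1
  refine h2.trans (dvd_of_eq ?_)
  simp only [Diff.smul_apply]
  ring

theorem mem_A_iff {s : Diff S n} : s ∈ A x ↔ ∃ c, s = nablaSum x c := by
  constructor
  · rintro ⟨a, ha, hs⟩
    refine ⟨ofSymbol a ha, Diff.ext_apply fun F => ?_⟩
    rw [hs, nablaSum_apply]
    simp only [ofSymbol_eps]
  · rintro ⟨c, rfl⟩
    exact ⟨_, isNull_symbol c, nablaSum_apply x c⟩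

theorem nablaSum_add (x : Fin n → S) (c d : Diff S n) :
    nablaSum x (c + d) = nablaSum x c + nablaSum x d :=
  Diff.ext_eps fun I => by
    simp only [nablaSum_eps, Diff.add_apply, add_mul]
    exact nullSum_add (isNull_mul_right (isNull_symbol c) _) (isNull_mul_right (isNull_symbol d) _)

theorem nablaSum_smul (x : Fin n → S) (b : S⟦X⟧) (c : Diff S n) :
    nablaSum x (b • c) = b • nablaSum x c :=
  Diff.ext_eps fun I => by
    simp only [nablaSum_eps, Diff.smul_apply, mul_assoc]
    exact nullSum_mul_left (isNull_mul_right (isNull_symbol c) _) b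

/-- Modulo `q-1`, the operator `∑_J c_J ∇^J` has the values `I! c_I`. -/
theorem nablaSum_congr (x : Fin n → S) (c : Diff S n) (I : Fin n →₀ ℕ) :
    (PowerSeries.X : S⟦X⟧) ∣ (nablaSum x c).1 (eps I) - (mfact I : S⟦X⟧) * c.1 (eps I) := by
  have h1 := dvd_nullSum_sub (m := 1)
    (u := fun J => c.1 (eps J) * (nablaPow x J).1 (eps I)) {I} fun J hJ => by
      have hne : I ≠ J := fun h => hJ (by simp [h])
      have := nablaPow_congr x J I
      rw [if_neg hne, sub_zero] at this
      rw [pow_one]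
      exact Dvd.dvd.mul_left this _
  have h2 := nablaPow_congr x I I
  rw [if_pos rfl] at h2
  rw [Finset.sum_singleton, pow_one] at h1
  rw [nablaSum_eps]
  have h3 := dvd_add h1 (Dvd.dvd.mul_left h2 (c.1 (eps I)))
  refine h3.trans (dvd_of_eq ?_)
  ring

theorem nablaPow_mem_A (x : Fin n → S) (J : Fin n →₀ ℕ) : nablaPow x J ∈ A x := by
  classical
  refine ⟨fun I => if I = J then 1 else 0, fun m => ?_, fun F => ?_⟩
  · refine (Set.finite_singleton J).subset fun I hI => ?_
    by_contra h
    exact hI (by simp [show I ≠ J from h])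
  · rw [nullSum_eq_single _ J]
    · simp
    · intro I hI
      simp [hI]

theorem one_mem_A (x : Fin n → S) : (one : Diff S n) ∈ A x := by
  rw [← nablaPow_zero x]
  exact nablaPow_mem_A x 0

variable (h : IsCoordSystem x)
include h

/-- `𝒜_ψ` is saturated with respect to `q-1`: this is where the absence of torsion is used. -/
theorem IsCoordSystem.mem_A_of_X_smul_mem {d : Diff S n}
    (hd : (PowerSeries.X : S⟦X⟧) • d ∈ A x) : d ∈ A x := by
  obtain ⟨c, hc⟩ := mem_A_iff.mp hd
  have h1 : ∀ I, (PowerSeries.X : S⟦X⟧) ^ 1 ∣ c.1 (eps I) := by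
    intro I
    rw [pow_one, PowerSeries.X_dvd_iff]
    have h2 := nablaSum_congr x c I
    rw [← hc, Diff.smul_apply, PowerSeries.X_dvd_iff] at h2
    refine h.torsionFree _ (mfact_ne_zero I) _ ?_
    simpa using h2
  obtain ⟨e, rfl⟩ := exists_X_pow_smul_of_dvd h1
  rw [nablaSum_smul, pow_one] at hc
  refine mem_A_iff.mpr ⟨e, Diff.X_pow_smul_cancel (m := 1) ?_⟩
  rw [pow_one]
  exact hc

theorem IsCoordSystem.mem_A_of_X_pow_smul_mem {m : ℕ} {d : Diff S n}
    (hd : (PowerSeries.X : S⟦X⟧) ^ m • d ∈ A x) : d ∈ A x := by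
  induction m with
  | zero => simpa using hd
  | succ m ih =>
    rw [pow_succ', mul_smul] at hd
    exact ih (h.mem_A_of_X_smul_mem hd)

/-- `𝒜_ψ` is closed in the `(q-1)`-adic topology. -/
theorem IsCoordSystem.mem_A_of_forall {d : Diff S n}
    (hd : ∀ m : ℕ, ∃ a ∈ A x, ∃ e, d = a + (PowerSeries.X : S⟦X⟧) ^ m • e) : d ∈ A x := by
  choose a ha e he using hd
  have h1 : ∀ k, e k - (PowerSeries.X : S⟦X⟧) • e (k + 1) ∈ A x := by
    intro k
    refine h.mem_A_of_X_pow_smul_mem (m := k) ?_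
    have : (PowerSeries.X : S⟦X⟧) ^ k • (e k - (PowerSeries.X : S⟦X⟧) • e (k + 1)) =
        a (k + 1) - a k := by
      rw [smul_sub, ← mul_smul, ← pow_succ, sub_eq_sub_iff_add_eq_add, add_comm, ← he, ← he]
    rw [this]
    exact sub_mem (ha _) (ha _)
  choose c hc using fun k => mem_A_iff.mp (h1 k)
  obtain ⟨s, hs⟩ := Diff.exists_series c
  have h2 : ∀ m, e 0 - (PowerSeries.X : S⟦X⟧) ^ m • e m =
      ∑ k ∈ Finset.range m, (PowerSeries.X : S⟦X⟧) ^ k • nablaSum x (c k) := by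
    intro m
    induction m with
    | zero => simp
    | succ m ih =>
      rw [Finset.sum_range_succ, ← ih, ← hc, smul_sub, ← mul_smul, ← pow_succ]
      abel
  have h3 : e 0 = nablaSum x s := by
    rw [← sub_eq_zero]
    refine Diff.eq_zero_of_forall_X_pow_smul fun m => ?_
    obtain ⟨e', he'⟩ := hs m
    refine ⟨e m - nablaSum x e', ?_⟩
    have h4 : nablaSum x s = ∑ k ∈ Finset.range m, (PowerSeries.X : S⟦X⟧) ^ k • nablaSum x (c k) +
        (PowerSeries.X : S⟦X⟧) ^ m • nablaSum x e' := by
      let f : Diff S n →ₗ[S⟦X⟧] Diff S n :=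
        { toFun := nablaSum x
          map_add' := nablaSum_add x
          map_smul' := nablaSum_smul x }
      have := congrArg f he'
      simp only [map_add, map_sum, map_smul] at this
      exact this
    rw [h4, ← h2, smul_sub]
    abel
  rw [he 0, h3, pow_zero, one_smul] at *
  exact add_mem (ha 0) (mem_A_iff.mpr ⟨s, rfl⟩)

theorem IsCoordSystem.nabla_comp_mem_A (i : Fin n) {s : Diff S n} (hs : s ∈ A x) :
    comp x (nabla x i) s ∈ A x := by
  obtain ⟨c, rfl⟩ := mem_A_iff.mp hs
  refine h.mem_A_of_forall fun m => ?_
  obtain ⟨T, hT⟩ := exists_finset_forall_dvd c m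
  obtain ⟨d, hd⟩ := nablaSum_eq_sum_add x c T hT
  have hz : comp x (nabla x i) 0 = 0 := by
    have := h.comp_add (nabla x i) 0 0
    rwa [add_zero, left_eq_add] at this
  let f : Diff S n →+ Diff S n :=
    { toFun := comp x (nabla x i)
      map_zero' := hz
      map_add' := h.comp_add _ }
  refine ⟨f (∑ J ∈ T, c.1 (eps J) • nablaPow x J), ?_, comp x (nabla x i) d, ?_⟩
  · rw [map_sum]
    refine sum_mem fun J _ => ?_
    change comp x (nabla x i) (c.1 (eps J) • nablaPow x J) ∈ A x
    rw [h.nabla_comp_smul, h.nabla_comp_nablaPow]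
    exact add_mem (Submodule.smul_mem _ _ (nablaPow_mem_A x _))
      (Submodule.smul_mem _ _ (nablaPow_mem_A x _))
  · rw [hd, h.comp_add, h.comp_X_pow_smul]
    rfl

theorem IsCoordSystem.nablaPow_comp_mem_A (J : Fin n →₀ ℕ) {s : Diff S n} (hs : s ∈ A x) :
    comp x (nablaPow x J) s ∈ A x := by
  have key : ∀ l : List (Fin n), ∀ s ∈ A x,
      comp x (l.foldr (fun k s => (comp x (nabla x k))^[J k] s) one) s ∈ A x := by
    intro l
    induction l with
    | nil =>
      intro s hs
      rwa [List.foldr_nil, h.one_comp]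
    | cons i l ih =>
      intro s hs
      rw [List.foldr_cons]
      generalize J i = k
      induction k with
      | zero => exact ih s hs
      | succ k ihk =>
        rw [Function.iterate_succ_apply', h.comp_assoc]
        exact h.nabla_comp_mem_A i ihk
  exact key _ s hs

/-- `𝒜_ψ` is closed under composition. -/
theorem IsCoordSystem.comp_mem_A {t s : Diff S n} (ht : t ∈ A x) (hs : s ∈ A x) :
    comp x t s ∈ A x := by
  obtain ⟨c, rfl⟩ := mem_A_iff.mp ht
  refine h.mem_A_of_forall fun m => ?_
  obtain ⟨T, hT⟩ := exists_finset_forall_dvd c m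
  obtain ⟨d, hd⟩ := nablaSum_eq_sum_add x c T hT
  have hz : comp x 0 s = 0 := by
    have := h.add_comp 0 0 s
    rwa [add_zero, left_eq_add] at this
  let f : Diff S n →+ Diff S n :=
    { toFun := fun t => comp x t s
      map_zero' := hz
      map_add' := fun a b => h.add_comp a b s }
  refine ⟨f (∑ J ∈ T, c.1 (eps J) • nablaPow x J), ?_, comp x d s, ?_⟩
  · rw [map_sum]
    refine sum_mem fun J _ => ?_
    change comp x (c.1 (eps J) • nablaPow x J) s ∈ A x
    rw [h.smul_comp]
    exact Submodule.smul_mem _ _ (h.nablaPow_comp_mem_A J hs)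
  · rw [hd, h.add_comp, h.smul_comp]
    rfl

end Algebra

/-! ### Filtration of `Diff / 𝒜_ψ` and its graded pieces -/

section Graded

variable {S : Type*} [CommRing S] {n : ℕ} {x : Fin n → S}

/-- The subgroup `𝒜_ψ + (q-1)^m Diff`. -/
def modA (x : Fin n → S) (m : ℕ) : AddSubgroup (Diff S n) where
  carrier := {d | ∃ a ∈ A x, ∃ e : Diff S n, d = a + (PowerSeries.X : S⟦X⟧) ^ m • e}
  zero_mem' := ⟨0, zero_mem _, 0, by rw [smul_zero, add_zero]⟩
  add_mem' := by
    rintro _ _ ⟨a, ha, e, rfl⟩ ⟨a', ha', e', rfl⟩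
    exact ⟨a + a', add_mem ha ha', e + e', by rw [smul_add]; abel⟩
  neg_mem' := by
    rintro _ ⟨a, ha, e, rfl⟩
    exact ⟨-a, neg_mem ha, -e, by rw [smul_neg]; abel⟩

theorem X_dvd_iff_coeff_zero {a : S⟦X⟧} :
    (PowerSeries.X : S⟦X⟧) ∣ a ↔ PowerSeries.coeff 0 a = 0 := by
  rw [PowerSeries.X_dvd_iff, PowerSeries.coeff_zero_eq_constantCoeff_apply]

theorem coeff_zero_eq_of_X_dvd_sub {a b : S⟦X⟧} (h : (PowerSeries.X : S⟦X⟧) ∣ a - b) :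
    PowerSeries.coeff 0 a = PowerSeries.coeff 0 b := by
  rw [X_dvd_iff_coeff_zero, map_sub, sub_eq_zero] at h
  exact h

/-- Membership in `𝒜_ψ + (q-1) Diff`: the quotient of `Diff` by it is `⨁_I S / I!`. -/
theorem mem_modA_one_iff {d : Diff S n} :
    d ∈ modA x 1 ↔ ∀ I, (mfact I : S) ∣ PowerSeries.coeff 0 (d.1 (eps I)) := by
  constructor
  · rintro ⟨a, ha, e, rfl⟩ I
    obtain ⟨c, rfl⟩ := mem_A_iff.mp ha
    refine ⟨PowerSeries.coeff 0 (c.1 (eps I)), ?_⟩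
    rw [Diff.add_apply, Diff.smul_apply, map_add, coeff_zero_eq_of_X_dvd_sub (nablaSum_congr x c I)]
    simp
  · intro hd
    -- the quotients are chosen to be `0` wherever possible, so that they form a null family
    have h1 : ∀ I, ∃ c : S, PowerSeries.coeff 0 (d.1 (eps I)) = mfact I * c ∧
        (PowerSeries.coeff 0 (d.1 (eps I)) = 0 → c = 0) := by
      intro I
      by_cases h0 : PowerSeries.coeff 0 (d.1 (eps I)) = 0
      · exact ⟨0, by simp [h0], fun _ => rfl⟩
      · obtain ⟨c, hc⟩ := hd I
        exact ⟨c, hc, fun h => absurd h h0⟩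
    choose c hc hc0 using h1
    have hn : IsNull fun I => PowerSeries.C (c I) := by
      intro m
      refine (isNull_symbol d 1).subset fun I hI hX => hI ?_
      rw [pow_one, X_dvd_iff_coeff_zero] at hX
      beta_reduce
      rw [hc0 I hX, map_zero]
      exact dvd_zero _
    obtain ⟨e, he⟩ := exists_X_pow_smul_of_dvd (m := 1)
      (s := d - nablaSum x (ofSymbol _ hn)) (fun I => by
        have h2 := coeff_zero_eq_of_X_dvd_sub (nablaSum_congr x (ofSymbol _ hn) I)
        rw [pow_one, X_dvd_iff_coeff_zero, Diff.sub_apply, map_sub, h2, hc, ofSymbol_eps]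
        simp)
    exact ⟨_, mem_A_iff.mpr ⟨_, rfl⟩, e, by rw [← he]; abel⟩

/-- Every operator lies in `𝒜_ψ + (q-1)^m Diff` up to a nonzero integer factor. -/
theorem exists_natCast_smul_mem_modA (x : Fin n → S) (m : ℕ) (s : Diff S n) :
    ∃ N : ℕ, N ≠ 0 ∧ (N : S⟦X⟧) • s ∈ modA x m := by
  classical
  have h1 : ∀ s : Diff S n, ∃ N : ℕ, N ≠ 0 ∧ (N : S⟦X⟧) • s ∈ modA x 1 := by
    intro s
    obtain ⟨T, hT⟩ := exists_finset_forall_dvd s 1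
    refine ⟨∏ I ∈ T, mfact I, Finset.prod_ne_zero_iff.mpr fun I _ => mfact_ne_zero I,
      mem_modA_one_iff.mpr fun I => ?_⟩
    rw [Diff.smul_apply, ← map_natCast (PowerSeries.C (R := S)), PowerSeries.coeff_C_mul]
    by_cases hI : I ∈ T
    · exact Dvd.dvd.mul_right (Nat.cast_dvd_cast (Finset.dvd_prod_of_mem _ hI)) _
    · have := hT I hI
      rw [pow_one, X_dvd_iff_coeff_zero] at this
      rw [this, mul_zero]
      exact dvd_zero _
  induction m generalizing s with
  | zero => exact ⟨1, one_ne_zero, 0, zero_mem _, s, by simp⟩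
  | succ m ih =>
    obtain ⟨N, hN, a, ha, e, he⟩ := h1 s
    obtain ⟨N', hN', a', ha', e', he'⟩ := ih e
    refine ⟨N' * N, mul_ne_zero hN' hN, (N' : S⟦X⟧) • a + (PowerSeries.X : S⟦X⟧) • a',
      add_mem (Submodule.smul_mem _ _ ha) (Submodule.smul_mem _ _ ha'), e', ?_⟩
    rw [Nat.cast_mul, mul_smul, he, smul_add, pow_one, smul_comm, he', smul_add, ← mul_smul _ _ e',
      ← pow_succ']
    abel

theorem smul_mem_modA {m : ℕ} {d : Diff S n} (b : S⟦X⟧) (hd : d ∈ modA x m) :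
    b • d ∈ modA x m := by
  obtain ⟨a, ha, e, rfl⟩ := hd
  exact ⟨b • a, Submodule.smul_mem _ _ ha, b • e, by rw [smul_add, smul_comm b]⟩

end Graded

/-! ### The `p`-adic completion of differential operators -/

section Completion

variable {R : Type*} [CommRing R] {n : ℕ}

theorem coeff_algebraMap (p : ℕ) (f : R⟦X⟧) (k : ℕ) :
    PowerSeries.coeff k (algebraMap R⟦X⟧ (Cp R p)⟦X⟧ f) =
      algebraMap R (Cp R p) (PowerSeries.coeff k f) :=
  PowerSeries.coeff_map _ _ _

theorem algebraMap_X (p : ℕ) :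
    algebraMap R⟦X⟧ (Cp R p)⟦X⟧ PowerSeries.X = PowerSeries.X :=
  PowerSeries.map_X _

theorem algebraMap_C (p : ℕ) (a : R) :
    algebraMap R⟦X⟧ (Cp R p)⟦X⟧ (PowerSeries.C a) = PowerSeries.C (algebraMap R (Cp R p) a) :=
  PowerSeries.map_C _ _

theorem pComp_eps (p : ℕ) (s : Diff R n) (I : Fin n →₀ ℕ) :
    (pComp p s).1 (eps I) = algebraMap R⟦X⟧ (Cp R p)⟦X⟧ (s.1 (eps I)) :=
  ofSymbol_eps _ _ I

theorem pComp_add (p : ℕ) (s t : Diff R n) : pComp p (s + t) = pComp p s + pComp p t :=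
  Diff.ext_eps fun I => by simp only [pComp_eps, Diff.add_apply, map_add]

theorem pComp_smul (p : ℕ) (b : R⟦X⟧) (s : Diff R n) :
    pComp p (b • s) = algebraMap R⟦X⟧ (Cp R p)⟦X⟧ b • pComp p s :=
  Diff.ext_eps fun I => by simp only [pComp_eps, Diff.smul_apply, map_mul]

theorem pComp_X_pow_smul (p m : ℕ) (s : Diff R n) :
    pComp p ((PowerSeries.X : R⟦X⟧) ^ m • s) = (PowerSeries.X : (Cp R p)⟦X⟧) ^ m • pComp p s := by
  rw [pComp_smul, map_pow, algebraMap_X]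

theorem pComp_one (p : ℕ) : pComp p (one : Diff R n) = one :=
  Diff.ext_eps fun I => by
    rw [pComp_eps, one_eps, one_eps]
    split_ifs <;> simp

theorem algebraMap_nullSum (p : ℕ) {ι : Type*} {u : ι → R⟦X⟧} (hu : IsNull u) :
    algebraMap R⟦X⟧ (Cp R p)⟦X⟧ (nullSum u) =
      nullSum fun i => algebraMap R⟦X⟧ (Cp R p)⟦X⟧ (u i) := by
  refine PowerSeries.ext fun k => ?_
  rw [coeff_algebraMap, nullSum, nullSum, PowerSeries.coeff_mk, PowerSeries.coeff_mk]
  simp only [coeff_algebraMap]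
  exact (algebraMap R (Cp R p)).toAddMonoidHom.map_finsum (hu.finite_support k)

theorem pComp_apply_map (p : ℕ) (s : Diff R n) (F : Thick R n) :
    (pComp p s).1 (MvPowerSeries.map (algebraMap R⟦X⟧ (Cp R p)⟦X⟧) F) =
      algebraMap R⟦X⟧ (Cp R p)⟦X⟧ (s.1 F) := by
  rw [apply_eq_nullSum s, apply_eq_nullSum, algebraMap_nullSum p (isNull_coeff_mul s F)]
  simp only [pComp_eps, MvPowerSeries.coeff_map, map_mul]

theorem pComp_nabla (ψ : MvPolynomial (Fin n) ℤ →+* R) (p : ℕ) (i : Fin n) :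
    pComp p (nabla (coord ψ) i) = nabla (coordp ψ p) i :=
  Diff.ext_eps fun I => by
    rw [pComp_eps, nabla_eps, nabla_eps]
    split_ifs
    · rw [map_pow, map_mul, algebraMap_X, algebraMap_C]
      rfl
    · exact map_zero _

theorem monomials_coordp (ψ : MvPolynomial (Fin n) ℤ →+* R) (p : ℕ) {f : (Cp R p)⟦X⟧}
    (hf : f ∈ monomials (coordp ψ p)) :
    ∃ g ∈ monomials (coord ψ), f = algebraMap R⟦X⟧ (Cp R p)⟦X⟧ g := by
  induction hf using Submonoid.closure_induction with
  | one => exact ⟨1, one_mem _, (map_one _).symm⟩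
  | mem f hf =>
    obtain ⟨i, rfl⟩ := hf
    exact ⟨_, Submonoid.subset_closure ⟨i, rfl⟩, (algebraMap_C p _).symm⟩
  | mul f f' _ _ h h' =>
    obtain ⟨g, hg, rfl⟩ := h
    obtain ⟨g', hg', rfl⟩ := h'
    exact ⟨g * g', mul_mem hg hg', (map_mul _ _ _).symm⟩

variable {ψ : MvPolynomial (Fin n) ℤ →+* R} (hψ : ψ.Etale)
include hψ

theorem delta0_algebraMap (p : ℕ) (f : R⟦X⟧) :
    delta0 (coordp ψ p) (algebraMap R⟦X⟧ (Cp R p)⟦X⟧ f) =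
      MvPowerSeries.map (algebraMap R⟦X⟧ (Cp R p)⟦X⟧) (delta0 (coord ψ) f) := by
  ext I k
  rw [coeff_coeff_delta0, MvPowerSeries.coeff_map, coeff_algebraMap, coeff_algebraMap,
    coeff_coeff_delta0, taylor_algebraMap hψ, MvPowerSeries.coeff_map]

theorem op_pComp (p : ℕ) (s : Diff R n) (f : R⟦X⟧) :
    op (coordp ψ p) (pComp p s) (algebraMap R⟦X⟧ (Cp R p)⟦X⟧ f) =
      algebraMap R⟦X⟧ (Cp R p)⟦X⟧ (op (coord ψ) s f) := by
  rw [op_apply, delta0_algebraMap hψ, pComp_apply_map]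
  rfl

theorem pComp_comp {p : ℕ} (hp : p.Prime) (t s : Diff R n) :
    pComp p (comp (coord ψ) t s) = comp (coordp ψ p) (pComp p t) (pComp p s) :=
  (isCoordSystem_coordp hψ hp).ext_op fun f hf => by
    obtain ⟨g, -, rfl⟩ := monomials_coordp ψ p hf
    rw [(isCoordSystem_coordp hψ hp).op_comp]
    simp only [op_pComp hψ]
    rw [(isCoordSystem_coord hψ).op_comp]

theorem pComp_nablaPow {p : ℕ} (hp : p.Prime) (J : Fin n →₀ ℕ) :
    pComp p (nablaPow (coord ψ) J) = nablaPow (coordp ψ p) J := by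
  rw [nablaPow, nablaPow]
  induction List.finRange n with
  | nil => exact pComp_one p
  | cons i l ih =>
    rw [List.foldr_cons, List.foldr_cons]
    generalize J i = k
    induction k with
    | zero => exact ih
    | succ k ihk =>
      rw [Function.iterate_succ_apply', Function.iterate_succ_apply', pComp_comp hψ hp, ihk,
        pComp_nabla]

theorem pComp_nablaSum {p : ℕ} (hp : p.Prime) (c : Diff R n) :
    pComp p (nablaSum (coord ψ) c) = nablaSum (coordp ψ p) (pComp p c) :=
  Diff.ext_eps fun I => by
    rw [pComp_eps, nablaSum_eps, nablaSum_eps,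
      algebraMap_nullSum p (isNull_mul_right (isNull_symbol c) _)]
    simp only [map_mul, ← pComp_eps, pComp_nablaPow hψ hp]

theorem pComp_mem_A {p : ℕ} (hp : p.Prime) {s : Diff R n} (hs : s ∈ A (coord ψ)) :
    pComp p s ∈ A (coordp ψ p) := by
  obtain ⟨c, rfl⟩ := mem_A_iff.mp hs
  exact mem_A_iff.mpr ⟨_, pComp_nablaSum hψ hp c⟩

theorem pComp_mem_modA {p : ℕ} (hp : p.Prime) {m : ℕ} {s : Diff R n}
    (hs : s ∈ modA (coord ψ) m) : pComp p s ∈ modA (coordp ψ p) m := by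
  obtain ⟨a, ha, e, rfl⟩ := hs
  exact ⟨_, pComp_mem_A hψ hp ha, pComp p e, by rw [pComp_add, pComp_X_pow_smul]⟩

/-- If `N s` is in `𝒜_ψ + (q-1)^m Diff`, then `s_p` is in `𝒜_{ψ,p} + (q-1)^m Diff` for all primes
`p` that do not divide `N`. -/
theorem finite_not_mem_modA (m : ℕ) (s : Diff R n) :
    {p : Nat.Primes | pComp p s ∉ modA (coordp ψ p) m}.Finite := by
  obtain ⟨N, hN, hs⟩ := exists_natCast_smul_mem_modA (coord ψ) m s
  have h1 : {p : Nat.Primes | (p : ℕ) ∣ N}.Finite := by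
    refine Set.Finite.of_finite_image (f := fun p : Nat.Primes => (p : ℕ)) ?_
      Subtype.val_injective.injOn
    refine (Nat.divisors N).finite_toSet.subset ?_
    rintro _ ⟨p, hp, rfl⟩
    simpa [hN] using hp
  refine h1.subset fun p hp => ?_
  by_contra hpN
  obtain ⟨u, hu⟩ := (isUnit_natCast_Cp (R := R) p.2 hpN).exists_left_inv
  refine hp ?_
  have h2 := smul_mem_modA (PowerSeries.C u) (pComp_mem_modA hψ p.2 hs)
  have h3 : PowerSeries.C u * (algebraMap R⟦X⟧ (Cp R p)⟦X⟧ (N : R⟦X⟧)) = 1 := by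
    rw [map_natCast, ← map_natCast (PowerSeries.C (R := Cp R p)), ← map_mul, hu, map_one]
  rwa [pComp_smul, ← mul_smul, h3, one_smul] at h2

omit hψ in
theorem natCast_dvd_of_forall_Cp {N : ℕ} (hN : N ≠ 0) {r : R}
    (h : ∀ p : ℕ, p.Prime → (N : Cp R p) ∣ algebraMap R (Cp R p) r) : (N : R) ∣ r := by
  have h1 : ∀ p v : ℕ, p.Prime → p ^ v ∣ N → (p : R) ^ v ∣ r := by
    intro p v hp hv
    rw [← Cp_dvd_iff, ← Nat.cast_pow]
    exact (Nat.cast_dvd_cast hv).trans (h p hp)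
  clear h
  induction N using Nat.recOnPosPrimePosCoprime with
  | prime_pow p k hp _ =>
    rw [Nat.cast_pow]
    exact h1 p k hp dvd_rfl
  | zero => exact absurd rfl hN
  | one => simp
  | coprime a b ha hb hab iha ihb =>
    rw [Nat.cast_mul]
    refine IsCoprime.mul_dvd (by simpa using (Nat.isCoprime_iff_coprime.mpr hab).map (Int.castRingHom R))
      (iha (by omega) fun p v hp hv => h1 p v hp (hv.mul_right _))
      (ihb (by omega) fun p v hp hv => h1 p v hp (hv.mul_left _))

omit hψ in
/-- Injectivity of the map of `Diff / 𝒜_ψ` to the product of the `Diff / 𝒜_{ψ,p}`, modulo `q-1`. -/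
theorem mem_modA_one_of_forall {s : Diff R n}
    (h : ∀ p : Nat.Primes, pComp p s ∈ modA (coordp ψ p) 1) : s ∈ modA (coord ψ) 1 := by
  refine mem_modA_one_iff.mpr fun I => natCast_dvd_of_forall_Cp (mfact_ne_zero I) fun p hp => ?_
  have := mem_modA_one_iff.mp (h ⟨p, hp⟩) I
  rwa [pComp_eps, coeff_algebraMap] at this

omit hψ in
/-- The Chinese remainder theorem: elements of `R_p` can be approximated modulo `N` by elements of
`R` that are divisible by `N` in `R_l` for all other primes `l`. -/
theorem exists_Cp_approx {p : ℕ} (hp : p.Prime) {N : ℕ} (hN : N ≠ 0) (c : Cp R p) :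
    ∃ r : R, (N : Cp R p) ∣ c - algebraMap R (Cp R p) r ∧
      ∀ l : ℕ, l.Prime → l ≠ p → (N : Cp R l) ∣ algebraMap R (Cp R l) r := by
  obtain ⟨v, M, hM, rfl⟩ := Nat.exists_eq_pow_mul_and_not_dvd hN p hp.ne_one
  obtain ⟨r, z, rfl⟩ := Cp_exists_eq p c v
  have h2 : IsCoprime (M : ℤ) ((p ^ v : ℕ) : ℤ) :=
    Nat.isCoprime_iff_coprime.mpr (((Nat.Prime.coprime_iff_not_dvd hp).mpr hM).symm.pow_right v)
  obtain ⟨a, b, hab⟩ := h2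
  refine ⟨r * a * M, ?_, fun l hl hlp => ?_⟩
  · obtain ⟨u, hu⟩ := (isUnit_natCast_Cp (R := R) hp hM).exists_left_inv
    have h3 : (a : Cp R p) * M = 1 - b * (p : Cp R p) ^ v := by
      have := congrArg (Int.cast : ℤ → Cp R p) hab
      push_cast at this
      linear_combination this
    refine ⟨u * (b * algebraMap R (Cp R p) r + z), ?_⟩
    rw [map_mul, map_mul, map_intCast, map_natCast]
    push_cast
    linear_combination (-algebraMap R (Cp R p) r) * h3 -
      (p : Cp R p) ^ v * (b * algebraMap R (Cp R p) r + z) * hu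
  · have h3 : ¬ l ∣ p ^ v := fun h => hlp ((Nat.prime_dvd_prime_iff_eq hl hp).mp (hl.dvd_of_dvd_pow h))
    obtain ⟨u, hu⟩ := (isUnit_natCast_Cp (R := R) hl h3).exists_left_inv
    refine ⟨u * algebraMap R (Cp R l) (r * a), ?_⟩
    rw [map_mul _ (r * a), map_natCast]
    push_cast at hu
    rw [Nat.cast_mul, Nat.cast_pow]
    linear_combination (-algebraMap R (Cp R l) (r * a) * M) * hu

omit hψ in
theorem exists_modA_one_approx_single {p : Nat.Primes} (t : Diff (Cp R p) n) :
    ∃ d : Diff R n, t - pComp p d ∈ modA (coordp ψ p) 1 ∧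
      ∀ l : Nat.Primes, l ≠ p → pComp l d ∈ modA (coordp ψ l) 1 := by
  have h1 : ∀ I, ∃ r : R, ((mfact I : Cp R p) ∣
        PowerSeries.coeff 0 (t.1 (eps I)) - algebraMap R (Cp R p) r ∧
      ∀ l : ℕ, l.Prime → l ≠ p → (mfact I : Cp R l) ∣ algebraMap R (Cp R l) r) ∧
      (PowerSeries.coeff 0 (t.1 (eps I)) = 0 → r = 0) := by
    intro I
    by_cases h0 : PowerSeries.coeff 0 (t.1 (eps I)) = 0
    · exact ⟨0, ⟨by simp [h0], by simp⟩, fun _ => rfl⟩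
    · obtain ⟨r, hr⟩ := exists_Cp_approx p.2 (mfact_ne_zero I) (PowerSeries.coeff 0 (t.1 (eps I)))
      exact ⟨r, hr, fun h => absurd h h0⟩
  choose r hr hr0 using h1
  have hn : IsNull fun I => PowerSeries.C (r I) := by
    intro m
    refine (isNull_symbol t 1).subset fun I hI hX => hI ?_
    rw [pow_one, X_dvd_iff_coeff_zero] at hX
    beta_reduce
    rw [hr0 I hX, map_zero]
    exact dvd_zero _
  refine ⟨ofSymbol _ hn, mem_modA_one_iff.mpr fun I => ?_, fun l hl => mem_modA_one_iff.mpr fun I => ?_⟩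
  · rw [Diff.sub_apply, map_sub, pComp_eps, ofSymbol_eps, algebraMap_C, PowerSeries.coeff_zero_C]
    exact (hr I).1
  · rw [pComp_eps, ofSymbol_eps, algebraMap_C, PowerSeries.coeff_zero_C]
    exact (hr I).2 l l.2 fun h => hl (Subtype.ext h)

omit hψ in
/-- Surjectivity of the map of `Diff / 𝒜_ψ` to the direct sum of the `Diff / 𝒜_{ψ,p}`, modulo
`q-1`. -/
theorem exists_modA_one_approx (t : ∀ p : Nat.Primes, Diff (Cp R p) n)
    (ht : {p : Nat.Primes | t p ∉ modA (coordp ψ p) 1}.Finite) :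
    ∃ d : Diff R n, ∀ p : Nat.Primes, t p - pComp p d ∈ modA (coordp ψ p) 1 := by
  classical
  choose d hd hd' using fun p : Nat.Primes => exists_modA_one_approx_single (ψ := ψ) (t p)
  have hsum : ∀ (p : Nat.Primes) (T : Finset Nat.Primes),
      pComp p (∑ l ∈ T, d l) = ∑ l ∈ T, pComp p (d l) := by
    intro p T
    let f : Diff R n →+ Diff (Cp R p) n :=
      AddMonoidHom.mk' (pComp p) (pComp_add p)
    exact map_sum f d T
  refine ⟨∑ l ∈ ht.toFinset, d l, fun p => ?_⟩
  rw [hsum]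
  by_cases hp : p ∈ ht.toFinset
  · rw [← Finset.add_sum_erase _ _ hp, ← sub_sub]
    refine sub_mem (hd p) (sum_mem fun l hl => ?_)
    exact hd' l p (Finset.ne_of_mem_erase hl).symm
  · refine sub_mem (by simpa using hp) (sum_mem fun l hl => hd' l p ?_)
    rintro rfl
    exact hp hl

/-- An operator whose completions all lie in `𝒜_{ψ,p}` lies in `𝒜_ψ`. -/
theorem mem_A_of_forall_pComp {s : Diff R n}
    (h : ∀ p : Nat.Primes, pComp p s ∈ A (coordp ψ p)) : s ∈ A (coord ψ) := by
  refine (isCoordSystem_coord hψ).mem_A_of_forall fun m => ?_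
  suffices s ∈ modA (coord ψ) m from this
  induction m generalizing s with
  | zero => exact ⟨0, zero_mem _, s, by simp⟩
  | succ m ih =>
    obtain ⟨a, ha, e, rfl⟩ := mem_modA_one_of_forall (ψ := ψ) (s := s) fun p =>
      ⟨_, h p, 0, by rw [smul_zero, add_zero]⟩
    obtain ⟨a', ha', e', rfl⟩ := ih (s := e) fun p => by
      refine (isCoordSystem_coordp hψ p.2).mem_A_of_X_pow_smul_mem (m := 1) ?_
      rw [← pComp_X_pow_smul]
      have h1 := sub_mem (h p) (pComp_mem_A hψ p.2 ha)
      rwa [pComp_add, add_sub_cancel_left] at h1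
    refine ⟨a + (PowerSeries.X : R⟦X⟧) ^ 1 • a', add_mem ha (Submodule.smul_mem _ _ ha'), e', ?_⟩
    rw [smul_add, ← mul_smul, ← pow_add, add_comm 1 m, add_assoc]

end Completion

/-! ### Successive approximation in filtered groups -/

/-- Let `f i : G → K i` be homomorphisms of filtered groups, where `G` is complete, and let
`H i ≤ K i` be closed subgroups. If every family in the graded pieces of `K i / H i`, almost all of
whose members are trivial, comes from the graded pieces of `G`, then every family `g i` that is
almost everywhere trivial modulo every step of the filtration comes from an element of `G`. -/
@[to_additive /-- The additive version of `exists_forall_inv_mul_mem`. -/]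
theorem exists_forall_inv_mul_mem {ι G : Type*} [Group G] {K : ι → Type*} [∀ i, Group (K i)]
    (f : ∀ i, G →* K i) (N : ℕ → Subgroup G) (N' : ∀ i, ℕ → Subgroup (K i))
    (H : ∀ i, Subgroup (K i)) (hN : Antitone N) (hnormal : ∀ i m, (N' i m).Normal)
    (hf : ∀ i m, ∀ g ∈ N m, f i g ∈ N' i m)
    (hcomplete : ∀ P : ℕ → G, (∀ m, P m ∈ N 0) → (∀ m, (P m)⁻¹ * P (m + 1) ∈ N m) →
      ∃ s ∈ N 0, ∀ m, (P m)⁻¹ * s ∈ N m)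
    (hclosed : ∀ i g, (∀ m, g ∈ N' i m ⊔ H i) → g ∈ H i)
    (hfin : ∀ s ∈ N 0, ∀ m, {i | f i s ∉ N' i m ⊔ H i}.Finite)
    (hgr : ∀ (m : ℕ) (t : ∀ i, K i), (∀ i, t i ∈ N' i m) →
      {i | t i ∉ N' i (m + 1) ⊔ H i}.Finite →
      ∃ d ∈ N m, ∀ i, (f i d)⁻¹ * t i ∈ N' i (m + 1) ⊔ H i)
    (g : ∀ i, K i) (hg0 : ∀ i, g i ∈ N' i 0 ⊔ H i)
    (hg : ∀ m, {i | g i ∉ N' i m ⊔ H i}.Finite) :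
    ∃ s ∈ N 0, ∀ i, (f i s)⁻¹ * g i ∈ H i := by
  -- an approximation `P` modulo the `m`-th step is improved to one modulo the next step
  have step : ∀ (m : ℕ) (P : G), P ∈ N 0 → (∀ i, (f i P)⁻¹ * g i ∈ N' i m ⊔ H i) →
      ∃ P' ∈ N 0, P⁻¹ * P' ∈ N m ∧ ∀ i, (f i P')⁻¹ * g i ∈ N' i (m + 1) ⊔ H i := by
    intro m P hP0 hP
    have h1 : ∀ i, ∃ t ∈ N' i m, ∃ h ∈ H i, t * h = (f i P)⁻¹ * g i := fun i => by
      have := hnormal i m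
      exact Subgroup.mem_sup_of_normal_left.mp (hP i)
    choose t ht h hh hth using h1
    obtain ⟨d, hd, hd'⟩ := hgr m t ht (by
      refine ((hfin P hP0 (m + 1)).union (hg (m + 1))).subset fun i hi => ?_
      by_contra hcon
      simp only [Set.mem_union, Set.mem_ofPred_eq, not_or, not_not] at hcon
      refine hi ?_
      rw [eq_mul_inv_of_mul_eq (hth i)]
      exact mul_mem (mul_mem (inv_mem hcon.1) hcon.2)
        (inv_mem (le_sup_right (a := N' i (m + 1)) (hh i))))
    refine ⟨P * d, mul_mem hP0 (hN (Nat.zero_le m) hd), by simpa using hd, fun i => ?_⟩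
    have h2 : (f i (P * d))⁻¹ * g i = (f i d)⁻¹ * t i * h i := by
      rw [mul_assoc, hth, map_mul, mul_inv_rev, mul_assoc]
    rw [h2]
    exact mul_mem (hd' i) (le_sup_right (a := N' i (m + 1)) (hh i))
  choose! S hS0 hS1 hS2 using step
  let P : ℕ → G := fun m => Nat.rec 1 (fun m Q => S m Q) m
  have hP : ∀ m, P m ∈ N 0 ∧ ∀ i, (f i (P m))⁻¹ * g i ∈ N' i m ⊔ H i := by
    intro m
    induction m with
    | zero => exact ⟨one_mem _, by simpa [P] using hg0⟩
    | succ m ih => exact ⟨hS0 m _ ih.1 ih.2, hS2 m _ ih.1 ih.2⟩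
  obtain ⟨s, hs0, hs⟩ := hcomplete P (fun m => (hP m).1) fun m => hS1 m _ (hP m).1 (hP m).2
  refine ⟨s, hs0, fun i => hclosed i _ fun m => ?_⟩
  have h3 : (f i s)⁻¹ * g i = (f i ((P m)⁻¹ * s))⁻¹ * ((f i (P m))⁻¹ * g i) := by
    rw [map_mul, map_inv, mul_inv_rev, inv_inv, mul_assoc, mul_inv_cancel_left]
  rw [h3]
  exact mul_mem (inv_mem (le_sup_left (b := H i) (hf i m _ (hs m)))) ((hP m).2 i)

section Additive

variable {S : Type*} [CommRing S] {n : ℕ} {x : Fin n → S}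

/-- The subgroup `(q-1)^m Diff`. -/
def filtration (S : Type*) [CommRing S] (n m : ℕ) : AddSubgroup (Diff S n) where
  carrier := {d | ∃ e : Diff S n, d = (PowerSeries.X : S⟦X⟧) ^ m • e}
  zero_mem' := ⟨0, (smul_zero _).symm⟩
  add_mem' := by
    rintro _ _ ⟨e, rfl⟩ ⟨e', rfl⟩
    exact ⟨e + e', (smul_add _ _ _).symm⟩
  neg_mem' := by
    rintro _ ⟨e, rfl⟩
    exact ⟨-e, (smul_neg _ _).symm⟩

theorem filtration_sup (x : Fin n → S) (m : ℕ) :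
    filtration S n m ⊔ (A x).toAddSubgroup = modA x m := by
  ext d
  rw [AddSubgroup.mem_sup]
  constructor
  · rintro ⟨_, ⟨e, rfl⟩, a, ha, rfl⟩
    exact ⟨a, ha, e, add_comm _ _⟩
  · rintro ⟨a, ha, e, rfl⟩
    exact ⟨_, ⟨e, rfl⟩, a, ha, add_comm _ _⟩

theorem filtration_antitone : Antitone (filtration S n) := by
  rintro k m hkm _ ⟨e, rfl⟩
  obtain ⟨l, rfl⟩ := Nat.exists_eq_add_of_le hkm
  exact ⟨(PowerSeries.X : S⟦X⟧) ^ l • e, by rw [pow_add, mul_smul]⟩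

theorem IsCoordSystem.X_pow_smul_mem_modA_iff (h : IsCoordSystem x) {m k : ℕ} {d : Diff S n} :
    (PowerSeries.X : S⟦X⟧) ^ m • d ∈ modA x (m + k) ↔ d ∈ modA x k := by
  constructor
  · rintro ⟨a, ha, e, he⟩
    refine ⟨d - (PowerSeries.X : S⟦X⟧) ^ k • e, h.mem_A_of_X_pow_smul_mem (m := m) ?_, e, by abel⟩
    rw [smul_sub, ← mul_smul, ← pow_add, he, add_sub_cancel_right]
    exact ha
  · rintro ⟨a, ha, e, rfl⟩
    exact ⟨_, Submodule.smul_mem _ _ ha, e, by rw [smul_add, ← mul_smul, ← pow_add]⟩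

/-- Limits in `Diff`: a sequence with `P_{m+1} ≡ P_m` modulo `(q-1)^m` converges. -/
theorem Diff.exists_limit (P : ℕ → Diff S n)
    (hP : ∀ m, -P m + P (m + 1) ∈ filtration S n m) : ∃ s, ∀ m, -P m + s ∈ filtration S n m := by
  choose d hd using hP
  obtain ⟨s, hs⟩ := Diff.exists_series d
  refine ⟨P 0 + s, fun m => ?_⟩
  obtain ⟨e, he⟩ := hs m
  refine ⟨e, ?_⟩
  have h1 : P m = P 0 + ∑ k ∈ Finset.range m, (PowerSeries.X : S⟦X⟧) ^ k • d k := by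
    clear he
    induction m with
    | zero => simp
    | succ m ih => rw [Finset.sum_range_succ, ← add_assoc, ← ih, ← hd, add_neg_cancel_left]
  rw [h1, he]
  abel

end Additive

section AdditiveSurjectivity

variable {R : Type*} [CommRing R] {n : ℕ}

/-- The `p`-adic completion map as an additive homomorphism. -/
def pCompAddHom (R : Type*) [CommRing R] (n p : ℕ) : Diff R n →+ Diff (Cp R p) n :=
  AddMonoidHom.mk' (pComp p) (pComp_add p)

/-- Families in the `Diff / 𝒜_{ψ,p}` that are trivial modulo `(q-1)^m` for almost all `p`, for
every `m`, come from `Diff / 𝒜_ψ`. -/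
theorem exists_sub_pComp_mem_A {ψ : MvPolynomial (Fin n) ℤ →+* R} (hψ : ψ.Etale)
    (t : ∀ p : Nat.Primes, Diff (Cp R p) n)
    (ht : ∀ m, {p : Nat.Primes | t p ∉ modA (coordp ψ p) m}.Finite) :
    ∃ s : Diff R n, ∀ p : Nat.Primes, t p - pComp p s ∈ A (coordp ψ p) := by
  have h0 : ∀ d : Diff R n, d ∈ filtration R n 0 := fun d => ⟨d, by simp⟩
  suffices H : ∃ s ∈ filtration R n 0, ∀ p : Nat.Primes,
      -pCompAddHom R n p s + t p ∈ (A (coordp ψ p)).toAddSubgroup by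
    obtain ⟨s, -, hs⟩ := H
    refine ⟨s, fun p => ?_⟩
    have h1 : t p - pComp p s = -pCompAddHom R n p s + t p := by
      rw [add_comm, ← sub_eq_add_neg]
      rfl
    rw [h1]
    exact hs p
  refine exists_forall_neg_add_mem
    (fun p : Nat.Primes => pCompAddHom R n p) (filtration R n)
    (fun p => filtration (Cp R p) n) (fun p => (A (coordp ψ p)).toAddSubgroup)
    filtration_antitone (fun p m => inferInstance) ?_ ?_ ?_ ?_ ?_ t ?_ ?_
  · rintro p m _ ⟨e, rfl⟩
    exact ⟨pComp p e, pComp_X_pow_smul p m e⟩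
  · intro P _ hP
    obtain ⟨s, hs⟩ := Diff.exists_limit P hP
    exact ⟨s, h0 s, hs⟩
  · intro p g hg
    refine (isCoordSystem_coordp hψ p.2).mem_A_of_forall fun m => ?_
    have := hg m
    rw [filtration_sup] at this
    exact this
  · intro s _ m
    simp only [filtration_sup]
    exact finite_not_mem_modA hψ m s
  · intro m t ht hfin
    simp only [filtration_sup] at hfin ⊢
    choose d hd using ht
    obtain ⟨e, he⟩ := exists_modA_one_approx (ψ := ψ) d (by
      refine hfin.subset fun p hp h1 => hp ?_
      rw [hd] at h1
      exact (isCoordSystem_coordp hψ p.2).X_pow_smul_mem_modA_iff.mp h1)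
    refine ⟨_, ⟨e, rfl⟩, fun p => ?_⟩
    have h1 : -pCompAddHom R n p ((PowerSeries.X : R⟦X⟧) ^ m • e) + t p =
        (PowerSeries.X : (Cp R p)⟦X⟧) ^ m • (d p - pComp p e) := by
      rw [smul_sub, ← pComp_X_pow_smul, ← hd, add_comm, ← sub_eq_add_neg]
      rfl
    rw [h1]
    exact (isCoordSystem_coordp hψ p.2).X_pow_smul_mem_modA_iff.mpr (he p)
  · intro p
    exact (le_sup_left (a := filtration (Cp R p) n 0)) ⟨t p, by simp⟩
  · intro m
    simp only [filtration_sup]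
    exact ht m

end AdditiveSurjectivity

/-! ### The groups of sections -/

section Units

variable {S : Type*} [CommRing S] {n : ℕ} {x : Fin n → S} {h : IsCoordSystem x}

/-- An element of `DiffRing h` as a differential operator. This is the identity; it separates the
types `DiffRing h` and `Diff S n`. -/
def DiffRing.toDiff (a : DiffRing h) : Diff S n := a

/-- `𝒜_ψ` as a subring of `DiffRing h`. -/
def subringA (h : IsCoordSystem x) : Subring (DiffRing h) where
  carrier := {a | a.toDiff ∈ A x}
  mul_mem' := fun ha hb => h.comp_mem_A ha hb
  one_mem' := one_mem_A x
  add_mem' := fun ha hb => (A x).add_mem ha hb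
  zero_mem' := (A x).zero_mem
  neg_mem' := fun ha => (A x).neg_mem ha

theorem mem_subringA {a : DiffRing h} : a ∈ subringA h ↔ a.toDiff ∈ A x := Iff.rfl

theorem smul_mem_subringA (b : S⟦X⟧) {a : DiffRing h} (ha : a ∈ subringA h) : b • a ∈ subringA h :=
  mem_subringA.mpr ((A x).smul_mem b ha)

theorem DiffRing.neg_X_smul_pow (d : DiffRing h) (k : ℕ) :
    (-((PowerSeries.X : S⟦X⟧) ^ 1 • d)) ^ k = (PowerSeries.X : S⟦X⟧) ^ k • (-d) ^ k := by
  induction k with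
  | zero => simp
  | succ k ih =>
    rw [pow_succ, pow_succ _ k, ih, ← smul_neg, DiffRing.smul_mul, DiffRing.mul_X_pow_smul,
      ← mul_smul, ← pow_add, ← pow_succ, pow_succ (PowerSeries.X : S⟦X⟧) k]

/-- The operators `1 + (q-1) d` are invertible, by the geometric series, and the inverse lies in
`𝒜_ψ` if `d` does. -/
theorem DiffRing.exists_unit (d : DiffRing h) : ∃ u : (DiffRing h)ˣ,
    (u : DiffRing h) = 1 + (PowerSeries.X : S⟦X⟧) ^ 1 • d ∧
      (d ∈ subringA h → (↑u⁻¹ : DiffRing h) ∈ subringA h) := by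
  obtain ⟨t, ht⟩ := Diff.exists_series fun k => ((-d) ^ k : DiffRing h)
  set y : DiffRing h := -((PowerSeries.X : S⟦X⟧) ^ 1 • d) with hy
  have ht' : ∀ m, ∃ e : DiffRing h,
      t = ∑ k ∈ Finset.range m, y ^ k + (PowerSeries.X : S⟦X⟧) ^ m • e := by
    intro m
    obtain ⟨e, he⟩ := ht m
    refine ⟨e, he.trans ?_⟩
    simp only [hy, DiffRing.neg_X_smul_pow]
    rfl
  let t' : DiffRing h := t
  have h1 : (1 - y) * t' = 1 := by
    rw [← sub_eq_zero]
    refine Diff.eq_zero_of_forall_X_pow_smul fun m => ?_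
    obtain ⟨e, he⟩ := ht' m
    refine ⟨((1 - y) * e - (-d) ^ m : DiffRing h), ?_⟩
    change (1 - y) * t' - 1 = (PowerSeries.X : S⟦X⟧) ^ m • ((1 - y) * e - (-d) ^ m)
    rw [show t' = _ from he, mul_add, mul_neg_geom_sum, DiffRing.mul_X_pow_smul, hy,
      DiffRing.neg_X_smul_pow, smul_sub]
    abel
  have h2 : t' * (1 - y) = 1 := by
    rw [← sub_eq_zero]
    refine Diff.eq_zero_of_forall_X_pow_smul fun m => ?_
    obtain ⟨e, he⟩ := ht' m
    refine ⟨(e * (1 - y) - (-d) ^ m : DiffRing h), ?_⟩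
    change t' * (1 - y) - 1 = (PowerSeries.X : S⟦X⟧) ^ m • (e * (1 - y) - (-d) ^ m)
    rw [show t' = _ from he, add_mul, geom_sum_mul_neg, DiffRing.smul_mul, hy,
      DiffRing.neg_X_smul_pow, smul_sub]
    abel
  refine ⟨⟨1 - y, t', h1, h2⟩, by simp [hy], fun hd => ?_⟩
  change t' ∈ subringA h
  refine mem_subringA.mpr (h.mem_A_of_forall fun m => ?_)
  obtain ⟨e, he⟩ := ht' m
  refine ⟨_, ?_, e, he⟩
  have hyA : y ∈ subringA h := neg_mem (smul_mem_subringA _ hd)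
  change ∑ k ∈ Finset.range m, y ^ k ∈ subringA h
  exact sum_mem fun k _ => pow_mem hyA k

/-- The group of invertible operators congruent to `1` modulo `(q-1)^m`. -/
def congruenceSubgroup (h : IsCoordSystem x) (m : ℕ) : Subgroup (DiffRing h)ˣ where
  carrier := {u | ∃ d : DiffRing h, (u : DiffRing h) = 1 + (PowerSeries.X : S⟦X⟧) ^ m • d}
  one_mem' := ⟨0, by simp⟩
  mul_mem' := by
    rintro u v ⟨d, hd⟩ ⟨e, he⟩
    refine ⟨d + u * e, ?_⟩
    rw [Units.val_mul, he, mul_add, mul_one, DiffRing.mul_X_pow_smul, smul_add, hd]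
    abel
  inv_mem' := by
    rintro u ⟨d, hd⟩
    refine ⟨-(↑u⁻¹ * d), ?_⟩
    have h1 : (↑u⁻¹ : DiffRing h) * (u - (PowerSeries.X : S⟦X⟧) ^ m • d) = ↑u⁻¹ := by
      rw [hd, add_sub_cancel_right, mul_one]
    rw [mul_sub, Units.inv_mul, DiffRing.mul_X_pow_smul] at h1
    rw [smul_neg, ← sub_eq_add_neg, h1]

theorem mem_congruenceSubgroup {m : ℕ} {u : (DiffRing h)ˣ} : u ∈ congruenceSubgroup h m ↔
    ∃ d : DiffRing h, (u : DiffRing h) = 1 + (PowerSeries.X : S⟦X⟧) ^ m • d := Iff.rfl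

instance (m : ℕ) : (congruenceSubgroup h m).Normal where
  conj_mem := by
    rintro u ⟨d, hd⟩ v
    refine ⟨v * d * ↑v⁻¹, ?_⟩
    rw [Units.val_mul, Units.val_mul, hd, mul_add, mul_one, add_mul, Units.mul_inv,
      DiffRing.mul_X_pow_smul, DiffRing.smul_mul]

theorem congruenceSubgroup_antitone : Antitone (congruenceSubgroup h) := by
  rintro k m hkm u ⟨d, hd⟩
  obtain ⟨l, rfl⟩ := Nat.exists_eq_add_of_le hkm
  exact ⟨(PowerSeries.X : S⟦X⟧) ^ l • d, by rw [hd, pow_add, mul_smul]⟩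

theorem inv_mul_mem_congruenceSubgroup {m : ℕ} {u v : (DiffRing h)ˣ} :
    u⁻¹ * v ∈ congruenceSubgroup h m ↔
      ∃ d : DiffRing h, (v : DiffRing h) = u + (PowerSeries.X : S⟦X⟧) ^ m • d := by
  constructor
  · rintro ⟨d, hd⟩
    refine ⟨u * d, ?_⟩
    have h1 : (v : DiffRing h) = u * ↑(u⁻¹ * v) := by rw [← Units.val_mul, mul_inv_cancel_left]
    rw [h1, hd, mul_add, mul_one, DiffRing.mul_X_pow_smul]
  · rintro ⟨d, hd⟩
    refine ⟨↑u⁻¹ * d, ?_⟩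
    rw [Units.val_mul, hd, mul_add, Units.inv_mul, DiffRing.mul_X_pow_smul]

theorem X_smul_mem_subringA_iff {m : ℕ} {d : DiffRing h} :
    (PowerSeries.X : S⟦X⟧) ^ m • d ∈ subringA h ↔ d ∈ subringA h :=
  ⟨fun hd => mem_subringA.mpr (h.mem_A_of_X_pow_smul_mem hd), smul_mem_subringA _⟩

/-- The group `S𝒜_ψ`. It is closed under inverses because `1 + (q-1) d ∈ 𝒜_ψ` implies
`d ∈ 𝒜_ψ`. -/
def sectionSubgroup (h : IsCoordSystem x) : Subgroup (DiffRing h)ˣ where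
  carrier := {u | u ∈ congruenceSubgroup h 1 ∧ (u : DiffRing h) ∈ subringA h}
  one_mem' := ⟨one_mem _, one_mem (subringA h)⟩
  mul_mem' := fun hu hv => ⟨mul_mem hu.1 hv.1, mul_mem (S := Subring (DiffRing h)) hu.2 hv.2⟩
  inv_mem' := by
    rintro u ⟨⟨d, hd⟩, hA⟩
    refine ⟨inv_mem (mem_congruenceSubgroup.mpr ⟨d, hd⟩), ?_⟩
    obtain ⟨v, hv, hv'⟩ := DiffRing.exists_unit d
    have huv : u = v := Units.ext (hd.trans hv.symm)
    rw [huv]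
    refine hv' ((X_smul_mem_subringA_iff (m := 1)).mp ?_)
    have := sub_mem hA (one_mem (subringA h))
    rwa [hd, add_sub_cancel_left] at this

theorem DiffRing.X_pow_smul_cancel {m : ℕ} {s t : DiffRing h}
    (hst : (PowerSeries.X : S⟦X⟧) ^ m • s = (PowerSeries.X : S⟦X⟧) ^ m • t) : s = t :=
  Diff.X_pow_smul_cancel hst

/-- For `u = 1 + (q-1) d`, the class of `u` modulo `S𝒜_ψ` is trivial modulo `(q-1)^{m+1}` if and
only if the class of `d` modulo `𝒜_ψ` is trivial modulo `(q-1)^m`. -/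
theorem mem_congruenceSubgroup_sup_iff {m : ℕ} {u : (DiffRing h)ˣ} {d : DiffRing h}
    (hd : (u : DiffRing h) = 1 + (PowerSeries.X : S⟦X⟧) ^ 1 • d) :
    u ∈ congruenceSubgroup h (m + 1) ⊔ sectionSubgroup h ↔ d.toDiff ∈ modA x m := by
  rw [Subgroup.mem_sup_of_normal_left]
  constructor
  · rintro ⟨v, ⟨e, he⟩, w, ⟨⟨a, ha⟩, hA⟩, rfl⟩
    have haA : a ∈ subringA h := by
      have := sub_mem hA (one_mem (subringA h))
      rw [ha, add_sub_cancel_left] at this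
      exact X_smul_mem_subringA_iff.mp this
    refine ⟨a.toDiff, haA, (e * (w : DiffRing h)).toDiff, ?_⟩
    have key : d = a + (PowerSeries.X : S⟦X⟧) ^ m • (e * (w : DiffRing h)) := by
      refine DiffRing.X_pow_smul_cancel (m := 1) (add_left_cancel (a := (1 : DiffRing h)) ?_)
      rw [← hd, Units.val_mul, he, add_mul, one_mul, DiffRing.smul_mul, smul_add, ← mul_smul,
        ← pow_add, add_comm 1 m, ← add_assoc, ← ha]
    exact key
  · rintro ⟨a', ha, e', he'⟩
    let a : DiffRing h := a'
    let e : DiffRing h := e'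
    have he : d = a + (PowerSeries.X : S⟦X⟧) ^ m • e := he'
    obtain ⟨w, hw, -⟩ := DiffRing.exists_unit a
    have hwA : w ∈ sectionSubgroup h := by
      refine ⟨⟨a, hw⟩, ?_⟩
      rw [hw]
      exact add_mem (one_mem (subringA h)) (smul_mem_subringA _ ha)
    refine ⟨u * w⁻¹, ⟨e * ↑w⁻¹, ?_⟩, w, hwA, inv_mul_cancel_right u w⟩
    have h1 : (u : DiffRing h) = w + (PowerSeries.X : S⟦X⟧) ^ (m + 1) • e := by
      rw [hd, hw, add_assoc, he, smul_add, ← mul_smul, ← pow_add, add_comm 1 m]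
    rw [Units.val_mul, h1, add_mul, Units.mul_inv, DiffRing.smul_mul]

theorem congruenceSubgroup_sup_le (m : ℕ) :
    congruenceSubgroup h (m + 1) ⊔ sectionSubgroup h ≤ congruenceSubgroup h 1 :=
  sup_le (congruenceSubgroup_antitone (Nat.le_add_left 1 m)) fun _ hu => hu.1

/-- Completeness of the group `SDiff` with respect to the congruence subgroups. -/
theorem exists_unit_limit (P : ℕ → (DiffRing h)ˣ) (hP0 : ∀ m, P m ∈ congruenceSubgroup h (0 + 1))
    (hP : ∀ m, (P m)⁻¹ * P (m + 1) ∈ congruenceSubgroup h (m + 1)) :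
    ∃ s ∈ congruenceSubgroup h (0 + 1), ∀ m, (P m)⁻¹ * s ∈ congruenceSubgroup h (m + 1) := by
  choose c hc using hP0
  simp only [zero_add] at hc
  have h1 : ∀ m, -(c m : Diff S n) + c (m + 1) ∈ filtration S n m := by
    intro m
    obtain ⟨d, hd⟩ := inv_mul_mem_congruenceSubgroup.mp (hP m)
    refine ⟨d, DiffRing.X_pow_smul_cancel (h := h) (m := 1) ?_⟩
    change (PowerSeries.X : S⟦X⟧) ^ 1 • (-c m + c (m + 1)) =
      (PowerSeries.X : S⟦X⟧) ^ 1 • (PowerSeries.X : S⟦X⟧) ^ m • d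
    rw [hc, hc, add_assoc, add_right_inj] at hd
    rw [smul_add, hd, smul_neg, neg_add_cancel_left, ← mul_smul, ← pow_add, add_comm 1 m]
  obtain ⟨s, hs⟩ := Diff.exists_limit _ h1
  let s' : DiffRing h := s
  obtain ⟨u, hu, -⟩ := DiffRing.exists_unit s'
  refine ⟨u, ⟨s', hu⟩, fun m => inv_mul_mem_congruenceSubgroup.mpr ?_⟩
  obtain ⟨e, he⟩ := hs m
  let e' : DiffRing h := e
  have he' : -c m + s' = (PowerSeries.X : S⟦X⟧) ^ m • e' := he
  refine ⟨e', ?_⟩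
  rw [hu, hc, add_assoc, add_comm m 1, pow_add, mul_smul, ← he', ← smul_add, add_neg_cancel_left]

/-- The subgroup of the operators `s` with `s(1) = 1`. -/
def unitalSubgroup (h : IsCoordSystem x) : Subgroup (DiffRing h)ˣ where
  carrier := {u | (u : DiffRing h).op 1 = 1}
  one_mem' := DiffRing.op_one 1
  mul_mem' := by
    intro u v hu hv
    change (↑(u * v) : DiffRing h).op 1 = 1
    rw [Units.val_mul, DiffRing.op_mul, show (v : DiffRing h).op 1 = 1 from hv]
    exact hu
  inv_mem' := by
    intro u hu
    change (↑u⁻¹ : DiffRing h).op 1 = 1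
    have h1 : (↑u⁻¹ : DiffRing h).op ((u : DiffRing h).op 1) = 1 := by
      rw [← DiffRing.op_mul, Units.inv_mul, DiffRing.op_one]
    rwa [show (u : DiffRing h).op 1 = 1 from hu] at h1

theorem mem_unitalSubgroup {u : (DiffRing h)ˣ} :
    u ∈ unitalSubgroup h ↔ (u : DiffRing h).op 1 = 1 := Iff.rfl

/-- Every operator congruent to `1` can be made unital by the multiplication with a scalar
`v = u⁻¹(1)` on the right. -/
theorem exists_mul_mem_unitalSubgroup {m : ℕ} {u : (DiffRing h)ˣ}
    (hu : u ∈ congruenceSubgroup h (m + 1)) : ∃ v ∈ sectionSubgroup h,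
      v ∈ congruenceSubgroup h (m + 1) ∧ u * v ∈ unitalSubgroup h := by
  obtain ⟨d, hd⟩ := inv_mem hu
  obtain ⟨v, hv, -⟩ := DiffRing.exists_unit (h := h)
    ((PowerSeries.X : S⟦X⟧) ^ m • (d.op 1 • 1))
  have hm : v ∈ congruenceSubgroup h (m + 1) :=
    ⟨d.op 1 • 1, by rw [hv, ← mul_smul, ← pow_add, add_comm 1 m]⟩
  refine ⟨v, ⟨congruenceSubgroup_antitone (Nat.le_add_left 1 m) hm, ?_⟩, hm, ?_⟩
  · rw [hv]
    exact add_mem (one_mem (subringA h)) (smul_mem_subringA _ (smul_mem_subringA _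
      (smul_mem_subringA _ (one_mem (subringA h)))))
  · have h1 : (v : DiffRing h).op 1 = (↑u⁻¹ : DiffRing h).op 1 := by
      rw [hv, hd]
      simp only [DiffRing.op_add, DiffRing.op_smul, DiffRing.op_one]
      ring
    rw [mem_unitalSubgroup, Units.val_mul, DiffRing.op_mul, h1, ← DiffRing.op_mul, Units.mul_inv,
      DiffRing.op_one]

/-- The differential operators that are the elements of a group of units of `DiffRing h`. -/
def unitSet (G : Subgroup (DiffRing h)ˣ) : Set (Diff S n) :=
  {s | ∃ u ∈ G, (u : DiffRing h).toDiff = s}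

/-- `SDiff` is the group of units congruent to `1` modulo `q-1`. -/
theorem SSet_univ_eq (h : IsCoordSystem x) : SSet x Set.univ =
    unitSet (congruenceSubgroup h 1) := by
  ext s
  constructor
  · rintro ⟨-, hs⟩
    obtain ⟨d, hd⟩ := exists_X_pow_smul_of_dvd (m := 1) (s := s - one)
      (h.dvd_eps_of_dvd_op fun f _ => by
        have h1 : op x (s - one) f = op x s f - op x one f := rfl
        rw [h1, h.op_one, pow_one]
        exact hs f)
    let d' : DiffRing h := d
    obtain ⟨u, hu, -⟩ := DiffRing.exists_unit d'
    refine ⟨u, ⟨d', hu⟩, hu.trans ?_⟩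
    exact (congrArg (one + ·) hd.symm).trans (add_sub_cancel one s)
  · rintro ⟨u, ⟨d, hd⟩, rfl⟩
    refine ⟨trivial, fun f => ?_⟩
    change _ ∣ (u : DiffRing h).op f - f
    rw [hd, DiffRing.op_add, DiffRing.op_smul, DiffRing.op_one, add_sub_cancel_left, pow_one]
    exact Dvd.intro _ rfl

theorem SSet_A_eq (h : IsCoordSystem x) : SSet x (A x) =
    unitSet (sectionSubgroup h) := by
  ext s
  constructor
  · rintro ⟨hA, hs⟩
    have : s ∈ SSet x Set.univ := ⟨trivial, hs⟩
    rw [SSet_univ_eq h] at this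
    obtain ⟨u, hu, rfl⟩ := this
    exact ⟨u, ⟨hu, hA⟩, rfl⟩
  · rintro ⟨u, hu, rfl⟩
    have : (u : DiffRing h).toDiff ∈ SSet x Set.univ := by
      rw [SSet_univ_eq h]
      exact ⟨u, hu.1, rfl⟩
    exact ⟨hu.2, this.2⟩

theorem SSet1_eq (h : IsCoordSystem x) {Y : Set (Diff S n)} {G : Subgroup (DiffRing h)ˣ}
    (hY : SSet x Y = unitSet G) : SSet1 x Y =
      unitSet (G ⊓ unitalSubgroup h) := by
  ext s
  have h1 : ∀ s : DiffRing h, s.op 1 = s.toDiff.1 1 := fun s => by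
    change s.toDiff.1 (delta0 x 1) = _
    rw [map_one]
  constructor
  · rintro ⟨hs, hs1⟩
    rw [hY] at hs
    obtain ⟨u, hu, rfl⟩ := hs
    exact ⟨u, ⟨hu, (h1 _).trans hs1⟩, rfl⟩
  · rintro ⟨u, hu, rfl⟩
    refine ⟨?_, (h1 _).symm.trans hu.2⟩
    rw [hY]
    exact ⟨u, hu.1, rfl⟩

end Units

/-! ### Cosets -/

section Cosets

variable {S : Type*} [CommRing S] {n : ℕ} {x : Fin n → S} {h : IsCoordSystem x}

theorem mem_coset_unitSet_iff {H : Subgroup (DiffRing h)ˣ} {u : (DiffRing h)ˣ} {s : Diff S n} :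
    s ∈ coset x (unitSet H) (u : DiffRing h).toDiff ↔
      ∃ v ∈ H, s = (↑(u * v) : DiffRing h).toDiff := by
  constructor
  · rintro ⟨_, ⟨v, hv, rfl⟩, rfl⟩
    exact ⟨v, hv, rfl⟩
  · rintro ⟨v, hv, rfl⟩
    exact ⟨_, ⟨v, hv, rfl⟩, rfl⟩

theorem coset_unitSet_eq_iff {H : Subgroup (DiffRing h)ˣ} {u v : (DiffRing h)ˣ} :
    coset x (unitSet H) (u : DiffRing h).toDiff = coset x (unitSet H) (v : DiffRing h).toDiff ↔
      u⁻¹ * v ∈ H := by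
  constructor
  · intro huv
    have h1 : (v : DiffRing h).toDiff ∈ coset x (unitSet H) (v : DiffRing h).toDiff :=
      mem_coset_unitSet_iff.mpr ⟨1, one_mem _, by rw [mul_one]⟩
    rw [← huv] at h1
    obtain ⟨w, hw, hvw⟩ := mem_coset_unitSet_iff.mp h1
    have h2 : v = u * w := Units.ext hvw
    rwa [h2, inv_mul_cancel_left]
  · intro huv
    ext s
    rw [mem_coset_unitSet_iff, mem_coset_unitSet_iff]
    constructor
    · rintro ⟨w, hw, rfl⟩
      exact ⟨(u⁻¹ * v)⁻¹ * w, mul_mem (inv_mem huv) hw, by rw [mul_inv_rev, inv_inv]; group⟩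
    · rintro ⟨w, hw, rfl⟩
      exact ⟨(u⁻¹ * v) * w, mul_mem huv hw, by group⟩

theorem mem_congruenceSubgroup_iff_forall_dvd {m : ℕ} {u : (DiffRing h)ˣ} :
    u ∈ congruenceSubgroup h m ↔ ∀ F, (PowerSeries.X : S⟦X⟧) ^ m ∣
      (u : DiffRing h).toDiff.1 F - (one : Diff S n).1 F := by
  constructor
  · rintro ⟨d, hd⟩ F
    have h1 : (u : DiffRing h).toDiff - one = (PowerSeries.X : S⟦X⟧) ^ m • d.toDiff :=
      (congrArg (· - (1 : DiffRing h)) hd).trans (add_sub_cancel_left _ _)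
    rw [← Diff.sub_apply, h1, Diff.smul_apply]
    exact Dvd.intro _ rfl
  · intro hu
    obtain ⟨d, hd⟩ := exists_X_pow_smul_of_dvd (s := (u : DiffRing h).toDiff - one)
      (m := m) fun I => hu (eps I)
    let d' : DiffRing h := d
    have h1 : (u : DiffRing h) - 1 = (PowerSeries.X : S⟦X⟧) ^ m • d' := hd
    exact ⟨d', by rw [← h1, add_sub_cancel]⟩

theorem isOneMod_mk_iff {G : Set (Diff S n)} {H : Subgroup (DiffRing h)ˣ} {m : ℕ}
    {u : (DiffRing h)ˣ} (hu : (u : DiffRing h).toDiff ∈ G) :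
    (CosetSpace.mk x (unitSet H) hu).IsOneMod m ↔
      ∃ v ∈ H, u * v ∈ congruenceSubgroup h m := by
  constructor
  · rintro ⟨s, hs, hF⟩
    obtain ⟨v, hv, rfl⟩ := mem_coset_unitSet_iff.mp hs
    exact ⟨v, hv, mem_congruenceSubgroup_iff_forall_dvd.mpr hF⟩
  · rintro ⟨v, hv, huv⟩
    exact ⟨_, mem_coset_unitSet_iff.mpr ⟨v, hv, rfl⟩,
      mem_congruenceSubgroup_iff_forall_dvd.mp huv⟩

end Cosets

/-! ### The `p`-adic completion of sections -/

section Sections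

variable {R : Type*} [CommRing R] {n : ℕ} {ψ : MvPolynomial (Fin n) ℤ →+* R} (hψ : ψ.Etale)

/-- The `p`-adic completion map as a homomorphism of rings. -/
def pCompHom (p : Nat.Primes) :
    DiffRing (isCoordSystem_coord hψ) →+* DiffRing (isCoordSystem_coordp hψ p.2) where
  toFun a := pComp p a.toDiff
  map_one' := pComp_one p
  map_mul' := pComp_comp hψ p.2
  map_zero' := (pCompAddHom R n p).map_zero
  map_add' := pComp_add p

/-- The `p`-adic completion map on groups of units. -/
def pCompUnits (p : Nat.Primes) :
    (DiffRing (isCoordSystem_coord hψ))ˣ →* (DiffRing (isCoordSystem_coordp hψ p.2))ˣ :=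
  Units.map (pCompHom hψ p : _ →* _)

theorem val_pCompUnits {p : Nat.Primes} {u : (DiffRing (isCoordSystem_coord hψ))ˣ} {m : ℕ}
    {d : DiffRing (isCoordSystem_coord hψ)}
    (hu : (u : DiffRing (isCoordSystem_coord hψ)) = 1 + (PowerSeries.X : R⟦X⟧) ^ m • d) :
    (pCompUnits hψ p u : DiffRing (isCoordSystem_coordp hψ p.2)) =
      1 + (PowerSeries.X : (Cp R p)⟦X⟧) ^ m • pCompHom hψ p d := by
  have h1 : pCompHom hψ p ((PowerSeries.X : R⟦X⟧) ^ m • d) =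
    (PowerSeries.X : (Cp R p)⟦X⟧) ^ m • pCompHom hψ p d := pComp_X_pow_smul p m d.toDiff
  have h2 : (pCompUnits hψ p u : DiffRing (isCoordSystem_coordp hψ p.2)) =
    pCompHom hψ p u := rfl
  rw [h2, hu, map_add, map_one, h1]

theorem pCompUnits_mem_congruenceSubgroup {p : Nat.Primes} {m : ℕ}
    {u : (DiffRing (isCoordSystem_coord hψ))ˣ}
    (hu : u ∈ congruenceSubgroup (isCoordSystem_coord hψ) m) :
    pCompUnits hψ p u ∈ congruenceSubgroup (isCoordSystem_coordp hψ p.2) m := by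
  obtain ⟨d, hd⟩ := hu
  exact ⟨_, val_pCompUnits hψ hd⟩

theorem pCompUnits_mem_sectionSubgroup {p : Nat.Primes}
    {u : (DiffRing (isCoordSystem_coord hψ))ˣ}
    (hu : u ∈ sectionSubgroup (isCoordSystem_coord hψ)) :
    pCompUnits hψ p u ∈ sectionSubgroup (isCoordSystem_coordp hψ p.2) :=
  ⟨pCompUnits_mem_congruenceSubgroup hψ hu.1, pComp_mem_A hψ p.2 hu.2⟩

theorem pCompUnits_mem_unitalSubgroup {p : Nat.Primes}
    {u : (DiffRing (isCoordSystem_coord hψ))ˣ}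
    (hu : u ∈ unitalSubgroup (isCoordSystem_coord hψ)) :
    pCompUnits hψ p u ∈ unitalSubgroup (isCoordSystem_coordp hψ p.2) := by
  have h1 := op_pComp hψ p (u : DiffRing (isCoordSystem_coord hψ)).toDiff 1
  have h2 : op (coord ψ) (u : DiffRing (isCoordSystem_coord hψ)).toDiff 1 = 1 := hu
  rw [h2, map_one] at h1
  exact h1

theorem mem_sectionSubgroup_of_forall {u : (DiffRing (isCoordSystem_coord hψ))ˣ}
    (hu : u ∈ congruenceSubgroup (isCoordSystem_coord hψ) 1)
    (h : ∀ p, pCompUnits hψ p u ∈ sectionSubgroup (isCoordSystem_coordp hψ p.2)) :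
    u ∈ sectionSubgroup (isCoordSystem_coord hψ) :=
  ⟨hu, mem_A_of_forall_pComp hψ fun p => (h p).2⟩

theorem finite_not_mem_congruenceSubgroup_sup {u : (DiffRing (isCoordSystem_coord hψ))ˣ}
    (hu : u ∈ congruenceSubgroup (isCoordSystem_coord hψ) 1) (m : ℕ) :
    {p | pCompUnits hψ p u ∉ congruenceSubgroup (isCoordSystem_coordp hψ p.2) (m + 1) ⊔
      sectionSubgroup (isCoordSystem_coordp hψ p.2)}.Finite := by
  obtain ⟨d, hd⟩ := hu
  refine (finite_not_mem_modA hψ m d.toDiff).subset fun p hp hd' => hp ?_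
  exact (mem_congruenceSubgroup_sup_iff (val_pCompUnits hψ hd)).mpr hd'

/-- Families of sections over the `R_p` that are trivial modulo `S𝒜_{ψ,p}` and `(q-1)^m` for almost
all `p`, for every `m`, come from a section over `R`, up to `S𝒜_{ψ,p}`. -/
theorem exists_pCompUnits_inv_mul_mem
    (g : ∀ p : Nat.Primes, (DiffRing (isCoordSystem_coordp hψ p.2))ˣ)
    (hg1 : ∀ p, g p ∈ congruenceSubgroup (isCoordSystem_coordp hψ p.2) 1)
    (hg : ∀ m, {p | g p ∉ congruenceSubgroup (isCoordSystem_coordp hψ p.2) (m + 1) ⊔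
      sectionSubgroup (isCoordSystem_coordp hψ p.2)}.Finite) :
    ∃ s ∈ congruenceSubgroup (isCoordSystem_coord hψ) 1,
      ∀ p, (pCompUnits hψ p s)⁻¹ * g p ∈ sectionSubgroup (isCoordSystem_coordp hψ p.2) := by
  refine exists_forall_inv_mul_mem (pCompUnits hψ)
    (fun m => congruenceSubgroup (isCoordSystem_coord hψ) (m + 1))
    (fun p m => congruenceSubgroup (isCoordSystem_coordp hψ p.2) (m + 1))
    (fun p => sectionSubgroup (isCoordSystem_coordp hψ p.2))
    (fun a b hab => congruenceSubgroup_antitone (Nat.succ_le_succ hab))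
    (fun p m => inferInstance) (fun p m u hu => pCompUnits_mem_congruenceSubgroup hψ hu)
    exists_unit_limit ?_ (fun s hs m => finite_not_mem_congruenceSubgroup_sup hψ hs m) ?_ g
    (fun p => le_sup_left (a := congruenceSubgroup (isCoordSystem_coordp hψ p.2) (0 + 1)) (hg1 p))
    hg
  · intro p u hu
    have hu1 := congruenceSubgroup_sup_le 0 (hu 0)
    obtain ⟨d, hd⟩ := hu1
    have hdA : d ∈ subringA (isCoordSystem_coordp hψ p.2) :=
      mem_subringA.mpr ((isCoordSystem_coordp hψ p.2).mem_A_of_forall fun m =>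
        (mem_congruenceSubgroup_sup_iff hd).mp (hu m))
    refine ⟨⟨d, hd⟩, ?_⟩
    rw [hd]
    exact add_mem (one_mem (subringA _)) (smul_mem_subringA _ hdA)
  · intro m t ht hfin
    choose d hd using ht
    have hd' : ∀ p, (t p : DiffRing (isCoordSystem_coordp hψ p.2)) =
        1 + (PowerSeries.X : (Cp R p)⟦X⟧) ^ 1 • (PowerSeries.X : (Cp R p)⟦X⟧) ^ m • d p := by
      intro p
      rw [hd, ← mul_smul, ← pow_add, add_comm 1 m]
    obtain ⟨e, he⟩ := exists_modA_one_approx (ψ := ψ) (fun p => (d p).toDiff) (by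
      refine hfin.subset fun p hp h1 => hp ?_
      rw [mem_congruenceSubgroup_sup_iff (hd' p)] at h1
      exact (isCoordSystem_coordp hψ p.2).X_pow_smul_mem_modA_iff.mp h1)
    let e' : DiffRing (isCoordSystem_coord hψ) := e
    obtain ⟨u, hu, -⟩ := DiffRing.exists_unit ((PowerSeries.X : R⟦X⟧) ^ m • e')
    have hu' : (u : DiffRing (isCoordSystem_coord hψ)) =
        1 + (PowerSeries.X : R⟦X⟧) ^ (m + 1) • e' := by
      rw [hu, ← mul_smul, ← pow_add, add_comm 1 m]
    refine ⟨u, ⟨e', hu'⟩, fun p => ?_⟩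
    obtain ⟨c, hc⟩ : ∃ c, ((pCompUnits hψ p u)⁻¹ : (DiffRing (isCoordSystem_coordp hψ p.2))ˣ) =
        (1 : DiffRing (isCoordSystem_coordp hψ p.2)) + (PowerSeries.X : (Cp R p)⟦X⟧) ^ 1 • c :=
      inv_mem (pCompUnits_mem_congruenceSubgroup hψ (p := p)
        (mem_congruenceSubgroup.mpr ⟨_, hu⟩))
    -- multiplication by a unit congruent to `1` does not change the class modulo `q-1`
    have h1 : (↑((pCompUnits hψ p u)⁻¹ * t p) : DiffRing (isCoordSystem_coordp hψ p.2)) =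
        1 + (PowerSeries.X : (Cp R p)⟦X⟧) ^ 1 • (PowerSeries.X : (Cp R p)⟦X⟧) ^ m •
          ((d p - pCompHom hψ p e') + (PowerSeries.X : (Cp R p)⟦X⟧) ^ 1 •
            (c * (d p - pCompHom hψ p e'))) := by
      have h2 : (t p : DiffRing (isCoordSystem_coordp hψ p.2)) = pCompUnits hψ p u +
          (PowerSeries.X : (Cp R p)⟦X⟧) ^ (m + 1) • (d p - pCompHom hψ p e') := by
        rw [hd, val_pCompUnits hψ hu', smul_sub]
        abel
      rw [Units.val_mul, h2, mul_add, Units.inv_mul, DiffRing.mul_X_pow_smul, hc, add_mul,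
        one_mul, DiffRing.smul_mul, ← mul_smul _ _ (_ + _), ← pow_add, add_comm 1 m]
    refine (mem_congruenceSubgroup_sup_iff h1).mpr ?_
    refine (isCoordSystem_coordp hψ p.2).X_pow_smul_mem_modA_iff.mpr (add_mem (he p) ?_)
    exact ⟨0, zero_mem _, (c * (d p - pCompHom hψ p e')).toDiff, (zero_add _).symm⟩

end Sections

/-! ### Adic completions of direct sums -/

section DirectSumCompletion

variable {A ι : Type*} [CommRing A] (I : Ideal A) {M : ι → Type*} [∀ i, AddCommGroup (M i)]
  [∀ i, Module A (M i)]

theorem mem_ideal_smul_top_of_component {J : Ideal A} {z : ⨁ i, M i}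
    (h : ∀ i, z i ∈ (J • ⊤ : Submodule A (M i))) : z ∈ (J • ⊤ : Submodule A (⨁ i, M i)) := by
  classical
  rw [← DirectSum.sum_support_of z]
  refine sum_mem fun i _ => ?_
  have h1 : DirectSum.lof A ι M i (z i) ∈ (J • ⊤ : Submodule A (M i)).map (DirectSum.lof A ι M i) :=
    Submodule.mem_map_of_mem (h i)
  rw [Submodule.map_smul''] at h1
  exact Submodule.smul_mono le_rfl le_top h1

/-- The family of the components of an element of the completion of a direct sum. -/
def completionComponents : AdicCompletion I (⨁ i, M i) →ₗ[A] ∀ i, AdicCompletion I (M i) :=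
  LinearMap.pi fun i => (AdicCompletion.map I (DirectSum.component A ι M i)).restrictScalars A

theorem completionComponents_apply (x : AdicCompletion I (⨁ i, M i)) (i : ι) :
    completionComponents I x i = AdicCompletion.map I (DirectSum.component A ι M i) x := rfl

theorem completionComponents_injective :
    Function.Injective (completionComponents I (M := M)) := by
  rw [← LinearMap.ker_eq_bot, LinearMap.ker_eq_bot']
  intro x hx
  ext m
  obtain ⟨z, hz⟩ := Submodule.Quotient.mk_surjective _ (x.val m)
  rw [AdicCompletion.val_zero_apply, ← hz, Submodule.Quotient.mk_eq_zero]
  refine mem_ideal_smul_top_of_component fun i => ?_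
  have h1 := congrArg (fun y => (y i).val m) hx
  simp only [completionComponents_apply, AdicCompletion.map_val_apply, ← hz] at h1
  exact (Submodule.Quotient.mk_eq_zero _).mp h1

theorem mem_range_completionComponents {y : ∀ i, AdicCompletion I (M i)} :
    y ∈ (completionComponents I (M := M)).range ↔ ∀ m, {i | (y i).val m ≠ 0}.Finite := by
  classical
  constructor
  · rintro ⟨x, rfl⟩ m
    obtain ⟨z, hz⟩ := Submodule.Quotient.mk_surjective _ (x.val m)
    refine (DFinsupp.support z).finite_toSet.subset fun i hi => ?_
    rw [Finset.mem_coe, DFinsupp.mem_support_iff]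
    intro hzi
    refine hi ?_
    rw [completionComponents_apply, AdicCompletion.map_val_apply, ← hz]
    refine (Submodule.Quotient.mk_eq_zero _).mpr ?_
    change z i ∈ _
    rw [hzi]
    exact zero_mem _
  · intro hy
    choose c hc using fun i => AdicCompletion.mk_surjective I (M i) (y i)
    have hval : ∀ i m, (y i).val m = Submodule.Quotient.mk (c i m) := fun i m => by
      rw [← hc]
      rfl
    -- the components outside of a finite set may be truncated modulo `I ^ m`
    let z : ℕ → ⨁ i, M i := fun m => DirectSum.mk M (hy m).toFinset fun i => c i m
    have hz : ∀ m i, z m i - c i m ∈ (I ^ m • ⊤ : Submodule A (M i)) := by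
      intro m i
      by_cases hi : (y i).val m = 0
      · have h1 : z m i = 0 := DirectSum.mk_apply_of_notMem (by simpa using hi)
        rw [h1, zero_sub, neg_mem_iff, ← Submodule.Quotient.mk_eq_zero, ← hval, hi]
      · have h1 : z m i = c i m := DirectSum.mk_apply_of_mem (by simpa using hi)
        rw [h1, sub_self]
        exact zero_mem _
    have hcauchy : ∀ m, z m ≡ z (m + 1) [SMOD (I ^ m • ⊤ : Submodule A (⨁ i, M i))] := by
      intro m
      rw [SModEq.sub_mem]
      refine mem_ideal_smul_top_of_component fun i => ?_
      have h1 := SModEq.sub_mem.mp ((c i).2 (Nat.le_succ m))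
      have h2 := Submodule.smul_mono_left (Ideal.pow_le_pow_right (Nat.le_succ m)) (hz (m + 1) i)
      have h3 : (z m - z (m + 1)) i =
          (z m i - c i m) + (c i m - c i (m + 1)) - (z (m + 1) i - c i (m + 1)) := by
        rw [DirectSum.sub_apply]
        abel
      rw [h3]
      exact sub_mem (add_mem (hz m i) h1) h2
    refine ⟨AdicCompletion.mk I _ (AdicCompletion.AdicCauchySequence.mk I _ z hcauchy), ?_⟩
    ext i m
    rw [completionComponents_apply, AdicCompletion.map_val_apply, hval]
    exact (Submodule.Quotient.eq _).mpr (hz m i)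

/-- A linear map into the completion of a direct sum of precomplete modules amounts to a family of
linear maps into the summands that is almost everywhere trivial modulo every power of the ideal,
and it is bijective if the family is so onto the families with this property. -/
theorem exists_bijective_adicCompletion_directSum {N : Type*} [AddCommGroup N] [Module A N]
    [∀ i, IsPrecomplete I (M i)] (f : ∀ i, N →ₗ[A] M i)
    (hfin : ∀ s m, {i | f i s ∉ (I ^ m • ⊤ : Submodule A (M i))}.Finite)
    (hinj : ∀ s, (∀ i m, f i s ∈ (I ^ m • ⊤ : Submodule A (M i))) → s = 0)
    (hsurj : ∀ t : ∀ i, M i, (∀ m, {i | t i ∉ (I ^ m • ⊤ : Submodule A (M i))}.Finite) →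
      ∃ s, ∀ i, f i s = t i) :
    ∃ Φ : N →ₗ[A] AdicCompletion I (⨁ i, M i),
      (∀ s i, AdicCompletion.map I (DirectSum.component A ι M i) (Φ s) =
        AdicCompletion.of I (M i) (f i s)) ∧ Function.Bijective Φ := by
  have hof : ∀ (t : ∀ i, M i) i m, (AdicCompletion.of I (M i) (t i)).val m = 0 ↔
      t i ∈ (I ^ m • ⊤ : Submodule A (M i)) := fun t i m => Submodule.Quotient.mk_eq_zero _
  let F : N →ₗ[A] ∀ i, AdicCompletion I (M i) :=
    LinearMap.pi fun i => (AdicCompletion.of I (M i)).comp (f i)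
  have hF : ∀ s, F s ∈ (completionComponents I (M := M)).range := fun s =>
    (mem_range_completionComponents I).mpr fun m => (hfin s m).subset fun i hi h =>
      hi ((hof (fun i => f i s) i m).mpr h)
  let e := LinearEquiv.ofInjective _ (completionComponents_injective I (M := M))
  have he : ∀ x : (completionComponents I (M := M)).range,
      completionComponents I (e.symm x) = x := fun x =>
    congrArg Subtype.val (e.apply_symm_apply x)
  refine ⟨e.symm.toLinearMap.comp (F.codRestrict _ hF), fun s i => ?_, ?_, fun x => ?_⟩
  · rw [← completionComponents_apply]
    exact congrArg (· i) (he _)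
  · refine e.symm.injective.comp ((injective_iff_map_eq_zero _).mpr fun s hs => hinj s fun i m => ?_)
    rw [← hof (fun i => f i s)]
    exact congrArg (fun y => (y.1 i).val m) hs
  · choose t ht using fun i => AdicCompletion.of_surjective I (M i) (completionComponents I x i)
    obtain ⟨s, hs⟩ := hsurj t fun m =>
      ((mem_range_completionComponents I).mp ⟨x, rfl⟩ m).subset fun i hi h => hi
        ((hof t i m).mp ((congrArg (fun y => y.val m) (ht i)).trans h))
    refine ⟨s, e.symm_apply_eq.mpr (Subtype.ext (funext fun i => ?_))⟩
    change AdicCompletion.of I (M i) (f i s) = completionComponents I x i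
    rw [hs, ht]

end DirectSumCompletion

/-! ### Bijectivity for the quotient modules -/

section Quotients

variable {R : Type*} [CommRing R] {n : ℕ}

theorem DiffQuot.mk_surjective (ψ : MvPolynomial (Fin n) ℤ →+* R) (p : ℕ) :
    Function.Surjective (DiffQuot.mk ψ p) :=
  Submodule.Quotient.mk_surjective _

theorem DiffQuot.X_pow_smul_mk (ψ : MvPolynomial (Fin n) ℤ →+* R) (p m : ℕ)
    (t : Diff (Cp R p) n) : (PowerSeries.X : R⟦X⟧) ^ m • DiffQuot.mk ψ p t =
      DiffQuot.mk ψ p ((PowerSeries.X : (Cp R p)⟦X⟧) ^ m • t) := by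
  change algebraMap R⟦X⟧ (Cp R p)⟦X⟧ (PowerSeries.X ^ m) • DiffQuot.mk ψ p t = _
  rw [map_pow, algebraMap_X]
  rfl

theorem DiffQuot.mk_mem_pow_smul_top_iff (ψ : MvPolynomial (Fin n) ℤ →+* R) (p m : ℕ)
    (t : Diff (Cp R p) n) :
    DiffQuot.mk ψ p t ∈ (Ideal.span {(PowerSeries.X : R⟦X⟧)} ^ m • ⊤ :
      Submodule R⟦X⟧ (DiffQuot ψ p)) ↔ t ∈ modA (coordp ψ p) m := by
  rw [Ideal.span_singleton_pow, Submodule.ideal_span_singleton_smul,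
    Submodule.mem_smul_pointwise_iff_exists]
  constructor
  · rintro ⟨y, -, hy⟩
    obtain ⟨e, rfl⟩ := DiffQuot.mk_surjective ψ p y
    rw [DiffQuot.X_pow_smul_mk] at hy
    refine ⟨t - (PowerSeries.X : (Cp R p)⟦X⟧) ^ m • e, ?_, e, by abel⟩
    exact (Submodule.Quotient.eq _).mp hy.symm
  · rintro ⟨a, ha, e, rfl⟩
    refine ⟨DiffQuot.mk ψ p e, trivial, ?_⟩
    rw [DiffQuot.X_pow_smul_mk]
    refine (Submodule.Quotient.eq _).mpr ?_
    rw [sub_add_cancel_right]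
    exact neg_mem ha

/-- `Diff / 𝒜_{ψ,p}` inherits completeness from `Diff`. -/
instance (ψ : MvPolynomial (Fin n) ℤ →+* R) (p : ℕ) :
    IsPrecomplete (Ideal.span {(PowerSeries.X : R⟦X⟧)}) (DiffQuot ψ p) where
  prec' f hf := by
    choose e he using fun m => DiffQuot.mk_surjective ψ p (f m)
    have h1 : ∀ m, -e m + e (m + 1) ∈ modA (coordp ψ p) m := by
      intro m
      rw [← DiffQuot.mk_mem_pow_smul_top_iff]
      have h2 := SModEq.sub_mem.mp (hf (Nat.le_succ m)).symm
      rw [← he, ← he] at h2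
      rw [neg_add_eq_sub]
      exact h2
    choose a ha d hd using h1
    -- the representatives are corrected by elements of `𝒜_ψ` to form a Cauchy sequence
    let P : ℕ → Diff (Cp R p) n := fun m => e m - ∑ k ∈ Finset.range m, a k
    obtain ⟨s, hs⟩ := Diff.exists_limit P fun m => ⟨d m, by
      have h3 : e (m + 1) = e m + (a m + (PowerSeries.X : (Cp R p)⟦X⟧) ^ m • d m) := by
        rw [← hd, add_neg_cancel_left]
      simp only [P, Finset.sum_range_succ, h3]
      abel⟩
    refine ⟨DiffQuot.mk ψ p s, fun m => ?_⟩
    rw [SModEq.comm, SModEq.sub_mem, ← he]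
    refine (DiffQuot.mk_mem_pow_smul_top_iff ψ p m (s - e m)).mpr ?_
    obtain ⟨c, hc⟩ := hs m
    refine ⟨-∑ k ∈ Finset.range m, a k, neg_mem (sum_mem fun k _ => ha k), c, ?_⟩
    rw [← hc]
    simp only [P]
    abel

/-- The map `Diff/𝒜_ψ → Diff/𝒜_{ψ,p}` induced by the `p`-adic completion map. -/
def quotCompletion {ψ : MvPolynomial (Fin n) ℤ →+* R} (hψ : ψ.Etale) (p : Nat.Primes) :
    (Diff R n ⧸ A (coord ψ)) →ₗ[R⟦X⟧] DiffQuot ψ p :=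
  Submodule.liftQ _
    { toFun := fun s => DiffQuot.mk ψ p (pComp p s)
      map_add' := fun s t => congrArg (DiffQuot.mk ψ p) (pComp_add p s t)
      map_smul' := fun b s => congrArg (DiffQuot.mk ψ p) (pComp_smul p b s) }
    fun _ hs => (Submodule.Quotient.mk_eq_zero _).mpr (pComp_mem_A hψ p.2 hs)

theorem exists_bijective_quotient {ψ : MvPolynomial (Fin n) ℤ →+* R} (hψ : ψ.Etale) :
    ∃ Φ : (Diff R n ⧸ A (coord ψ)) →ₗ[R⟦X⟧]
        AdicCompletion (Ideal.span {(PowerSeries.X : R⟦X⟧)}) (⨁ p : Nat.Primes, DiffQuot ψ p),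
      (∀ (s : Diff R n) (p : Nat.Primes),
        AdicCompletion.map (Ideal.span {(PowerSeries.X : R⟦X⟧)})
            (DirectSum.component R⟦X⟧ Nat.Primes (fun p => DiffQuot ψ p) p)
            (Φ (Submodule.Quotient.mk s)) =
          AdicCompletion.of (Ideal.span {(PowerSeries.X : R⟦X⟧)}) (DiffQuot ψ p)
            (DiffQuot.mk ψ p (pComp p s))) ∧
      Function.Bijective Φ := by
  refine (exists_bijective_adicCompletion_directSum
    (Ideal.span {(PowerSeries.X : R⟦X⟧)}) (M := fun p : Nat.Primes => DiffQuot ψ p)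
    (quotCompletion hψ) ?_ ?_ ?_).imp fun Φ hΦ => ⟨fun s p => hΦ.1 _ p, hΦ.2⟩
  · intro s m
    obtain ⟨s, rfl⟩ := Submodule.Quotient.mk_surjective _ s
    exact (finite_not_mem_modA hψ m s).subset fun p hp h =>
      hp ((DiffQuot.mk_mem_pow_smul_top_iff ψ p m _).mpr h)
  · intro s hs
    obtain ⟨s, rfl⟩ := Submodule.Quotient.mk_surjective _ s
    rw [Submodule.Quotient.mk_eq_zero]
    exact mem_A_of_forall_pComp hψ fun p => (isCoordSystem_coordp hψ p.2).mem_A_of_forall fun m =>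
      (DiffQuot.mk_mem_pow_smul_top_iff ψ p m _).mp (hs p m)
  · intro t ht
    choose t' ht' using fun p : Nat.Primes => DiffQuot.mk_surjective ψ p (t p)
    obtain ⟨s, hs⟩ := exists_sub_pComp_mem_A hψ t' fun m => (ht m).subset fun p hp h => hp (by
      rw [← ht', DiffQuot.mk_mem_pow_smul_top_iff] at h
      exact h)
    refine ⟨Submodule.Quotient.mk s, fun p => ?_⟩
    rw [← ht']
    exact ((Submodule.Quotient.eq _).mpr (hs p)).symm

end Quotients

/-! ### Bijectivity for the sets of cosets -/

section CosetMap

theorem cosetSpace_mk_eq_mk_iff {S : Type*} [CommRing S] {n : ℕ} {x : Fin n → S}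
    {h : IsCoordSystem x} {G : Set (Diff S n)} {H : Subgroup (DiffRing h)ˣ} {u v : (DiffRing h)ˣ}
    (hu : (u : DiffRing h).toDiff ∈ G) (hv : (v : DiffRing h).toDiff ∈ G) :
    CosetSpace.mk x (unitSet H) hu = CosetSpace.mk x (unitSet H) hv ↔ u⁻¹ * v ∈ H :=
  Subtype.ext_iff.trans coset_unitSet_eq_iff

theorem exists_eq_cosetSpace_mk {S : Type*} [CommRing S] {n : ℕ} {x : Fin n → S}
    {h : IsCoordSystem x} {G H : Subgroup (DiffRing h)ˣ}
    (C : CosetSpace x (unitSet G) (unitSet H)) : ∃ u ∈ G,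
      ∃ hu : (u : DiffRing h).toDiff ∈ unitSet G, C = CosetSpace.mk x (unitSet H) hu := by
  obtain ⟨_, _, ⟨u, hu, rfl⟩, rfl⟩ := C
  exact ⟨u, hu, ⟨u, hu, rfl⟩, rfl⟩

variable {R : Type*} [CommRing R] {n : ℕ} {ψ : MvPolynomial (Fin n) ℤ →+* R} (hψ : ψ.Etale)

/-- The passage from homomorphisms of groups of units to maps between sets of cosets of
differential operators. -/
theorem exists_bijective_cosets {G H : Subgroup (DiffRing (isCoordSystem_coord hψ))ˣ}
    {Gp Hp : ∀ p : Nat.Primes, Subgroup (DiffRing (isCoordSystem_coordp hψ p.2))ˣ}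
    (hG : ∀ p, ∀ u ∈ G, pCompUnits hψ p u ∈ Gp p) (hH : ∀ p, ∀ u ∈ H, pCompUnits hψ p u ∈ Hp p)
    (hfin : ∀ u ∈ G, ∀ m, {p | ¬ ∃ a ∈ Hp p, pCompUnits hψ p u * a ∈
      congruenceSubgroup (isCoordSystem_coordp hψ p.2) m}.Finite)
    (hinj : ∀ u ∈ G, (∀ p, pCompUnits hψ p u ∈ Hp p) → u ∈ H)
    (hsurj : ∀ g : ∀ p : Nat.Primes, (DiffRing (isCoordSystem_coordp hψ p.2))ˣ,
      (∀ p, g p ∈ Gp p) → (∀ m, {p | ¬ ∃ a ∈ Hp p, g p * a ∈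
        congruenceSubgroup (isCoordSystem_coordp hψ p.2) m}.Finite) →
      ∃ s ∈ G, ∀ p, (pCompUnits hψ p s)⁻¹ * g p ∈ Hp p)
    {SG SH : Set (Diff R n)} {SGp SHp : ∀ p : Nat.Primes, Set (Diff (Cp R p) n)}
    (hSG : SG = unitSet G) (hSH : SH = unitSet H)
    (hSGp : ∀ p, SGp p = unitSet (Gp p)) (hSHp : ∀ p, SHp p = unitSet (Hp p)) :
    ∃ Φ : CosetSpace (coord ψ) SG SH →
        RestrictedProduct (fun p : Nat.Primes => coordp ψ p) SGp SHp,
      (∀ (s : Diff R n) (hs : s ∈ SG) (p : Nat.Primes), ∃ hp : pComp p s ∈ SGp p,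
          (Φ (CosetSpace.mk _ _ hs)).1 p = CosetSpace.mk _ _ hp) ∧
      Function.Bijective Φ := by
  obtain rfl : SGp = fun p => unitSet (Gp p) := funext hSGp
  obtain rfl : SHp = fun p => unitSet (Hp p) := funext hSHp
  subst hSG hSH
  choose r hrG hrS hr using exists_eq_cosetSpace_mk (G := G) (H := H)
  have hpG : ∀ p u, u ∈ G →
      (pCompUnits hψ p u : DiffRing (isCoordSystem_coordp hψ p.2)).toDiff ∈ unitSet (Gp p) :=
    fun p u hu => ⟨_, hG p u hu, rfl⟩
  have hrr : ∀ p u (hu : u ∈ G) (hS : (u : DiffRing (isCoordSystem_coord hψ)).toDiff ∈ unitSet G),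
      (pCompUnits hψ p (r (CosetSpace.mk _ (unitSet H) hS)))⁻¹ * pCompUnits hψ p u ∈ Hp p := by
    intro p u hu hS
    have h1 := hH p _ ((cosetSpace_mk_eq_mk_iff _ _).mp (hr (CosetSpace.mk _ (unitSet H) hS)))
    rw [map_mul, map_inv] at h1
    have h2 := inv_mem h1
    rwa [mul_inv_rev, inv_inv] at h2
  let Φ : CosetSpace (coord ψ) (unitSet G) (unitSet H) →
      RestrictedProduct (fun p : Nat.Primes => coordp ψ p) (fun p => unitSet (Gp p))
        (fun p => unitSet (Hp p)) := fun C =>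
    ⟨fun p => CosetSpace.mk _ _ (hpG p (r C) (hrG C)), fun m =>
      (hfin _ (hrG C) m).subset fun p hp h => hp ((isOneMod_mk_iff (hpG p _ (hrG C))).mpr h)⟩
  have hΦ : ∀ C p, (Φ C).1 p = CosetSpace.mk _ _ (hpG p (r C) (hrG C)) := fun C p => rfl
  clear_value Φ
  refine ⟨Φ, ?_, ?_, ?_⟩
  · rintro _ ⟨u, hu, rfl⟩ p
    have h1 : (Φ (CosetSpace.mk _ _ ⟨u, hu, rfl⟩)).1 p =
        CosetSpace.mk (coordp ψ p) (unitSet (Hp p)) (hpG p u hu) :=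
      (hΦ _ p).trans ((cosetSpace_mk_eq_mk_iff _ _).mpr (hrr p u hu _))
    exact ⟨hpG p u hu, h1⟩
  · intro C D hCD
    rw [hr C, hr D, cosetSpace_mk_eq_mk_iff]
    refine hinj _ (mul_mem (inv_mem (hrG C)) (hrG D)) fun p => ?_
    have h1 := congrArg (fun y => y.1 p) hCD
    beta_reduce at h1
    rw [hΦ, hΦ, cosetSpace_mk_eq_mk_iff] at h1
    rwa [map_mul, map_inv]
  · intro y
    choose g hgG hgS hg using fun p => exists_eq_cosetSpace_mk (y.1 p)
    obtain ⟨s, hsG, hs⟩ := hsurj g hgG fun m => (y.2 m).subset fun p hp h => hp (by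
      rw [hg p] at h
      exact (isOneMod_mk_iff (hgS p)).mp h)
    refine ⟨CosetSpace.mk _ _ ⟨s, hsG, rfl⟩, Subtype.ext (funext fun p => ?_)⟩
    rw [hg p, hΦ, cosetSpace_mk_eq_mk_iff]
    have h2 := mul_mem (hrr p s hsG ⟨s, hsG, rfl⟩) (hs p)
    rwa [mul_assoc, mul_inv_cancel_left] at h2

end CosetMap

section Sup

variable {S : Type*} [CommRing S] {n : ℕ} {x : Fin n → S} {h : IsCoordSystem x}

theorem mem_congruenceSubgroup_sup_iff_exists {H : Subgroup (DiffRing h)ˣ} {m : ℕ}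
    {u : (DiffRing h)ˣ} :
    u ∈ congruenceSubgroup h m ⊔ H ↔ ∃ a ∈ H, u * a ∈ congruenceSubgroup h m := by
  rw [Subgroup.mem_sup_of_normal_left]
  constructor
  · rintro ⟨v, hv, w, hw, rfl⟩
    exact ⟨w⁻¹, inv_mem hw, by rwa [mul_inv_cancel_right]⟩
  · rintro ⟨a, ha, hu⟩
    exact ⟨u * a, hu, a⁻¹, inv_mem ha, mul_inv_cancel_right u a⟩

/-- A unital operator whose class modulo `S𝒜_ψ` is trivial modulo `(q-1)^m` has a representative
that is congruent to `1` modulo `(q-1)^m` and differs from it by a unital operator in `S𝒜_ψ`. -/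
theorem exists_unital_mul_mem {m : ℕ} {u : (DiffRing h)ˣ} (hu1 : u ∈ unitalSubgroup h)
    (hu : u ∈ congruenceSubgroup h (m + 1) ⊔ sectionSubgroup h) :
    ∃ a ∈ sectionSubgroup h ⊓ unitalSubgroup h, u * a ∈ congruenceSubgroup h (m + 1) := by
  obtain ⟨a, ha, hua⟩ := mem_congruenceSubgroup_sup_iff_exists.mp hu
  obtain ⟨v, hv, hvm, huv⟩ := exists_mul_mem_unitalSubgroup hua
  refine ⟨a * v, ⟨mul_mem ha hv, ?_⟩, by rw [← mul_assoc]; exact mul_mem hua hvm⟩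
  rw [mul_assoc] at huv
  exact (mul_mem_cancel_left hu1).mp huv

end Sup

section Conclusion

variable {R : Type*} [CommRing R] {n : ℕ}

theorem exists_bijective_sections {ψ : MvPolynomial (Fin n) ℤ →+* R} (hψ : ψ.Etale) :
    ∃ Φ : CosetSpace (coord ψ) (SSet (coord ψ) Set.univ) (SSet (coord ψ) (A (coord ψ))) →
        RestrictedProduct (fun p : Nat.Primes => coordp ψ p)
          (fun p => SSet (coordp ψ p) Set.univ) (fun p => SSet (coordp ψ p) (A (coordp ψ p))),
      (∀ (s : Diff R n) (hs : s ∈ SSet (coord ψ) Set.univ) (p : Nat.Primes),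
        ∃ hp : pComp p s ∈ SSet (coordp ψ p) Set.univ,
          (Φ (CosetSpace.mk _ _ hs)).1 p = CosetSpace.mk _ _ hp) ∧
      Function.Bijective Φ := by
  refine exists_bijective_cosets hψ
    (fun p u hu => pCompUnits_mem_congruenceSubgroup hψ hu)
    (fun p u hu => pCompUnits_mem_sectionSubgroup hψ hu) ?_
    (fun u hu h => mem_sectionSubgroup_of_forall hψ hu h) ?_
    (SSet_univ_eq _) (SSet_A_eq _) (fun p => SSet_univ_eq _) (fun p => SSet_A_eq _)
  · intro u hu m
    refine (finite_not_mem_congruenceSubgroup_sup hψ hu m).subset fun p hp h => hp ?_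
    obtain ⟨a, ha, hua⟩ := mem_congruenceSubgroup_sup_iff_exists.mp h
    exact ⟨a, ha, congruenceSubgroup_antitone (Nat.le_succ m) hua⟩
  · intro g hg hfin
    exact exists_pCompUnits_inv_mul_mem hψ g hg fun m => (hfin (m + 1)).subset fun p hp h =>
      hp (mem_congruenceSubgroup_sup_iff_exists.mpr h)

theorem exists_bijective_unital_sections {ψ : MvPolynomial (Fin n) ℤ →+* R} (hψ : ψ.Etale) :
    ∃ Φ : CosetSpace (coord ψ) (SSet1 (coord ψ) Set.univ) (SSet1 (coord ψ) (A (coord ψ))) →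
        RestrictedProduct (fun p : Nat.Primes => coordp ψ p)
          (fun p => SSet1 (coordp ψ p) Set.univ) (fun p => SSet1 (coordp ψ p) (A (coordp ψ p))),
      (∀ (s : Diff R n) (hs : s ∈ SSet1 (coord ψ) Set.univ) (p : Nat.Primes),
        ∃ hp : pComp p s ∈ SSet1 (coordp ψ p) Set.univ,
          (Φ (CosetSpace.mk _ _ hs)).1 p = CosetSpace.mk _ _ hp) ∧
      Function.Bijective Φ := by
  refine exists_bijective_cosets hψ
    (G := congruenceSubgroup (isCoordSystem_coord hψ) 1 ⊓ unitalSubgroup _)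
    (H := sectionSubgroup _ ⊓ unitalSubgroup _)
    (Gp := fun p => congruenceSubgroup (isCoordSystem_coordp hψ p.2) 1 ⊓ unitalSubgroup _)
    (Hp := fun p => sectionSubgroup _ ⊓ unitalSubgroup _)
    (fun p u hu => ⟨pCompUnits_mem_congruenceSubgroup hψ hu.1,
      pCompUnits_mem_unitalSubgroup hψ hu.2⟩)
    (fun p u hu => ⟨pCompUnits_mem_sectionSubgroup hψ hu.1,
      pCompUnits_mem_unitalSubgroup hψ hu.2⟩) ?_
    (fun u hu h => ⟨mem_sectionSubgroup_of_forall hψ hu.1 fun p => (h p).1, hu.2⟩) ?_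
    (SSet1_eq _ (SSet_univ_eq _)) (SSet1_eq _ (SSet_A_eq _))
    (fun p => SSet1_eq _ (SSet_univ_eq _)) (fun p => SSet1_eq _ (SSet_A_eq _))
  · intro u hu m
    refine (finite_not_mem_congruenceSubgroup_sup hψ hu.1 m).subset fun p hp h => hp ?_
    obtain ⟨a, ha, hua⟩ := exists_unital_mul_mem (pCompUnits_mem_unitalSubgroup hψ hu.2) h
    exact ⟨a, ha, congruenceSubgroup_antitone (Nat.le_succ m) hua⟩
  · intro g hg hfin
    obtain ⟨s, hs1, hs⟩ := exists_pCompUnits_inv_mul_mem hψ g (fun p => (hg p).1) fun m =>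
      (hfin (m + 1)).subset fun p hp h => by
        obtain ⟨a, ha, hga⟩ := h
        exact hp (mem_congruenceSubgroup_sup_iff_exists.mpr ⟨a, ha.1, hga⟩)
    obtain ⟨v, hv, hv1, hsv⟩ := exists_mul_mem_unitalSubgroup (m := 0) hs1
    refine ⟨s * v, ⟨mul_mem hs1 hv1, hsv⟩, fun p => Subgroup.mem_inf.mpr ⟨?_, ?_⟩⟩
    · rw [map_mul, mul_inv_rev, mul_assoc]
      exact mul_mem (inv_mem (pCompUnits_mem_sectionSubgroup hψ hv)) (hs p)
    · exact mul_mem (inv_mem (pCompUnits_mem_unitalSubgroup hψ hsv)) (hg p).2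

end Conclusion

end QDiff

end

theorem mainTheorem10 {R : Type*} [CommRing R] {n : ℕ} (ψ : MvPolynomial (Fin n) ℤ →+* R)
    (hψ : ψ.Etale) :
    -- bijectivity for the quotients of the rings of differential operators
    (∃ Φ : (QDiff.Diff R n ⧸ QDiff.A (QDiff.coord ψ)) →ₗ[R⟦X⟧]
        AdicCompletion (Ideal.span {(PowerSeries.X : R⟦X⟧)})
          (⨁ p : Nat.Primes, QDiff.DiffQuot ψ p),
      (∀ (s : QDiff.Diff R n) (p : Nat.Primes),
        AdicCompletion.map (Ideal.span {(PowerSeries.X : R⟦X⟧)})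
            (DirectSum.component R⟦X⟧ Nat.Primes (fun p => QDiff.DiffQuot ψ p) p)
            (Φ (Submodule.Quotient.mk s)) =
          AdicCompletion.of (Ideal.span {(PowerSeries.X : R⟦X⟧)}) (QDiff.DiffQuot ψ p)
            (QDiff.DiffQuot.mk ψ p (QDiff.pComp p s))) ∧
      Function.Bijective Φ) ∧
    -- bijectivity for the quotients of the groups of sections
    (∃ Φ : QDiff.CosetSpace (QDiff.coord ψ)
          (QDiff.SSet (QDiff.coord ψ) Set.univ)
          (QDiff.SSet (QDiff.coord ψ) (QDiff.A (QDiff.coord ψ))) →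
        QDiff.RestrictedProduct (fun p : Nat.Primes => QDiff.coordp ψ p)
          (fun p => QDiff.SSet (QDiff.coordp ψ p) Set.univ)
          (fun p => QDiff.SSet (QDiff.coordp ψ p) (QDiff.A (QDiff.coordp ψ p))),
      (∀ (s : QDiff.Diff R n) (hs : s ∈ QDiff.SSet (QDiff.coord ψ) Set.univ) (p : Nat.Primes),
        ∃ hp : QDiff.pComp p s ∈ QDiff.SSet (QDiff.coordp ψ p) Set.univ,
          (Φ (QDiff.CosetSpace.mk _ _ hs)).1 p = QDiff.CosetSpace.mk _ _ hp) ∧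
      Function.Bijective Φ) ∧
    -- the same for the sections `s` that satisfy in addition `s(1) = 1`
    (∃ Φ : QDiff.CosetSpace (QDiff.coord ψ)
          (QDiff.SSet1 (QDiff.coord ψ) Set.univ)
          (QDiff.SSet1 (QDiff.coord ψ) (QDiff.A (QDiff.coord ψ))) →
        QDiff.RestrictedProduct (fun p : Nat.Primes => QDiff.coordp ψ p)
          (fun p => QDiff.SSet1 (QDiff.coordp ψ p) Set.univ)
          (fun p => QDiff.SSet1 (QDiff.coordp ψ p) (QDiff.A (QDiff.coordp ψ p))),
      (∀ (s : QDiff.Diff R n) (hs : s ∈ QDiff.SSet1 (QDiff.coord ψ) Set.univ) (p : Nat.Primes),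
        ∃ hp : QDiff.pComp p s ∈ QDiff.SSet1 (QDiff.coordp ψ p) Set.univ,
          (Φ (QDiff.CosetSpace.mk _ _ hs)).1 p = QDiff.CosetSpace.mk _ _ hp) ∧
      Function.Bijective Φ) := by
  exact ⟨QDiff.exists_bijective_quotient hψ, QDiff.exists_bijective_sections hψ,
    QDiff.exists_bijective_unital_sections hψ⟩
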